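/- Let $\mathbb{K}$ be any field, let $G$ be a finite simple graph on the vertex set $[n]=\{1,\dots,n\}$, and let $S=\mathbb{K}[x_1,\dots,x_n,y_1,\dots,y_n]$ with the standard grading. For an edge $e=\{u,v\}$ put $\bar g_e=x_ux_v-y_uy_v$, let $\mathcal{I}_G=(\bar g_e : e\in E(G))\subset S$ be the parity binomial edge ideal of $G$, and let $G\setminus e$ denote the graph on $[n]$ with edge set $E(G)\setminus\{e\}$. For a finitely generated graded $S$-module $M$, let $\beta_{i,j}(M)$ denote its $(i,j)$-th graded Betti number, i.e. the number of summands $S(-j)$ in the $i$-th step of the minimal graded free resolution of $M$ over $S$. Then: 1. $\beta_{2,3}(S/\mathcal{I}_G)=0$, and moreover $\beta_{i,i+1}(S/\mathcal{I}_G)=0$ for all $i\neq 1$. 2. If $G\neq K_2$, then $\beta_{2,4}(S/\mathcal{I}_G)\geq\binom{|E(G)|}{2}$. 3. For every edge $e\in E(G)$ and every $i>0$, $\beta_{i,i}\bigl(S/(\mathcal{I}_{G\setminus e}:\bar g_e)\bigr)=0$. 4. If $G$ is non-bipartite, then $\beta_{3,6}(S/\mathcal{I}_G)\neq 0$. 5.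 If $G$ is odd unicyclic (that is, $G$ contains exactly one cycle, and its length is odd), then $\beta_{i,j}(S/\mathcal{I}_G)=0$ whenever $j>2i$. -/

import Mathlib

/-- The homogeneous components of the cyclic module `S ⧸ I`, where `S = K[σ]` has its standard
grading: the images of the spaces of homogeneous polynomials of degree `d`. For a homogeneous
ideal `I` this is the induced standard grading of `S ⧸ I`. -/
noncomputable def quotientGrading {σ K : Type*} [Field K] (I : Ideal (MvPolynomial σ K)) (d : ℕ) :
    Submodule K (MvPolynomial σ K ⧸ I) :=
  (MvPolynomial.homogeneousSubmodule σ K d).map (Ideal.Quotient.mkₐ K I).toLinearMap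

/-- A minimal graded free resolution `⋯ → F₂ → F₁ → F₀ → M → 0` of an `ℕ`-graded module `M` over
the standard graded polynomial ring `S = K[σ]`, the graded components of `M` being `𝓜 d`.

Here `Fᵢ = ⨁ₐ S(-deg i a)` is the finite graded free module with basis indexed by `Fin (rank i)`,
the `a`-th basis vector having degree `deg i a`. For finite `σ` such a resolution is automatically
of finite length. -/
structure MinimalGradedFreeResolution {σ K M : Type*} [Field K] [AddCommGroup M] [Module K M]
    [Module (MvPolynomial σ K) M] (𝓜 : ℕ → Submodule K M) where
  /-- The rank of the `i`-th free module `Fᵢ`. -/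
  rank : ℕ → ℕ
  /-- The degrees of the basis vectors of `Fᵢ`. -/
  deg : (i : ℕ) → Fin (rank i) → ℕ
  /-- The differential `Fᵢ₊₁ → Fᵢ`. -/
  d : (i : ℕ) → (Fin (rank (i + 1)) → MvPolynomial σ K) →ₗ[MvPolynomial σ K]
    (Fin (rank i) → MvPolynomial σ K)
  /-- The augmentation `F₀ → M`. -/
  aug : (Fin (rank 0) → MvPolynomial σ K) →ₗ[MvPolynomial σ K] M
  /-- The augmentation is homogeneous of degree zero. -/
  aug_mem : ∀ a : Fin (rank 0), aug (Pi.single a 1) ∈ 𝓜 (deg 0 a)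
  /-- The differentials are homogeneous of degree zero: each matrix entry is zero or homogeneous
  of degree the difference of the degrees of the two basis vectors. -/
  d_homogeneous : ∀ (i : ℕ) (b : Fin (rank (i + 1))) (a : Fin (rank i)),
    d i (Pi.single b 1) a = 0 ∨
      ∃ k : ℕ, deg (i + 1) b = deg i a + k ∧ (d i (Pi.single b 1) a).IsHomogeneous k
  aug_surjective : Function.Surjective aug
  exact_zero : Function.Exact (d 0) aug
  exact_succ : ∀ i : ℕ, Function.Exact (d (i + 1)) (d i)
  /-- Minimality: all matrix entries of the differentials lie in the irrelevant maximal ideal. -/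
  minimal : ∀ (i : ℕ) (b : Fin (rank (i + 1))) (a : Fin (rank i)),
    MvPolynomial.constantCoeff (d i (Pi.single b 1) a) = 0

/-- The number of summands `S(-j)` in the `i`-th free module of a minimal resolution. -/
def MinimalGradedFreeResolution.betti {σ K M : Type*} [Field K] [AddCommGroup M] [Module K M]
    [Module (MvPolynomial σ K) M] {𝓜 : ℕ → Submodule K M}
    (F : MinimalGradedFreeResolution (σ := σ) 𝓜) (i j : ℕ) : ℕ :=
  Fintype.card {a : Fin (F.rank i) // F.deg i a = j}

open Classical in
/-- The graded Betti number `β_{i,j}(M)`: the number of summands `S(-j)` in the `i`-th step of the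
minimal graded free resolution of `M`. The resolution exists for each finitely generated graded
module over a polynomial ring in finitely many variables, and is unique up to isomorphism, so that
the choice of it does not matter. -/
noncomputable def gradedBetti (σ : Type*) {K M : Type*} [Field K] [AddCommGroup M] [Module K M]
    [Module (MvPolynomial σ K) M] (𝓜 : ℕ → Submodule K M) (i j : ℕ) : ℕ :=
  if h : Nonempty (MinimalGradedFreeResolution (σ := σ) 𝓜) then h.some.betti i j else 0

/-- The graded Betti number `β_{i,j}(S/I)` of the cyclic module `S/I`. -/
noncomputable def quotientBetti {σ K : Type*} [Field K] (I : Ideal (MvPolynomial σ K))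
    (i j : ℕ) : ℕ :=
  gradedBetti σ (quotientGrading I) i j

/-- `S = K[x_v, y_v : v ∈ V]`; the variable `x_v` is `X (Sum.inl v)` and `y_v` is
`X (Sum.inr v)`. -/
abbrev EdgeRing (V K : Type*) [Field K] : Type _ := MvPolynomial (V ⊕ V) K

/-- The binomial `ḡ_{u,v} = x_u x_v - y_u y_v`. -/
noncomputable def gBar {V : Type*} (K : Type*) [Field K] (u v : V) : EdgeRing V K :=
  MvPolynomial.X (Sum.inl u) * MvPolynomial.X (Sum.inl v)
    - MvPolynomial.X (Sum.inr u) * MvPolynomial.X (Sum.inr v)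

/-- The parity binomial edge ideal of a graph. -/
noncomputable def parityIdeal {V : Type*} (K : Type*) [Field K] (G : SimpleGraph V) :
    Ideal (EdgeRing V K) :=
  Ideal.span {f | ∃ u v : V, G.Adj u v ∧ f = gBar K u v}

/-- A graph is unicyclic if it contains exactly one cycle. Two closed walks that are cycles
describe the same cycle of the graph when they have the same edges. -/
def IsUnicyclic {V : Type*} (G : SimpleGraph V) : Prop :=
  ∃! C : Set (Sym2 V), ∃ (v : V) (p : G.Walk v v), p.IsCycle ∧ C = {e | e ∈ p.edges}

/-- A graph is odd unicyclic if it is unicyclic and its girth is odd. -/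
def IsOddUnicyclic {V : Type*} (G : SimpleGraph V) : Prop :=
  IsUnicyclic G ∧ Odd G.girth

/-! Graded Betti numbers are controlled by the comparison theorem for resolutions. A minimal
resolution is bounded, degree by degree, by every graded resolution (`quotientBetti_le`), and Betti
numbers do not drop along an algebra retract (`le_quotientBetti`). Minimal resolutions are
constructed by iterating minimal homogeneous generators of syzygies.

Statements 1 to 3 rest on one observation about coefficients (`exists_coeff_mul_gBar`). For an edge
`uv` and a monomial `m` of degree at most one there is a monomial `M` that detects `m` in `p * gBar
K u v` and occurs in no multiple of the binomial of another pair of distinct vertices. Hence the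
edge binomials are minimal generators, their relations have coefficients without terms of degree at
most one, and step two lives in degrees at least four. Degrees grow strictly along a minimal
resolution, so the linear strand vanishes. The same observation shows that the colon ideal has no
terms of degree at most one. The commutation syzygies of pairs of generators have degree four and
are independent over `K`, which gives the binomial bound.

For statement 4, a non-bipartite graph contains a triangle or an induced path on four vertices. Its
three binomials form a regular sequence, so the Koszul complex has a generator of degree six in step
three. Setting the remaining variables to zero is an algebra retract, which carries this generator
over to the whole graph.

For statement 5, removing an edge of the odd cycle leaves a forest in which the two ends of that
edge have the same colour. Interchanging `x` and `y` on one colour class turns the binomials of the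
forest into the minors `fBin` of a binomial edge ideal, and preserves the remaining binomial up to
sign. Generators are then added one at a time: if `J` and `J : p` have resolutions with degrees at
most `2 * i` in step `i`, and `p` has degree at most two, the mapping cone shows the same for `J +
(p)`. For this recursion (`QuadTower`) the colon ideals must stay in the class. The class used
consists of binomial edge ideals of chordal graphs with some vertices deleted, chordal graphs being
given as intersection graphs of subtrees of a rooted forest. The colon ideals are determined by a
nonzerodivisor criterion (`mem_bIdeal_of_mul_mem`): Ohtani's decomposition reduces it to disjoint
unions of cliques, whose ideals are kernels of monomial maps into a domain. -/

open MvPolynomial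

/-! ### Graded free modules, homogeneous components and minimal homogeneous generators. -/

section GradedLinearAlgebra

variable {σ K : Type*} [Field K] {α β γ : Type*}

/-- All monomials of the vector `x`, in the graded free module with basis degrees `deg`, have
degrees in `Q`. -/
def DegSupp (deg : α → ℕ) (Q : Set ℕ) (x : α → MvPolynomial σ K) : Prop :=
  ∀ a m, coeff m (x a) ≠ 0 → m.degree + deg a ∈ Q

/-- The component of degree `j` of a vector in a graded free module. -/
noncomputable def degComp (deg : α → ℕ) (j : ℕ) (x : α → MvPolynomial σ K) :
    α → MvPolynomial σ K :=
  -- Without the guard, truncated subtraction would keep the constant term of `x a` when `deg a`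
  -- exceeds `j`.
  fun a => if deg a ≤ j then homogeneousComponent (j - deg a) (x a) else 0

lemma coeff_degComp (deg : α → ℕ) (j : ℕ) (x : α → MvPolynomial σ K) (a : α) (m : σ →₀ ℕ) :
    coeff m (degComp deg j x a) = if m.degree + deg a = j then coeff m (x a) else 0 := by
  unfold degComp
  by_cases h : deg a ≤ j
  · rw [if_pos h, coeff_homogeneousComponent]
    congr 1
    exact propext ⟨fun h' => by omega, fun h' => by omega⟩
  · rw [if_neg h, coeff_zero, if_neg (by omega)]

lemma degSupp_degComp (deg : α → ℕ) (j : ℕ) (x : α → MvPolynomial σ K) :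
    DegSupp deg {j} (degComp deg j x) := by
  intro a m h
  rw [coeff_degComp] at h
  by_contra h'
  exact h (if_neg h')

lemma degSupp_sub_degComp (deg : α → ℕ) (j : ℕ) (x : α → MvPolynomial σ K) :
    DegSupp deg {j}ᶜ (x - degComp deg j x) := by
  intro a m h h'
  simp only [Set.mem_singleton_iff] at h'
  apply h
  rw [Pi.sub_apply, coeff_sub, coeff_degComp, if_pos h', sub_self]

lemma DegSupp.zero (deg : α → ℕ) (Q : Set ℕ) : DegSupp deg Q (0 : α → MvPolynomial σ K) :=
  fun _ m h => absurd (coeff_zero m) h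

lemma DegSupp.add {deg : α → ℕ} {Q : Set ℕ} {x y : α → MvPolynomial σ K}
    (hx : DegSupp deg Q x) (hy : DegSupp deg Q y) : DegSupp deg Q (x + y) := by
  intro a m h
  by_cases h1 : coeff m (x a) = 0
  · exact hy a m fun h2 => h (by rw [Pi.add_apply, coeff_add, h1, h2, add_zero])
  · exact hx a m h1

lemma DegSupp.neg {deg : α → ℕ} {Q : Set ℕ} {x : α → MvPolynomial σ K}
    (hx : DegSupp deg Q x) : DegSupp deg Q (-x) := by
  intro a m h
  exact hx a m fun h2 => h (by rw [Pi.neg_apply, coeff_neg, h2, neg_zero])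

lemma DegSupp.sub {deg : α → ℕ} {Q : Set ℕ} {x y : α → MvPolynomial σ K}
    (hx : DegSupp deg Q x) (hy : DegSupp deg Q y) : DegSupp deg Q (x - y) := by
  rw [sub_eq_add_neg]; exact hx.add hy.neg

lemma DegSupp.sum {ι : Type*} {deg : α → ℕ} {Q : Set ℕ} (s : Finset ι)
    {x : ι → α → MvPolynomial σ K} (hx : ∀ i ∈ s, DegSupp deg Q (x i)) :
    DegSupp deg Q (∑ i ∈ s, x i) := by
  classical
  induction s using Finset.induction_on with
  | empty => simpa using DegSupp.zero deg Q
  | insert i s hi ih =>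
    rw [Finset.sum_insert hi]
    exact (hx i (Finset.mem_insert_self i s)).add
      (ih fun k hk => hx k (Finset.mem_insert_of_mem hk))

lemma eq_zero_of_degSupp {deg : α → ℕ} {j : ℕ} {x : α → MvPolynomial σ K}
    (h1 : DegSupp deg {j} x) (h2 : DegSupp deg {j}ᶜ x) : x = 0 := by
  funext a
  ext m
  by_contra h
  exact h2 a m (by simpa using h) (h1 a m (by simpa using h))

lemma degComp_eq_self {deg : α → ℕ} {j : ℕ} {x : α → MvPolynomial σ K}
    (h : DegSupp deg {j} x) : degComp deg j x = x := by
  have := eq_zero_of_degSupp (h.sub (degSupp_degComp deg j x)) (degSupp_sub_degComp deg j x)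
  exact (sub_eq_zero.mp this).symm

lemma degComp_zero (deg : α → ℕ) (j : ℕ) :
    degComp deg j (0 : α → MvPolynomial σ K) = 0 :=
  degComp_eq_self (DegSupp.zero deg _)

lemma exists_coeff_ne_zero_of_mul {p q : MvPolynomial σ K} {m : σ →₀ ℕ}
    (h : coeff m (p * q) ≠ 0) :
    ∃ m₁ m₂, m₁ + m₂ = m ∧ coeff m₁ p ≠ 0 ∧ coeff m₂ q ≠ 0 := by
  classical
  rw [coeff_mul] at h
  obtain ⟨⟨m₁, m₂⟩, hm, hne⟩ := Finset.exists_ne_zero_of_sum_ne_zero h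
  exact ⟨m₁, m₂, Finset.HasAntidiagonal.mem_antidiagonal.mp hm, left_ne_zero_of_mul hne,
    right_ne_zero_of_mul hne⟩

lemma DegSupp.linearCombination [Fintype α] {degα : α → ℕ} {degβ : β → ℕ} {Q : Set ℕ}
    {D : α → β → MvPolynomial σ K} (hD : ∀ a, DegSupp degβ {degα a} (D a))
    {x : α → MvPolynomial σ K} (hx : DegSupp degα Q x) :
    DegSupp degβ Q (Fintype.linearCombination (MvPolynomial σ K) D x) := by
  rw [Fintype.linearCombination_apply]
  refine DegSupp.sum _ fun a _ => ?_
  intro b m h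
  obtain ⟨m₁, m₂, rfl, h1, h2⟩ := exists_coeff_ne_zero_of_mul h
  have e1 := hx a m₁ h1
  have e2 : m₂.degree + degβ b = degα a := hD a b m₂ h2
  rw [map_add, add_assoc, e2]
  exact e1

/-- The difference of the two sides is supported in degree `j` and also away from degree `j`, so it
vanishes. This makes kernels graded and lets homogeneous elements of the image be lifted
homogeneously. -/
lemma linearCombination_degComp [Fintype α] {degα : α → ℕ} {degβ : β → ℕ}
    {D : α → β → MvPolynomial σ K} (hD : ∀ a, DegSupp degβ {degα a} (D a)) (j : ℕ)
    (x : α → MvPolynomial σ K) :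
    Fintype.linearCombination (MvPolynomial σ K) D (degComp degα j x) =
      degComp degβ j (Fintype.linearCombination (MvPolynomial σ K) D x) := by
  set L := Fintype.linearCombination (MvPolynomial σ K) D
  refine sub_eq_zero.mp (eq_zero_of_degSupp (deg := degβ) (j := j) ?_ ?_)
  · exact ((degSupp_degComp degα j x).linearCombination hD).sub (degSupp_degComp _ _ _)
  · have h1 := (degSupp_sub_degComp degα j x).linearCombination hD
    have h2 := degSupp_sub_degComp degβ j (L x)
    have : L (degComp degα j x) - degComp degβ j (L x)
        = (L x - degComp degβ j (L x)) - L (x - degComp degα j x) := by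
      rw [map_sub]; abel
    rw [this]
    exact h2.sub h1

lemma exists_degSupp_preimage [Fintype α] {degα : α → ℕ} {degβ : β → ℕ}
    {D : α → β → MvPolynomial σ K} (hD : ∀ a, DegSupp degβ {degα a} (D a)) {j : ℕ}
    {y : β → MvPolynomial σ K} (hy : DegSupp degβ {j} y) {x : α → MvPolynomial σ K}
    (hx : Fintype.linearCombination (MvPolynomial σ K) D x = y) :
    ∃ x', DegSupp degα {j} x' ∧ Fintype.linearCombination (MvPolynomial σ K) D x' = y :=
  ⟨degComp degα j x, degSupp_degComp _ _ _, by
    rw [linearCombination_degComp hD, hx, degComp_eq_self hy]⟩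

lemma constantCoeff_eq_zero_of_degSupp {deg : α → ℕ} {j : ℕ} {x : α → MvPolynomial σ K}
    (hx : DegSupp deg {j} x) {a : α} (h : deg a ≠ j) : constantCoeff (x a) = 0 := by
  by_contra h'
  have := hx a 0 h'
  simp at this
  exact h this

lemma isHomogeneous_iff_degSupp {p : MvPolynomial σ K} {k : ℕ} :
    p.IsHomogeneous k ↔ ∀ m, coeff m p ≠ 0 → m.degree = k :=
  ⟨fun h m hm => by_contra fun h' => hm (h.coeff_eq_zero h'), fun h m hm => by
    rw [← h m hm, Finsupp.degree_eq_weight_one]; rfl⟩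

lemma DegSupp.isHomogeneous {deg : α → ℕ} {j : ℕ} {x : α → MvPolynomial σ K}
    (hx : DegSupp deg {j} x) (a : α) : x a = 0 ∨ ∃ k, j = deg a + k ∧ (x a).IsHomogeneous k := by
  by_cases h : deg a ≤ j
  · refine Or.inr ⟨j - deg a, by omega, isHomogeneous_iff_degSupp.mpr fun m hm => ?_⟩
    have : m.degree + deg a = j := hx a m hm
    omega
  · left
    ext m
    by_contra h'
    have : m.degree + deg a = j := hx a m (by rwa [coeff_zero] at h')
    omega

lemma degSupp_of_isHomogeneous {deg : α → ℕ} {j : ℕ} {x : α → MvPolynomial σ K}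
    (hx : ∀ a, x a = 0 ∨ ∃ k, j = deg a + k ∧ (x a).IsHomogeneous k) : DegSupp deg {j} x := by
  intro a m hm
  rcases hx a with h | ⟨k, h1, h2⟩
  · simp [h] at hm
  · have := isHomogeneous_iff_degSupp.mp h2 m hm
    simp only [Set.mem_singleton_iff]
    omega

/-- A submodule of a graded free module that contains the homogeneous components of its
elements. -/
def IsGradedSubmodule (deg : α → ℕ) (N : Submodule (MvPolynomial σ K) (α → MvPolynomial σ K)) :
    Prop :=
  ∀ x ∈ N, ∀ j, degComp deg j x ∈ N

lemma isGradedSubmodule_ker [Fintype α] {degα : α → ℕ} {degβ : β → ℕ}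
    {D : α → β → MvPolynomial σ K} (hD : ∀ a, DegSupp degβ {degα a} (D a)) :
    IsGradedSubmodule degα
      (LinearMap.ker (Fintype.linearCombination (MvPolynomial σ K) D)) := by
  intro x hx j
  rw [LinearMap.mem_ker] at hx ⊢
  rw [linearCombination_degComp hD, hx]
  exact degComp_zero degβ j

lemma eq_sum_degComp [Fintype α] (deg : α → ℕ) (x : α → MvPolynomial σ K) :
    ∃ n, x = ∑ j ∈ Finset.range n, degComp deg j x := by
  refine ⟨∑ a, (deg a + (x a).totalDegree) + 1, ?_⟩
  funext a
  ext m
  rw [Finset.sum_apply, coeff_sum]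
  rw [Finset.sum_congr rfl fun j _ => coeff_degComp deg j x a m, Finset.sum_ite_eq]
  by_cases h : coeff m (x a) = 0
  · simp [h]
  · rw [if_pos]
    have h1 : m.degree ≤ (x a).totalDegree := le_totalDegree (mem_support_iff.mpr h)
    have h2 := Finset.single_le_sum (f := fun a => deg a + (x a).totalDegree)
      (fun _ _ => Nat.zero_le _) (Finset.mem_univ a)
    rw [Finset.mem_range]
    omega

/-- A finite family of homogeneous elements that generates `N`. -/
structure IsHomogGen (deg : α → ℕ) (N : Submodule (MvPolynomial σ K) (α → MvPolynomial σ K))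
    (e : β → ℕ) (g : β → α → MvPolynomial σ K) : Prop where
  homog : ∀ b, DegSupp deg {e b} (g b)
  span : Submodule.span (MvPolynomial σ K) (Set.range g) = N

/-- A family of vectors all of whose relations have coefficients in the irrelevant ideal. -/
def IsMinimalFamily [Fintype β] (g : β → α → MvPolynomial σ K) : Prop :=
  ∀ x, Fintype.linearCombination (MvPolynomial σ K) g x = 0 → ∀ b, constantCoeff (x b) = 0

/-- Noetherianity gives a finite homogeneous generating family; one of least size is minimal.
Indeed, if a relation has a nonzero constant coefficient at `b₀`, its component in the degree of `g
b₀` is a relation whose coefficient at `b₀` is a unit, and `g b₀` could be dropped. -/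
theorem exists_minimal_homogGen [Finite σ] [Fintype α] (deg : α → ℕ)
    (N : Submodule (MvPolynomial σ K) (α → MvPolynomial σ K)) (hN : IsGradedSubmodule deg N) :
    ∃ (r : ℕ) (e : Fin r → ℕ) (g : Fin r → α → MvPolynomial σ K),
      IsHomogGen deg N e g ∧ IsMinimalFamily g := by
  classical
  have hex : ∃ (r : ℕ) (e : Fin r → ℕ) (g : Fin r → α → MvPolynomial σ K),
      IsHomogGen deg N e g := by
    set s : Set (α → MvPolynomial σ K) := {x | x ∈ N ∧ ∃ j, DegSupp deg {j} x}
    have hs : Submodule.span (MvPolynomial σ K) s = N := by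
      apply le_antisymm
      · rw [Submodule.span_le]
        exact fun x hx => hx.1
      · intro x hx
        obtain ⟨n, hn⟩ := eq_sum_degComp deg x
        rw [hn]
        exact Submodule.sum_mem _ fun j _ =>
          Submodule.subset_span ⟨hN x hx j, j, degSupp_degComp _ _ _⟩
    have hfg : N.FG := IsNoetherian.noetherian N
    rw [← hs, Submodule.fg_span_iff_fg_span_finset_subset] at hfg
    obtain ⟨t, hts, ht⟩ := hfg
    have hd : ∀ x : t, ∃ j, DegSupp deg {j} x.1 := fun x => (hts x.2).2
    choose e he using hd
    refine ⟨t.card, fun i => e (t.equivFin.symm i), fun i => (t.equivFin.symm i).1,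
      fun i => he _, ?_⟩
    rw [← hs, ht]
    congr 1
    ext x
    constructor
    · rintro ⟨i, rfl⟩
      exact (t.equivFin.symm i).2
    · intro hx
      exact ⟨t.equivFin ⟨x, hx⟩, by simp⟩
  obtain ⟨e, g, hg⟩ := Nat.find_spec hex
  refine ⟨Nat.find hex, e, g, hg, ?_⟩
  intro x hx b₀
  by_contra hb
  have hlt : 0 < Nat.find hex := Fin.pos b₀
  obtain ⟨r, hr⟩ : ∃ r, Nat.find hex = r + 1 := ⟨Nat.find hex - 1, by omega⟩
  -- The length is generalized to `k` so that `subst` can turn it into `r + 1`, as `Fin.succAbove`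
  -- requires.
  have key : ∀ k (hk : k = r + 1) (e : Fin k → ℕ) (g : Fin k → α → MvPolynomial σ K)
      (_ : IsHomogGen deg N e g) (x : Fin k → MvPolynomial σ K)
      (_ : Fintype.linearCombination (MvPolynomial σ K) g x = 0) (b₀ : Fin k)
      (_ : constantCoeff (x b₀) ≠ 0), False := by
    intro k hk
    subst hk
    intro e g hg x hx b₀ hb
    refine Nat.find_min hex (m := r) (by omega)
      ⟨fun i => e (b₀.succAbove i), fun i => g (b₀.succAbove i), fun i => hg.homog _, ?_⟩
    set z := degComp e (e b₀) x
    have hz : Fintype.linearCombination (MvPolynomial σ K) g z = 0 := by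
      rw [linearCombination_degComp hg.homog, hx, degComp_zero]
    -- In degree `e b₀` the coefficient of a basis vector of that same degree has degree zero, so
    -- only the constant term survives.
    have hzb : z b₀ = C (constantCoeff (x b₀)) := by
      ext m
      rw [coeff_degComp, coeff_C]
      by_cases h : m = 0
      · subst h; simp [constantCoeff]
      · rw [if_neg, if_neg (Ne.symm h)]
        intro h'
        exact h ((Finsupp.degree_eq_zero_iff m).mp (by omega))
    apply le_antisymm
    · rw [Submodule.span_le]
      rintro _ ⟨i, rfl⟩
      rw [← hg.span]
      exact Submodule.subset_span ⟨_, rfl⟩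
    · rw [← hg.span, Submodule.span_le]
      rintro _ ⟨b, rfl⟩
      have hmem : ∀ i, g (b₀.succAbove i) ∈ Submodule.span (MvPolynomial σ K)
          (Set.range fun i => g (b₀.succAbove i)) := fun i => Submodule.subset_span ⟨i, rfl⟩
      rcases Fin.eq_self_or_eq_succAbove b₀ b with rfl | ⟨i, rfl⟩
      · rw [Fintype.linearCombination_apply, Fin.sum_univ_succAbove _ b, hzb] at hz
        have h1 : (C (constantCoeff (x b)) : MvPolynomial σ K) • g b ∈ Submodule.span (MvPolynomial σ K)
            (Set.range fun i => g (b.succAbove i)) := by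
          rw [eq_neg_of_add_eq_zero_left hz]
          exact Submodule.neg_mem _ (Submodule.sum_mem _ fun i _ =>
            Submodule.smul_mem _ _ (hmem i))
        have h2 := (Submodule.span (MvPolynomial σ K) (Set.range fun i => g (b.succAbove i))).smul_mem
          (C (constantCoeff (x b))⁻¹) h1
        rwa [smul_smul, ← C_mul, inv_mul_cancel₀ hb, C_1, one_smul] at h2
      · exact hmem i
  exact key _ hr e g hg x hx b₀ hb

end GradedLinearAlgebra

/-! ### Graded resolutions in matrix form. -/

section Resolutions

variable {σ K : Type*} [Field K]

/-- A graded free resolution of `S ⧸ I`, where the differentials are given by the images of the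
basis vectors. -/
structure GradedRes (I : Ideal (MvPolynomial σ K)) where
  ι : ℕ → Type
  fintype : ∀ i, Fintype (ι i)
  deg : ∀ i, ι i → ℕ
  d : ∀ i, ι (i + 1) → ι i → MvPolynomial σ K
  aug : ι 0 → MvPolynomial σ K ⧸ I
  aug_mem : ∀ a, aug a ∈ quotientGrading I (deg 0 a)
  d_homog : ∀ i b, DegSupp (deg i) {deg (i + 1) b} (d i b)
  aug_surjective : Function.Surjective (Fintype.linearCombination (MvPolynomial σ K) aug)
  aug_d : ∀ b, Fintype.linearCombination (MvPolynomial σ K) aug (d 0 b) = 0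
  exact_zero : ∀ x, Fintype.linearCombination (MvPolynomial σ K) aug x = 0 →
    ∃ y, Fintype.linearCombination (MvPolynomial σ K) (d 0) y = x
  d_d : ∀ i b, Fintype.linearCombination (MvPolynomial σ K) (d i) (d (i + 1) b) = 0
  exact_succ : ∀ i x, Fintype.linearCombination (MvPolynomial σ K) (d i) x = 0 →
    ∃ y, Fintype.linearCombination (MvPolynomial σ K) (d (i + 1)) y = x

attribute [instance] GradedRes.fintype

/-- Homogeneous elements of `S ⧸ I` lift to homogeneous elements of the free module in step zero. -/
def GradedRes.AugSurjective {I : Ideal (MvPolynomial σ K)} (P : GradedRes I) : Prop :=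
  ∀ j, ∀ m ∈ quotientGrading I j, ∃ y, DegSupp (P.deg 0) {j} y ∧
    Fintype.linearCombination (MvPolynomial σ K) P.aug y = m

/-- The entries of the differentials lie in the irrelevant ideal. -/
def GradedRes.IsMinimal {I : Ideal (MvPolynomial σ K)} (P : GradedRes I) : Prop :=
  ∀ i b a, constantCoeff (P.d i b a) = 0

lemma linearMap_eq_linearCombination {ι M : Type*} [Fintype ι] [DecidableEq ι] {R : Type*}
    [CommRing R] [AddCommGroup M] [Module R M] (f : (ι → R) →ₗ[R] M) :
    Fintype.linearCombination R (fun a => f (Pi.single a 1)) = f := by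
  refine LinearMap.pi_ext' fun a => LinearMap.ext_ring ?_
  simp

/-- The resolution underlying a minimal graded free resolution of `S ⧸ I`. -/
noncomputable def MinimalGradedFreeResolution.toGradedRes {I : Ideal (MvPolynomial σ K)}
    (F : MinimalGradedFreeResolution (σ := σ) (quotientGrading I)) : GradedRes I where
  ι i := Fin (F.rank i)
  fintype _ := inferInstance
  deg := F.deg
  d i b := F.d i (Pi.single b 1)
  aug a := F.aug (Pi.single a 1)
  aug_mem := F.aug_mem
  d_homog i b := degSupp_of_isHomogeneous (F.d_homogeneous i b)
  aug_surjective := by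
    rw [linearMap_eq_linearCombination]
    exact F.aug_surjective
  aug_d b := by
    rw [linearMap_eq_linearCombination]
    exact F.exact_zero.apply_apply_eq_zero _
  exact_zero x h := by
    rw [linearMap_eq_linearCombination] at h ⊢
    exact (F.exact_zero x).mp h
  d_d i b := by
    rw [linearMap_eq_linearCombination]
    exact (F.exact_succ i).apply_apply_eq_zero _
  exact_succ i x h := by
    rw [linearMap_eq_linearCombination] at h ⊢
    exact (F.exact_succ i x).mp h

lemma MinimalGradedFreeResolution.toGradedRes_isMinimal {I : Ideal (MvPolynomial σ K)}
    (F : MinimalGradedFreeResolution (σ := σ) (quotientGrading I)) : F.toGradedRes.IsMinimal :=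
  fun i b a => F.minimal i b a

lemma mk_mem_quotientGrading {I : Ideal (MvPolynomial σ K)} {p : MvPolynomial σ K} {j : ℕ}
    (hp : p.IsHomogeneous j) : Ideal.Quotient.mk I p ∈ quotientGrading I j :=
  ⟨p, hp, rfl⟩

lemma exists_of_mem_quotientGrading {I : Ideal (MvPolynomial σ K)} {m : MvPolynomial σ K ⧸ I}
    {j : ℕ} (hm : m ∈ quotientGrading I j) :
    ∃ p : MvPolynomial σ K, p.IsHomogeneous j ∧ Ideal.Quotient.mk I p = m :=
  hm

end Resolutions

/-! ### Existence of minimal graded free resolutions with prescribed first generators. -/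

section Existence

variable {σ K : Type*} [Field K]

/-- A graded submodule of a finite graded free module. -/
structure GradedSubmoduleData (σ K : Type*) [Field K] where
  rank : ℕ
  deg : Fin rank → ℕ
  N : Submodule (MvPolynomial σ K) (Fin rank → MvPolynomial σ K)
  graded : IsGradedSubmodule deg N

variable [Finite σ]

/-- The number of chosen minimal generators. -/
noncomputable def GradedSubmoduleData.genRank (s : GradedSubmoduleData σ K) : ℕ :=
  (exists_minimal_homogGen s.deg s.N s.graded).choose

/-- The degrees of the chosen minimal generators. -/
noncomputable def GradedSubmoduleData.genDeg (s : GradedSubmoduleData σ K) : Fin s.genRank → ℕ :=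
  (exists_minimal_homogGen s.deg s.N s.graded).choose_spec.choose

/-- Chosen minimal generators of a graded submodule. -/
noncomputable def GradedSubmoduleData.gen (s : GradedSubmoduleData σ K) :
    Fin s.genRank → Fin s.rank → MvPolynomial σ K :=
  (exists_minimal_homogGen s.deg s.N s.graded).choose_spec.choose_spec.choose

lemma GradedSubmoduleData.gen_isHomogGen (s : GradedSubmoduleData σ K) :
    IsHomogGen s.deg s.N s.genDeg s.gen :=
  (exists_minimal_homogGen s.deg s.N s.graded).choose_spec.choose_spec.choose_spec.1

lemma GradedSubmoduleData.gen_isMinimalFamily (s : GradedSubmoduleData σ K) :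
    IsMinimalFamily s.gen :=
  (exists_minimal_homogGen s.deg s.N s.graded).choose_spec.choose_spec.choose_spec.2

/-- The module of relations of the chosen minimal generators. -/
noncomputable def GradedSubmoduleData.next (s : GradedSubmoduleData σ K) :
    GradedSubmoduleData σ K where
  rank := s.genRank
  deg := s.genDeg
  N := LinearMap.ker (Fintype.linearCombination (MvPolynomial σ K) s.gen)
  graded := isGradedSubmodule_ker s.gen_isHomogGen.homog

/-- The iterated modules of relations. -/
noncomputable def GradedSubmoduleData.syz (s : GradedSubmoduleData σ K) :
    ℕ → GradedSubmoduleData σ K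
  | 0 => s
  | i + 1 => (s.syz i).next

variable {r : ℕ} {e : Fin r → ℕ} {g : Fin r → Fin 1 → MvPolynomial σ K}

/-- The relations between homogeneous generators of an ideal. -/
noncomputable def relationData (hg : ∀ b, DegSupp (fun _ => 0) {e b} (g b)) :
    GradedSubmoduleData σ K where
  rank := r
  deg := e
  N := LinearMap.ker (Fintype.linearCombination (MvPolynomial σ K) g)
  graded := isGradedSubmodule_ker hg

/-- The ranks in the minimal resolution with prescribed first step. -/
noncomputable def resRank (hg : ∀ b, DegSupp (fun _ => 0) {e b} (g b)) : ℕ → ℕ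
  | 0 => 1
  | i + 1 => ((relationData hg).syz i).rank

/-- The degrees in the minimal resolution with prescribed first step. -/
noncomputable def resDeg (hg : ∀ b, DegSupp (fun _ => 0) {e b} (g b)) :
    ∀ i, Fin (resRank hg i) → ℕ
  | 0 => fun _ => 0
  | i + 1 => ((relationData hg).syz i).deg

/-- The differentials in the minimal resolution with prescribed first step. -/
noncomputable def resD (hg : ∀ b, DegSupp (fun _ => 0) {e b} (g b)) :
    ∀ i, Fin (resRank hg (i + 1)) → Fin (resRank hg i) → MvPolynomial σ K
  | 0 => g
  | i + 1 => ((relationData hg).syz i).gen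

lemma resD_homog (hg : ∀ b, DegSupp (fun _ => 0) {e b} (g b)) (i : ℕ)
    (b : Fin (resRank hg (i + 1))) :
    DegSupp (resDeg hg i) {resDeg hg (i + 1) b} (resD hg i b) :=
  match i with
  | 0 => hg b
  | i + 1 => ((relationData hg).syz i).gen_isHomogGen.homog b

lemma resD_range (hg : ∀ b, DegSupp (fun _ => 0) {e b} (g b)) (i : ℕ) :
    LinearMap.range (Fintype.linearCombination (MvPolynomial σ K) (resD hg (i + 1))) =
      LinearMap.ker (Fintype.linearCombination (MvPolynomial σ K) (resD hg i)) := by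
  rw [Fintype.range_linearCombination]
  refine (((relationData hg).syz i).gen_isHomogGen.span).trans ?_
  -- For `i = 0` the module is the kernel in `relationData`, for a successor the kernel in `next`;
  -- both are the stated kernel by definition, but only after the case split.
  cases i <;> rfl

lemma resD_minimalFamily (hg : ∀ b, DegSupp (fun _ => 0) {e b} (g b)) (hmin : IsMinimalFamily g)
    (i : ℕ) : IsMinimalFamily (resD hg i) :=
  match i with
  | 0 => hmin
  | i + 1 => ((relationData hg).syz i).gen_isMinimalFamily

/-- Every minimal homogeneous system of generators of an ideal is the first step of a minimal
graded free resolution. -/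
theorem exists_minimalResolution {I : Ideal (MvPolynomial σ K)}
    (hg : ∀ b, DegSupp (fun _ => 0) {e b} (g b)) (hmin : IsMinimalFamily g)
    (hI : Ideal.span (Set.range fun b => g b 0) = I) (hI1 : ∀ x ∈ I, constantCoeff x = 0) :
    ∃ F : MinimalGradedFreeResolution (σ := σ) (quotientGrading I),
      F.toGradedRes.AugSurjective ∧ (∀ a, F.deg 0 a = 0) ∧ (∀ b, ∃ c, F.deg 1 b = e c) ∧
      ∃ D : Fin (F.rank 2) → Fin r → MvPolynomial σ K,
        (∀ b, DegSupp e {F.deg 2 b} (D b)) ∧ IsMinimalFamily D ∧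
        LinearMap.range (Fintype.linearCombination (MvPolynomial σ K) D) =
          LinearMap.ker (Fintype.linearCombination (MvPolynomial σ K) g) := by
  have hd : ∀ i b, Fintype.linearCombination (MvPolynomial σ K) (resD hg i) (Pi.single b 1) =
      resD hg i b := fun i b => by simp
  have hrange0 : ∀ x : Fin 1 → MvPolynomial σ K, x ∈ LinearMap.range
      (Fintype.linearCombination (MvPolynomial σ K) g) ↔ x 0 ∈ I := by
    intro x
    rw [Fintype.range_linearCombination, ← hI]
    let ev : (Fin 1 → MvPolynomial σ K) ≃ₗ[MvPolynomial σ K] MvPolynomial σ K :=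
      LinearEquiv.funUnique (Fin 1) _ _
    have h1 : Ideal.span (Set.range fun b => g b 0) =
        (Submodule.span (MvPolynomial σ K) (Set.range g)).map ev.toLinearMap := by
      rw [Submodule.map_span, ← Set.range_comp]
      rfl
    rw [h1]
    constructor
    · intro h
      exact ⟨x, h, rfl⟩
    · rintro ⟨y, hy, hyx⟩
      have : y = x := ev.injective hyx
      exact this ▸ hy
  let aug : (Fin 1 → MvPolynomial σ K) →ₗ[MvPolynomial σ K] MvPolynomial σ K ⧸ I :=
    (Submodule.mkQ I).comp (LinearMap.proj 0)
  have haug : ∀ x, aug x = Ideal.Quotient.mk I (x 0) := fun x => rfl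
  have haug_mem : ∀ a, aug (Pi.single a 1) ∈ quotientGrading I 0 := by
    intro a
    obtain rfl : a = 0 := Subsingleton.elim _ _
    rw [haug]
    exact mk_mem_quotientGrading (by simpa using isHomogeneous_one σ K)
  have hexact : Function.Exact (Fintype.linearCombination (MvPolynomial σ K) g) aug := by
    intro x
    rw [haug, Ideal.Quotient.eq_zero_iff_mem]
    exact (hrange0 x).symm
  have hmin0 : ∀ b a, constantCoeff (g b a) = 0 := by
    intro b a
    obtain rfl : a = 0 := Subsingleton.elim _ _
    exact hI1 _ (hI ▸ Ideal.subset_span ⟨b, rfl⟩)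
  let F : MinimalGradedFreeResolution (σ := σ) (quotientGrading I) :=
    { rank := resRank hg
      deg := resDeg hg
      d := fun i => Fintype.linearCombination (MvPolynomial σ K) (resD hg i)
      aug := aug
      aug_mem := haug_mem
      d_homogeneous := by
        intro i b a
        rw [hd]
        exact (resD_homog hg i b).isHomogeneous a
      aug_surjective := by
        intro m
        obtain ⟨p, rfl⟩ := Ideal.Quotient.mk_surjective m
        exact ⟨fun _ => p, rfl⟩
      exact_zero := hexact
      exact_succ := by
        intro i
        rw [LinearMap.exact_iff]
        exact (resD_range hg i).symm
      minimal := by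
        intro i b a
        rw [hd]
        cases i with
        | zero => exact hmin0 b a
        | succ i =>
          -- A column of the next differential is a relation of the minimal family of this step,
          -- hence has entries without constant term.
          refine resD_minimalFamily hg hmin i _ ?_ a
          rw [← LinearMap.mem_ker, ← resD_range]
          exact ⟨Pi.single b 1, hd _ _⟩ }
  refine ⟨F, ?_, fun a => rfl, fun b => ⟨b, rfl⟩, resD hg 1, resD_homog hg 1,
    resD_minimalFamily hg hmin 1, resD_range hg 0⟩
  intro j m hm
  obtain ⟨p, hp, rfl⟩ := exists_of_mem_quotientGrading hm
  refine ⟨fun _ => p, degSupp_of_isHomogeneous fun a => Or.inr ⟨j, (Nat.zero_add j).symm, hp⟩, ?_⟩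
  change Fintype.linearCombination _ (fun a => aug (Pi.single a 1)) _ = _
  rw [linearMap_eq_linearCombination]
  rfl

end Existence

/-- Dependent choice for a sequence whose terms lie in varying types. It produces the lift of a map
to resolutions, where step `i + 1` depends on step `i`. -/
lemma exists_dependent_seq {X : ℕ → Type*} (p : ∀ i, X i → Prop) (R : ∀ i, X i → X (i + 1) → Prop)
    (h0 : ∃ x, p 0 x) (hs : ∀ i x, p i x → ∃ y, p (i + 1) y ∧ R i x y) :
    ∃ x : ∀ i, X i, ∀ i, p i (x i) ∧ R i (x i) (x (i + 1)) := by
  choose f hf using fun i (x : {x : X i // p i x}) => hs i x.1 x.2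
  let s : ∀ i, {x : X i // p i x} := fun i =>
    Nat.rec (motive := fun i => {x : X i // p i x}) ⟨h0.choose, h0.choose_spec⟩
      (fun i x => ⟨f i x, (hf i x).1⟩) i
  exact ⟨fun i => (s i).1, fun i => ⟨(s i).2, (hf i (s i)).2⟩⟩

/-! ### Comparison of resolutions, semilinear over a ring endomorphism, and bounds for Betti
numbers. -/

section Comparison

variable {σ K : Type*} [Field K]

/-- The `ρ`-semilinear extension of a family of vectors to the free module. -/
noncomputable def semilin {ι M : Type*} [Fintype ι] [AddCommGroup M] [Module (MvPolynomial σ K) M]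
    (ρ : MvPolynomial σ K →+* MvPolynomial σ K) (φ : ι → M) (x : ι → MvPolynomial σ K) : M :=
  Fintype.linearCombination (MvPolynomial σ K) φ (fun a => ρ (x a))

variable {ι κ M : Type*} [Fintype ι] [Fintype κ] [AddCommGroup M] [Module (MvPolynomial σ K) M]
  {ρ : MvPolynomial σ K →+* MvPolynomial σ K}

lemma linearCombination_comp (D : ι → M) (φ : κ → ι → MvPolynomial σ K)
    (x : κ → MvPolynomial σ K) :
    Fintype.linearCombination (MvPolynomial σ K) D
        (Fintype.linearCombination (MvPolynomial σ K) φ x) =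
      Fintype.linearCombination (MvPolynomial σ K)
        (fun b => Fintype.linearCombination (MvPolynomial σ K) D (φ b)) x := by
  simp only [Fintype.linearCombination_apply (MvPolynomial σ K) φ x, map_sum, map_smul]
  rw [Fintype.linearCombination_apply]

lemma semilin_comp (φ : ι → M) (D : κ → ι → MvPolynomial σ K) (x : κ → MvPolynomial σ K) :
    semilin ρ φ (Fintype.linearCombination (MvPolynomial σ K) D x) =
      semilin ρ (fun b => semilin ρ φ (D b)) x := by
  have : (fun a => ρ (Fintype.linearCombination (MvPolynomial σ K) D x a)) =
      Fintype.linearCombination (MvPolynomial σ K) (fun b a => ρ (D b a)) (fun b => ρ (x b)) := by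
    funext a
    simp [Fintype.linearCombination_apply, Finset.sum_apply]
  rw [semilin, this, linearCombination_comp]
  rfl

lemma semilin_zero (φ : ι → M) : semilin ρ φ 0 = 0 := by
  simp [semilin, Fintype.linearCombination_apply]

lemma semilin_sub (φ φ' : ι → M) (x : ι → MvPolynomial σ K) :
    semilin ρ (fun a => φ a - φ' a) x = semilin ρ φ x - semilin ρ φ' x := by
  simp [semilin, Fintype.linearCombination_apply, smul_sub]

lemma linearCombination_semilin (D : ι → M) (φ : κ → ι → MvPolynomial σ K)
    (x : κ → MvPolynomial σ K) :
    Fintype.linearCombination (MvPolynomial σ K) D (semilin ρ φ x) =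
      semilin ρ (fun b => Fintype.linearCombination (MvPolynomial σ K) D (φ b)) x :=
  linearCombination_comp D φ _

variable {I J : Ideal (MvPolynomial σ K)}

lemma GradedRes.linearCombination_d_d (P : GradedRes I) (i : ℕ) (x) :
    Fintype.linearCombination (MvPolynomial σ K) (P.d i)
      (Fintype.linearCombination (MvPolynomial σ K) (P.d (i + 1)) x) = 0 := by
  rw [linearCombination_comp, Fintype.linearCombination_apply]
  exact Finset.sum_eq_zero fun b _ => by rw [P.d_d, smul_zero]

lemma GradedRes.linearCombination_aug_d (P : GradedRes I) (x) :
    Fintype.linearCombination (MvPolynomial σ K) P.aug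
      (Fintype.linearCombination (MvPolynomial σ K) (P.d 0) x) = 0 := by
  rw [linearCombination_comp, Fintype.linearCombination_apply]
  exact Finset.sum_eq_zero fun b _ => by rw [P.aug_d, smul_zero]

/-- A semilinear map of resolutions lifting `f`. -/
structure IsLift (P : GradedRes I) (Q : GradedRes J) (ρ : MvPolynomial σ K →+* MvPolynomial σ K)
    (f : (MvPolynomial σ K ⧸ I) →ₛₗ[ρ] (MvPolynomial σ K ⧸ J))
    (φ : ∀ i, P.ι i → Q.ι i → MvPolynomial σ K) : Prop where
  aug : ∀ a, Fintype.linearCombination (MvPolynomial σ K) Q.aug (φ 0 a) = f (P.aug a)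
  comm : ∀ i b, Fintype.linearCombination (MvPolynomial σ K) (Q.d i) (φ (i + 1) b) =
    semilin ρ (φ i) (P.d i b)

variable {P : GradedRes I} {Q : GradedRes J}
  {f : (MvPolynomial σ K ⧸ I) →ₛₗ[ρ] (MvPolynomial σ K ⧸ J)}

lemma aug_semilin {φ : P.ι 0 → Q.ι 0 → MvPolynomial σ K}
    (h : ∀ a, Fintype.linearCombination (MvPolynomial σ K) Q.aug (φ a) = f (P.aug a)) (x) :
    Fintype.linearCombination (MvPolynomial σ K) Q.aug (semilin ρ φ x) =
      f (Fintype.linearCombination (MvPolynomial σ K) P.aug x) := by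
  rw [linearCombination_semilin, semilin, Fintype.linearCombination_apply,
    Fintype.linearCombination_apply, map_sum]
  exact Finset.sum_congr rfl fun a _ => by rw [map_smulₛₗ, h]

lemma IsLift.comm_apply {φ : ∀ i, P.ι i → Q.ι i → MvPolynomial σ K} (h : IsLift P Q ρ f φ) (i : ℕ)
    (x) : Fintype.linearCombination (MvPolynomial σ K) (Q.d i) (semilin ρ (φ (i + 1)) x) =
      semilin ρ (φ i) (Fintype.linearCombination (MvPolynomial σ K) (P.d i) x) := by
  rw [linearCombination_semilin, semilin_comp]
  congr 1
  exact funext (h.comm i)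

/-- The usual lifting by freeness and exactness. The sets `T` carry a side condition on the images
of basis vectors: no condition for ungraded lifts, the correct degree for graded ones. Semilinearity
over `ρ` is needed because the retraction onto an induced subgraph is not linear over the polynomial
ring. -/
theorem exists_lift (P : GradedRes I) (Q : GradedRes J)
    (f : (MvPolynomial σ K ⧸ I) →ₛₗ[ρ] (MvPolynomial σ K ⧸ J))
    (T : ∀ i, P.ι i → Set (Q.ι i → MvPolynomial σ K))
    (h0 : ∀ a, ∃ y ∈ T 0 a, Fintype.linearCombination (MvPolynomial σ K) Q.aug y = f (P.aug a))
    (hT : ∀ i (φ : P.ι i → Q.ι i → MvPolynomial σ K), (∀ a, φ a ∈ T i a) → ∀ b y,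
      Fintype.linearCombination (MvPolynomial σ K) (Q.d i) y = semilin ρ φ (P.d i b) →
      ∃ y' ∈ T (i + 1) b,
        Fintype.linearCombination (MvPolynomial σ K) (Q.d i) y' = semilin ρ φ (P.d i b)) :
    ∃ φ : ∀ i, P.ι i → Q.ι i → MvPolynomial σ K, IsLift P Q ρ f φ ∧ ∀ i a, φ i a ∈ T i a := by
  choose φ₀ hφ₀ hφ₀' using h0
  obtain ⟨φ, hφ⟩ := exists_dependent_seq (X := fun i => P.ι i → Q.ι i → MvPolynomial σ K)
    (fun i φ => (∀ a, φ a ∈ T i a) ∧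
      (∀ b, ∃ y, Fintype.linearCombination (MvPolynomial σ K) (Q.d i) y =
        semilin ρ φ (P.d i b)) ∧
      -- The sequence must start with `φ₀` for compatibility with the augmentations. Since the type
      -- of `φ` depends on `i`, this is recorded as a heterogeneous equality.
      (i = 0 → ∀ k : ℕ, ∀ hk : i = k, HEq φ φ₀))
    (fun i φ φ' => ∀ b, Fintype.linearCombination (MvPolynomial σ K) (Q.d i) (φ' b) =
      semilin ρ φ (P.d i b))
    ⟨φ₀, hφ₀, fun b => Q.exact_zero _ (by rw [aug_semilin hφ₀', P.aug_d, map_zero]),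
      fun _ _ _ => HEq.rfl⟩
    (fun i φ ⟨h1, h2, _⟩ => by
      choose y hy using h2
      choose φ' hφ' hφ'' using fun b => hT i φ h1 b (y b) (hy b)
      refine ⟨φ', ⟨hφ', fun b => Q.exact_succ i _ ?_, fun h => by omega⟩, hφ''⟩
      rw [linearCombination_semilin]
      simp only [hφ'']
      rw [← semilin_comp, P.d_d, semilin_zero])
  refine ⟨φ, ⟨fun a => ?_, fun i b => (hφ i).2 b⟩, fun i => (hφ i).1.1⟩
  rw [eq_of_heq ((hφ 0).1.2.2 rfl 0 rfl), hφ₀']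

/-- Two lifts of the same map into a minimal resolution agree modulo the irrelevant ideal. -/
theorem IsLift.constantCoeff_eq {φ φ' : ∀ i, P.ι i → Q.ι i → MvPolynomial σ K}
    (h : IsLift P Q ρ f φ) (h' : IsLift P Q ρ f φ') (hP : P.IsMinimal) (hQ : Q.IsMinimal)
    (hρ : ∀ p, constantCoeff (ρ p) = constantCoeff p) (i : ℕ) (a : P.ι i) (c : Q.ι i) :
    constantCoeff (φ i a c) = constantCoeff (φ' i a c) := by
  have hmin : ∀ {i} (y : Q.ι (i + 1) → MvPolynomial σ K) (c),
      constantCoeff (Fintype.linearCombination (MvPolynomial σ K) (Q.d i) y c) = 0 := by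
    intro i y c
    rw [Fintype.linearCombination_apply, Finset.sum_apply, map_sum]
    exact Finset.sum_eq_zero fun b _ => by simp [hQ i b c]
  have hδ : ∀ i b, Fintype.linearCombination (MvPolynomial σ K) (Q.d i)
      (φ (i + 1) b - φ' (i + 1) b) = semilin ρ (fun a => φ i a - φ' i a) (P.d i b) := by
    intro i b
    rw [map_sub, h.comm, h'.comm, semilin_sub]
  -- The chain homotopy `η` is built step by step. It writes the difference of the lifts as `d η + η
  -- d`; the first term has no constant part because `Q` is minimal, the second because `P` is
  -- minimal and `ρ` preserves constant terms.
  have key : ∀ i, ∃ η : P.ι i → Q.ι (i + 1) → MvPolynomial σ K,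
      (∀ b, Fintype.linearCombination (MvPolynomial σ K) (Q.d i)
        (φ (i + 1) b - φ' (i + 1) b - semilin ρ η (P.d i b)) = 0) ∧
      ∀ a c, constantCoeff (φ i a c) = constantCoeff (φ' i a c) := by
    intro i
    induction i with
    | zero =>
      have h0 : ∀ a, ∃ y, Fintype.linearCombination (MvPolynomial σ K) (Q.d 0) y =
          φ 0 a - φ' 0 a := fun a => Q.exact_zero _ (by rw [map_sub, h.aug, h'.aug, sub_self])
      choose η hη using h0
      refine ⟨η, fun b => ?_, fun a c => ?_⟩
      · rw [map_sub, hδ, linearCombination_semilin]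
        simp only [hη, sub_self]
      · have := hmin (η a) c
        rwa [hη, Pi.sub_apply, map_sub, sub_eq_zero] at this
    | succ i ih =>
      obtain ⟨η₀, hη₀, -⟩ := ih
      choose η hη using fun b => Q.exact_succ i _ (hη₀ b)
      refine ⟨η, fun b => ?_, fun a c => ?_⟩
      · rw [map_sub, hδ, linearCombination_semilin]
        simp only [hη]
        rw [semilin_sub (fun b => φ (i + 1) b - φ' (i + 1) b), ← semilin_comp η₀, P.d_d,
          semilin_zero, sub_zero, sub_self]
      · have := hmin (η a) c
        rw [hη, Pi.sub_apply, Pi.sub_apply, map_sub, map_sub] at this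
        have h2 : constantCoeff (semilin ρ η₀ (P.d i a) c) = 0 := by
          rw [semilin, Fintype.linearCombination_apply, Finset.sum_apply, map_sum]
          exact Finset.sum_eq_zero fun b _ => by simp [hρ, hP i a b]
        rwa [h2, sub_zero, sub_eq_zero] at this
  obtain ⟨η, -, hη⟩ := key i
  exact hη a c

lemma card_le_card_of_matrix_mul_eq_one {F m n : Type*} [Field F] [Fintype m] [Fintype n]
    [DecidableEq m] {A : Matrix m n F} {B : Matrix n m F} (h : A * B = 1) :
    Fintype.card m ≤ Fintype.card n := by
  have h1 := Matrix.rank_mul_le_left A B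
  rw [h, Matrix.rank_one] at h1
  exact h1.trans (Matrix.rank_le_card_width A)

/-- The number of basis vectors of degree `j` in step `i`. -/
noncomputable def GradedRes.betti (P : GradedRes I) (i j : ℕ) : ℕ :=
  Nat.card {a : P.ι i // P.deg i a = j}

lemma isLift_ungraded_exists (P : GradedRes I) (Q : GradedRes J)
    (f : (MvPolynomial σ K ⧸ I) →ₛₗ[ρ] (MvPolynomial σ K ⧸ J)) :
    ∃ φ, IsLift P Q ρ f φ := by
  obtain ⟨φ, h, -⟩ := exists_lift P Q f (fun _ _ => Set.univ)
    (fun a => (Q.aug_surjective (f (P.aug a))).imp fun y hy => ⟨trivial, hy⟩)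
    (fun i φ _ b y hy => ⟨y, trivial, hy⟩)
  exact ⟨φ, h⟩

lemma DegSupp.semilin {α β : Type*} [Fintype α] {degα : α → ℕ} {degβ : β → ℕ} {j d : ℕ}
    (hρ : ∀ p k, p.IsHomogeneous k → (ρ p).IsHomogeneous k)
    {φ : α → β → MvPolynomial σ K} (hφ : ∀ a, DegSupp degβ {degα a + d} (φ a))
    {x : α → MvPolynomial σ K} (hx : DegSupp degα {j} x) :
    DegSupp degβ {j + d} (semilin ρ φ x) := by
  refine DegSupp.linearCombination (degα := fun a => degα a + d) hφ ?_
  refine degSupp_of_isHomogeneous fun a => ?_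
  rcases hx.isHomogeneous a with h | ⟨k, h1, h2⟩
  · exact Or.inl (by rw [h, map_zero])
  · exact Or.inr ⟨k, by omega, hρ _ _ h2⟩

lemma isLift_graded_exists (P : GradedRes I) (Q : GradedRes J) (hQ : Q.AugSurjective)
    (f : (MvPolynomial σ K ⧸ I) →ₛₗ[ρ] (MvPolynomial σ K ⧸ J)) (d : ℕ)
    (hρ : ∀ p k, p.IsHomogeneous k → (ρ p).IsHomogeneous k)
    (hf : ∀ j, ∀ m ∈ quotientGrading I j, f m ∈ quotientGrading J (j + d)) :
    ∃ φ, IsLift P Q ρ f φ ∧ ∀ i a, DegSupp (Q.deg i) {P.deg i a + d} (φ i a) :=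
  exists_lift P Q f (fun i a => {y | DegSupp (Q.deg i) {P.deg i a + d} y})
    (fun a => hQ _ _ (hf _ _ (P.aug_mem a)))
    (fun i _ hφ b _ hy =>
      exists_degSupp_preimage (Q.d_homog i) ((P.d_homog i b).semilin hρ hφ) hy)

/-- If the identity of a minimal resolution `P` factors through `Q` modulo the irrelevant ideal,
one of the factors being graded, then `Q` has at least as many basis vectors as `P`. -/
theorem betti_le_of_lift
    {φ : ∀ i, P.ι i → Q.ι i → MvPolynomial σ K} {ψ : ∀ i, Q.ι i → P.ι i → MvPolynomial σ K}
    {f : (MvPolynomial σ K ⧸ I) →ₗ[MvPolynomial σ K] (MvPolynomial σ K ⧸ J)}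
    {f' : (MvPolynomial σ K ⧸ J) →ₛₗ[ρ] (MvPolynomial σ K ⧸ I)}
    (hf : ∀ a, f' (f (P.aug a)) = P.aug a) (hρP : ∀ i b a, ρ (P.d i b a) = P.d i b a)
    (hP : P.IsMinimal) (hφ : IsLift P Q (RingHom.id _) f φ) (hψ : IsLift Q P ρ f' ψ)
    (hρ : ∀ p, constantCoeff (ρ p) = constantCoeff p)
    (hgr : (∀ i a, DegSupp (Q.deg i) {P.deg i a} (φ i a)) ∨
      (∀ i a, DegSupp (P.deg i) {Q.deg i a} (ψ i a))) (i j : ℕ) :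
    P.betti i j ≤ Q.betti i j := by
  classical
  have hcomp : IsLift P P ρ (f'.comp f) (fun i a => semilin ρ (ψ i) (φ i a)) := by
    constructor
    · intro a
      rw [aug_semilin hψ.aug, hφ.aug, LinearMap.comp_apply]
    · intro i b
      rw [hψ.comm_apply, hφ.comm, ← semilin_comp (ψ i)]
      rfl
  -- The identity matrix is also a `ρ`-semilinear lift, since `ρ` fixes the entries of the
  -- differentials of `P`. By uniqueness modulo the irrelevant ideal, the constant parts of `φ` and
  -- `ψ` multiply to the identity.
  have hθ : IsLift P P ρ (f'.comp f) (fun _ a => Pi.single a 1) := by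
    constructor
    · intro a
      rw [LinearMap.comp_apply, hf]
      simp
    · intro i b
      have : semilin ρ (fun a : P.ι i => (Pi.single a 1 : P.ι i → MvPolynomial σ K)) (P.d i b) =
          P.d i b := by
        rw [semilin, Fintype.linearCombination_apply]
        funext c
        simp [Finset.sum_apply, Pi.single_apply, hρP]
      rw [this]
      simp
  have h1 : ∀ a c, ∑ b, constantCoeff (φ i a b) * constantCoeff (ψ i b c) =
      if a = c then 1 else 0 := by
    intro a c
    have h2 := hcomp.constantCoeff_eq hθ hP hP hρ i a c
    simp only [semilin, Fintype.linearCombination_apply, Finset.sum_apply, map_sum, Pi.smul_apply,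
      smul_eq_mul, map_mul, hρ] at h2
    rw [h2]
    by_cases hac : a = c
    · subst hac; simp
    · rw [if_neg hac, Pi.single_eq_of_ne (Ne.symm hac), map_zero]
  rw [GradedRes.betti, GradedRes.betti, Nat.card_eq_fintype_card, Nat.card_eq_fintype_card]
  refine card_le_card_of_matrix_mul_eq_one
    (A := Matrix.of fun a b => constantCoeff (φ i a.1 b.1))
    (B := Matrix.of fun b a => constantCoeff (ψ i b.1 a.1)) ?_
  ext a c
  rw [Matrix.mul_apply, Matrix.one_apply]
  simp only [Matrix.of_apply]
  have h3 : (if a = c then (1 : K) else 0) = if a.1 = c.1 then 1 else 0 := by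
    simp [Subtype.ext_iff]
  rw [h3, ← h1]
  rw [← Finset.sum_subtype (Finset.univ.filter fun b => Q.deg i b = j) (by simp)
    (fun b => constantCoeff (φ i a.1 b) * constantCoeff (ψ i b c.1))]
  -- Only the basis vectors of `Q` of degree `j` contribute: whichever of `φ`, `ψ` is graded has
  -- zero constant term between different degrees. Gradedness of one factor therefore suffices.
  refine Finset.sum_filter_of_ne fun b _ hb => ?_
  rcases hgr with h | h
  · by_contra h'
    exact left_ne_zero_of_mul hb (constantCoeff_eq_zero_of_degSupp (h i a.1) fun h'' => h' (h''.trans a.2))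
  · by_contra h'
    exact right_ne_zero_of_mul hb
      (constantCoeff_eq_zero_of_degSupp (h i b) fun h'' => h' (h''.symm.trans c.2))

/-- A minimal resolution is bounded above by every graded resolution. -/
theorem betti_le_of_isMinimal {P Q : GradedRes I} (hP : P.IsMinimal) (hQ : Q.AugSurjective)
    (i j : ℕ) : P.betti i j ≤ Q.betti i j := by
  obtain ⟨φ, hφ, hφ'⟩ := isLift_graded_exists P Q hQ LinearMap.id 0 (fun _ _ h => h)
    (fun _ _ h => h)
  obtain ⟨ψ, hψ⟩ := isLift_ungraded_exists (ρ := RingHom.id _) Q P LinearMap.id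
  exact betti_le_of_lift (fun _ => rfl) (fun _ _ _ => rfl) hP hφ hψ (fun _ => rfl) (Or.inl hφ') i j

/-- Graded Betti numbers do not decrease along an algebra retract. -/
theorem betti_le_of_retract (hP : P.IsMinimal) (hP' : P.AugSurjective)
    (hρ : ∀ p, constantCoeff (ρ p) = constantCoeff p)
    (hρ' : ∀ p k, p.IsHomogeneous k → (ρ p).IsHomogeneous k)
    (hρP : ∀ i b a, ρ (P.d i b a) = P.d i b a)
    (hIJ : I ≤ J) (hJI : ∀ x ∈ J, ρ x ∈ I)
    (haug : ∀ a, ∃ p, ρ p = p ∧ P.aug a = Ideal.Quotient.mk I p) (i j : ℕ) :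
    P.betti i j ≤ Q.betti i j := by
  let f : (MvPolynomial σ K ⧸ I) →ₗ[MvPolynomial σ K] (MvPolynomial σ K ⧸ J) :=
    Submodule.mapQ I J LinearMap.id hIJ
  let f' : (MvPolynomial σ K ⧸ J) →ₛₗ[ρ] (MvPolynomial σ K ⧸ I) :=
    Submodule.mapQ J I ρ.toSemilinearMap hJI
  have hf' : ∀ p, f' (Ideal.Quotient.mk J p) = Ideal.Quotient.mk I (ρ p) := fun _ => rfl
  have hf : ∀ p, f (Ideal.Quotient.mk I p) = Ideal.Quotient.mk J p := fun _ => rfl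
  obtain ⟨φ, hφ⟩ := isLift_ungraded_exists (ρ := RingHom.id _) P Q f
  obtain ⟨ψ, hψ, hψ'⟩ := isLift_graded_exists Q P hP' f' 0 hρ' (by
    intro k m hm
    obtain ⟨p, hp, rfl⟩ := exists_of_mem_quotientGrading hm
    rw [hf']
    exact mk_mem_quotientGrading (hρ' _ _ hp))
  refine betti_le_of_lift (fun a => ?_) hρP hP hφ hψ hρ (Or.inr hψ') i j
  obtain ⟨p, hp, hpa⟩ := haug a
  rw [hpa, hf, hf', hp]

lemma MinimalGradedFreeResolution.betti_eq {I : Ideal (MvPolynomial σ K)}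
    (F : MinimalGradedFreeResolution (σ := σ) (quotientGrading I)) (i j : ℕ) :
    F.betti i j = F.toGradedRes.betti i j := by
  rw [MinimalGradedFreeResolution.betti, GradedRes.betti, ← Nat.card_eq_fintype_card]
  rfl

/-- The graded Betti numbers are bounded above by every graded resolution. -/
theorem quotientBetti_le {I : Ideal (MvPolynomial σ K)} {Q : GradedRes I} (hQ : Q.AugSurjective)
    (i j : ℕ) : quotientBetti I i j ≤ Q.betti i j := by
  rw [quotientBetti, gradedBetti]
  split_ifs with h
  · rw [MinimalGradedFreeResolution.betti_eq]
    exact betti_le_of_isMinimal h.some.toGradedRes_isMinimal hQ i j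
  · exact Nat.zero_le _

/-- The graded Betti numbers bound those of an algebra retract from above. -/
theorem le_quotientBetti (hex : Nonempty (MinimalGradedFreeResolution (σ := σ) (quotientGrading J)))
    (hP : P.IsMinimal) (hP' : P.AugSurjective)
    (hρ : ∀ p, constantCoeff (ρ p) = constantCoeff p)
    (hρ' : ∀ p k, p.IsHomogeneous k → (ρ p).IsHomogeneous k)
    (hρP : ∀ i b a, ρ (P.d i b a) = P.d i b a)
    (hIJ : I ≤ J) (hJI : ∀ x ∈ J, ρ x ∈ I)
    (haug : ∀ a, ∃ p, ρ p = p ∧ P.aug a = Ideal.Quotient.mk I p) (i j : ℕ) :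
    P.betti i j ≤ quotientBetti J i j := by
  rw [quotientBetti, gradedBetti, dif_pos hex, MinimalGradedFreeResolution.betti_eq]
  exact betti_le_of_retract hP hP' hρ hρ' hρP hIJ hJI haug i j

/-- The graded Betti numbers can be computed from any minimal resolution. -/
theorem quotientBetti_eq {I : Ideal (MvPolynomial σ K)}
    (F : MinimalGradedFreeResolution (σ := σ) (quotientGrading I))
    (hF : F.toGradedRes.AugSurjective) (i j : ℕ) :
    quotientBetti I i j = F.toGradedRes.betti i j := by
  refine le_antisymm (quotientBetti_le hF i j) ?_
  refine le_quotientBetti (ρ := RingHom.id _) ⟨F⟩ F.toGradedRes_isMinimal hF (fun _ => rfl)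
    (fun _ _ h => h) (fun _ _ _ => rfl) le_rfl (fun _ h => h) (fun a => ?_) i j
  obtain ⟨p, hp⟩ := Ideal.Quotient.mk_surjective (F.toGradedRes.aug a)
  exact ⟨p, rfl, hp.symm⟩

end Comparison

/-! ### Mapping cones and ideals built by successive forms of degree at most two. -/

section MappingCone

variable {σ K : Type*} [Field K] {I J L : Ideal (MvPolynomial σ K)}

lemma semilin_id {ι M : Type*} [Fintype ι] [AddCommGroup M] [Module (MvPolynomial σ K) M]
    (φ : ι → M) (x : ι → MvPolynomial σ K) :
    semilin (RingHom.id _) φ x = Fintype.linearCombination (MvPolynomial σ K) φ x := rfl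

lemma linearCombination_sum {R M ι κ : Type*} [Fintype ι] [Fintype κ] [CommRing R]
    [AddCommGroup M] [Module R M] (D : ι ⊕ κ → M) (z : ι ⊕ κ → R) :
    Fintype.linearCombination R D z =
      Fintype.linearCombination R (fun b => D (Sum.inl b)) (fun b => z (Sum.inl b)) +
      Fintype.linearCombination R (fun a => D (Sum.inr a)) (fun a => z (Sum.inr a)) := by
  simp only [Fintype.linearCombination_apply, Fintype.sum_sum_type]

lemma linearCombination_sumElim {R M ι κ : Type*} [Fintype ι] [Fintype κ] [CommRing R]
    [AddCommGroup M] [Module R M] (D : ι → M) (E : κ → M) (z : ι ⊕ κ → R) :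
    Fintype.linearCombination R (Sum.elim D E) z =
      Fintype.linearCombination R D (fun b => z (Sum.inl b)) +
      Fintype.linearCombination R E (fun a => z (Sum.inr a)) :=
  linearCombination_sum _ _

lemma linearCombination_block {R ι κ ι' κ' : Type*} [Fintype ι] [Fintype κ] [CommRing R]
    (D : ι → ι' → R) (φ : κ → ι' → R) (D' : κ → κ' → R) (z : ι ⊕ κ → R) :
    Fintype.linearCombination R
      (fun c => Sum.elim (fun b => Sum.elim (D b) 0) (fun a => Sum.elim (φ a) (-D' a)) c) z =
    Sum.elim (Fintype.linearCombination R D (fun b => z (Sum.inl b)) +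
        Fintype.linearCombination R φ (fun a => z (Sum.inr a)))
      (-Fintype.linearCombination R D' (fun a => z (Sum.inr a))) := by
  rw [linearCombination_sum]
  funext c
  cases c with
  | inl b =>
    simp only [Fintype.linearCombination_apply, Finset.sum_apply, Pi.add_apply, Pi.smul_apply,
      Sum.elim_inl, Sum.elim_inr]
  | inr a =>
    simp [Fintype.linearCombination_apply, Finset.sum_apply]

/-- Index types of the mapping cone. -/
def coneIndex (A : GradedRes I) (B : GradedRes J) : ℕ → Type
  | 0 => B.ι 0
  | i + 1 => B.ι (i + 1) ⊕ A.ι i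

/-- The index types of the mapping cone are finite. -/
@[reducible] def coneFintype (A : GradedRes I) (B : GradedRes J) : ∀ i, Fintype (coneIndex A B i)
  | 0 => B.fintype 0
  | i + 1 => @instFintypeSum _ _ (B.fintype (i + 1)) (A.fintype i)

/-- Degrees of the basis vectors of the mapping cone. -/
def coneDeg (A : GradedRes I) (B : GradedRes J) (d : ℕ) : ∀ i, coneIndex A B i → ℕ
  | 0 => B.deg 0
  | i + 1 => Sum.elim (B.deg (i + 1)) (fun a => A.deg i a + d)

/-- The block matrix of a differential of the mapping cone. -/
noncomputable def coneBlock (A : GradedRes I) (B : GradedRes J)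
    (φ : ∀ i, A.ι i → B.ι i → MvPolynomial σ K) (i : ℕ) (c : B.ι (i + 2) ⊕ A.ι (i + 1)) :
    B.ι (i + 1) ⊕ A.ι i → MvPolynomial σ K :=
  Sum.elim (fun b => Sum.elim (B.d (i + 1) b) 0) (fun a => Sum.elim (φ (i + 1) a) (-A.d i a)) c

/-- The differentials of the mapping cone. -/
noncomputable def coneD (A : GradedRes I) (B : GradedRes J)
    (φ : ∀ i, A.ι i → B.ι i → MvPolynomial σ K) :
    ∀ i, coneIndex A B (i + 1) → coneIndex A B i → MvPolynomial σ K
  | 0 => Sum.elim (B.d 0) (φ 0)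
  | i + 1 => coneBlock A B φ i

lemma linearCombination_coneBlock (A : GradedRes I) (B : GradedRes J)
    (φ : ∀ i, A.ι i → B.ι i → MvPolynomial σ K) (i : ℕ)
    (z : B.ι (i + 2) ⊕ A.ι (i + 1) → MvPolynomial σ K) :
    Fintype.linearCombination (MvPolynomial σ K)
      (coneBlock A B φ i) z =
    Sum.elim (Fintype.linearCombination (MvPolynomial σ K) (B.d (i + 1)) (fun b => z (Sum.inl b)) +
        Fintype.linearCombination (MvPolynomial σ K) (φ (i + 1)) (fun a => z (Sum.inr a)))
      (-Fintype.linearCombination (MvPolynomial σ K) (A.d i) (fun a => z (Sum.inr a))) := by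
  exact linearCombination_block _ _ _ _

/-- The mapping cone of multiplication by `p` resolves the quotient by the sum of the ideals. -/
theorem exists_cone (A : GradedRes I) (B : GradedRes J) (hB : B.AugSurjective)
    {p : MvPolynomial σ K} {d : ℕ} (hp : p.IsHomogeneous d) (hcolon : ∀ h, h ∈ I ↔ p * h ∈ J) :
    ∃ Q : GradedRes (J ⊔ Ideal.span {p}), Q.AugSurjective ∧
      ∀ b : ℕ → ℕ, (∀ i a, B.deg i a ≤ b i) → (∀ i a, A.deg i a + d ≤ b (i + 1)) →
        ∀ i a, Q.deg i a ≤ b i := by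
  let f : (MvPolynomial σ K ⧸ I) →ₗ[MvPolynomial σ K] (MvPolynomial σ K ⧸ J) :=
    Submodule.mapQ I J (LinearMap.mulLeft (MvPolynomial σ K) p) fun h hh => (hcolon h).mp hh
  have hf : ∀ h, f (Ideal.Quotient.mk I h) = Ideal.Quotient.mk J (p * h) := fun _ => rfl
  -- Multiplication by `p` is injective on the quotient because `I` is the whole colon ideal.
  have hfinj : ∀ m, f m = 0 → m = 0 := by
    intro m hm
    obtain ⟨h, rfl⟩ := Ideal.Quotient.mk_surjective m
    rw [hf, Ideal.Quotient.eq_zero_iff_mem] at hm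
    exact Ideal.Quotient.eq_zero_iff_mem.mpr ((hcolon h).mpr hm)
  let π : (MvPolynomial σ K ⧸ J) →ₗ[MvPolynomial σ K]
      (MvPolynomial σ K ⧸ (J ⊔ Ideal.span {p})) :=
    Submodule.mapQ J (J ⊔ Ideal.span {p}) LinearMap.id le_sup_left
  have hπ : ∀ h, π (Ideal.Quotient.mk J h) = Ideal.Quotient.mk _ h := fun _ => rfl
  clear_value f π
  obtain ⟨φ, hφ, hφd⟩ := isLift_graded_exists (ρ := RingHom.id _) A B hB f d (fun _ _ h => h) (by
    intro j m hm
    obtain ⟨h, hh, rfl⟩ := exists_of_mem_quotientGrading hm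
    rw [hf]
    exact mk_mem_quotientGrading (by rw [add_comm]; exact hp.mul hh))
  have hcomm : ∀ i x, Fintype.linearCombination (MvPolynomial σ K) (B.d i)
      (Fintype.linearCombination (MvPolynomial σ K) (φ (i + 1)) x) =
      Fintype.linearCombination (MvPolynomial σ K) (φ i)
        (Fintype.linearCombination (MvPolynomial σ K) (A.d i) x) := by
    intro i x
    have := hφ.comm_apply i x
    rwa [semilin_id, semilin_id] at this
  have haugφ : ∀ x, Fintype.linearCombination (MvPolynomial σ K) B.aug
      (Fintype.linearCombination (MvPolynomial σ K) (φ 0) x) =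
      f (Fintype.linearCombination (MvPolynomial σ K) A.aug x) := by
    intro x
    have := aug_semilin hφ.aug x
    rwa [semilin_id] at this
  have hπaug : ∀ x, Fintype.linearCombination (MvPolynomial σ K) (fun a => π (B.aug a)) x =
      π (Fintype.linearCombination (MvPolynomial σ K) B.aug x) := by
    intro x
    rw [Fintype.linearCombination_apply, Fintype.linearCombination_apply, map_sum]
    exact Finset.sum_congr rfl fun a _ => (map_smul π _ _).symm
  have hexact0 : ∀ x : B.ι 0 → MvPolynomial σ K,
      Fintype.linearCombination (MvPolynomial σ K) (fun a => π (B.aug a)) x = 0 →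
      ∃ y : B.ι 1 ⊕ A.ι 0 → MvPolynomial σ K, Fintype.linearCombination (MvPolynomial σ K)
        (Sum.elim (B.d 0) (φ 0)) y = x := by
    intro x hx
    rw [hπaug] at hx
    obtain ⟨q, hq⟩ := Ideal.Quotient.mk_surjective
      (Fintype.linearCombination (MvPolynomial σ K) B.aug x)
    rw [← hq, hπ, Ideal.Quotient.eq_zero_iff_mem] at hx
    obtain ⟨s, hs, t, ht, rfl⟩ := Submodule.mem_sup.mp hx
    obtain ⟨c, rfl⟩ := Ideal.mem_span_singleton.mp ht
    obtain ⟨y, hy⟩ := A.aug_surjective (Ideal.Quotient.mk I c)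
    obtain ⟨y', hy'⟩ := B.exact_zero (x - Fintype.linearCombination (MvPolynomial σ K) (φ 0) y) (by
      rw [map_sub, haugφ, hy, hf, ← hq, ← map_sub, Ideal.Quotient.eq_zero_iff_mem]
      simpa using hs)
    refine ⟨Sum.elim y' y, ?_⟩
    rw [linearCombination_sumElim]
    simp only [Sum.elim_inl, Sum.elim_inr]
    rw [hy', sub_add_cancel]
  have hdd0 : ∀ x : B.ι 1 ⊕ A.ι 0 → MvPolynomial σ K,
      Fintype.linearCombination (MvPolynomial σ K) (fun a => π (B.aug a))
        (Fintype.linearCombination (MvPolynomial σ K)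
        (Sum.elim (B.d 0) (φ 0)) x) = 0 := by
    intro x
    rw [hπaug, linearCombination_sumElim, map_add, B.linearCombination_aug_d, zero_add, haugφ]
    obtain ⟨h, hh⟩ := Ideal.Quotient.mk_surjective (Fintype.linearCombination (MvPolynomial σ K)
      A.aug fun a => x (Sum.inr a))
    rw [← hh, hf, hπ, Ideal.Quotient.eq_zero_iff_mem]
    exact Ideal.mul_mem_right _ _
      ((le_sup_right : _ ≤ J ⊔ Ideal.span {p}) (Ideal.mem_span_singleton_self p))
  have hbasis0 : ∀ b : B.ι 1 ⊕ A.ι 0, Fintype.linearCombination (MvPolynomial σ K)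
      (fun a => π (B.aug a)) (Sum.elim (B.d 0) (φ 0) b) = 0 := by
    classical
    intro b
    have := hdd0 (Pi.single b 1)
    rwa [Fintype.linearCombination_apply_single, one_smul] at this
  -- Exactness in all positive steps reduces to this: if `y` is the boundary of `y'`, then `x + φ
  -- y'` is a cycle of `B`, say the boundary of `x'`, and `(x', -y')` is a preimage. The sign
  -- matches the block `-A.d`.
  have hfin : ∀ (i : ℕ) (x : B.ι (i + 1) → MvPolynomial σ K) (y : A.ι i → MvPolynomial σ K),
      Fintype.linearCombination (MvPolynomial σ K) (B.d i) x +
        Fintype.linearCombination (MvPolynomial σ K) (φ i) y = 0 →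
      (∃ y', Fintype.linearCombination (MvPolynomial σ K) (A.d i) y' = y) →
      ∃ z : B.ι (i + 2) ⊕ A.ι (i + 1) → MvPolynomial σ K,
        Fintype.linearCombination (MvPolynomial σ K) (coneBlock A B φ i) z = Sum.elim x y := by
    rintro i x _ h ⟨y', rfl⟩
    obtain ⟨x', hx'⟩ := B.exact_succ i
      (x + Fintype.linearCombination (MvPolynomial σ K) (φ (i + 1)) y') (by
        rw [map_add, hcomm, h])
    refine ⟨Sum.elim x' (-y'), ?_⟩
    rw [linearCombination_coneBlock]
    simp only [Sum.elim_inl, Sum.elim_inr]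
    have : (fun a => (-y') a) = -y' := rfl
    rw [hx', this, map_neg, map_neg, add_neg_cancel_right, neg_neg]
  have hexact1 : ∀ z : B.ι 1 ⊕ A.ι 0 → MvPolynomial σ K,
      Fintype.linearCombination (MvPolynomial σ K)
        (Sum.elim (B.d 0) (φ 0)) z = 0 →
      ∃ w : B.ι 2 ⊕ A.ι 1 → MvPolynomial σ K,
        Fintype.linearCombination (MvPolynomial σ K) (coneBlock A B φ 0) w = z := by
    intro z hz
    rw [linearCombination_sumElim] at hz
    -- At the lowest step `y` need not be a boundary for formal reasons: its augmentation vanishes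
    -- because `f` is injective.
    obtain ⟨w, hw⟩ := hfin 0 _ _ hz (A.exact_zero _ (hfinj _ (by
      rw [← haugφ, eq_neg_of_add_eq_zero_right hz, map_neg, B.linearCombination_aug_d, neg_zero])))
    refine ⟨w, hw.trans ?_⟩
    funext c
    cases c <;> rfl
  have hexact2 : ∀ (i : ℕ) (z : B.ι (i + 2) ⊕ A.ι (i + 1) → MvPolynomial σ K),
      Fintype.linearCombination (MvPolynomial σ K) (coneBlock A B φ i) z = 0 →
      ∃ w : B.ι (i + 3) ⊕ A.ι (i + 2) → MvPolynomial σ K,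
        Fintype.linearCombination (MvPolynomial σ K) (coneBlock A B φ (i + 1)) w = z := by
    intro i z hz
    rw [linearCombination_coneBlock] at hz
    have hz1 := funext fun b => congrFun hz (Sum.inl b)
    have hz2 := funext fun a => congrFun hz (Sum.inr a)
    simp only [Sum.elim_inl, Sum.elim_inr, Pi.neg_apply, Pi.zero_apply] at hz1 hz2
    obtain ⟨w, hw⟩ := hfin (i + 1) _ _ hz1 (A.exact_succ i _ (by
      funext a
      simpa using congrFun hz2 a))
    refine ⟨w, hw.trans ?_⟩
    funext c
    cases c <;> rfl
  have hdd1 : ∀ z : B.ι 2 ⊕ A.ι 1 → MvPolynomial σ K,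
      Fintype.linearCombination (MvPolynomial σ K)
        (Sum.elim (B.d 0) (φ 0))
      (Fintype.linearCombination (MvPolynomial σ K) (coneBlock A B φ 0) z) = 0 := by
    intro z
    rw [linearCombination_coneBlock, linearCombination_sumElim]
    change Fintype.linearCombination (MvPolynomial σ K) (B.d 0) (_ + _) +
      Fintype.linearCombination (MvPolynomial σ K) (φ 0) (-_) = 0
    rw [map_add, B.linearCombination_d_d, hcomm, map_neg, zero_add, add_neg_cancel]
  have hdd2 : ∀ (i : ℕ) (z : B.ι (i + 3) ⊕ A.ι (i + 2) → MvPolynomial σ K),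
      Fintype.linearCombination (MvPolynomial σ K) (coneBlock A B φ i)
      (Fintype.linearCombination (MvPolynomial σ K) (coneBlock A B φ (i + 1)) z) = 0 := by
    intro i z
    rw [linearCombination_coneBlock, linearCombination_coneBlock]
    change Sum.elim (Fintype.linearCombination (MvPolynomial σ K) (B.d (i + 1)) (_ + _) +
      Fintype.linearCombination (MvPolynomial σ K) (φ (i + 1)) (-_))
      (-Fintype.linearCombination (MvPolynomial σ K) (A.d i) (-_)) = 0
    rw [map_add, B.linearCombination_d_d, hcomm, map_neg, zero_add, add_neg_cancel, map_neg,
      A.linearCombination_d_d]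
    funext c
    cases c <;> simp
  have hbasis1 : ∀ b : B.ι 2 ⊕ A.ι 1, Fintype.linearCombination (MvPolynomial σ K)
      (Sum.elim (B.d 0) (φ 0)) (coneBlock A B φ 0 b) = 0 := by
    classical
    intro b
    have := hdd1 (Pi.single b 1)
    rwa [Fintype.linearCombination_apply_single, one_smul] at this
  have hbasis2 : ∀ (i : ℕ) (b : B.ι (i + 3) ⊕ A.ι (i + 2)),
      Fintype.linearCombination (MvPolynomial σ K) (coneBlock A B φ i)
        (coneBlock A B φ (i + 1) b) = 0 := by
    classical
    intro i b
    have := hdd2 i (Pi.single b 1)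
    rwa [Fintype.linearCombination_apply_single, one_smul] at this
  refine ⟨{
    ι := coneIndex A B
    fintype := coneFintype A B
    deg := coneDeg A B d
    d := coneD A B φ
    aug := fun a : B.ι 0 => π (B.aug a)
    aug_mem := ?_
    d_homog := ?_
    aug_surjective := ?_
    aug_d := ?_
    exact_zero := hexact0
    d_d := ?_
    exact_succ := ?_ }, ?_, ?_⟩
  · intro a
    obtain ⟨h, hh, hha⟩ := exists_of_mem_quotientGrading (B.aug_mem a)
    change π (B.aug a) ∈ _
    rw [← hha, hπ]
    exact mk_mem_quotientGrading hh
  · intro i c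
    match i, c with
    | 0, Sum.inl b => exact B.d_homog 0 b
    | 0, Sum.inr a => exact hφd 0 a
    | i + 1, Sum.inl b =>
      intro c m hm
      match c with
      | Sum.inl b' => exact B.d_homog (i + 1) b b' m hm
      | Sum.inr a' => exact absurd (coeff_zero m) hm
    | i + 1, Sum.inr a =>
      intro c m hm
      match c with
      | Sum.inl b' => exact hφd (i + 1) a b' m hm
      | Sum.inr a' =>
        have h1 := (A.d_homog i a).neg a' m hm
        simp only [Set.mem_singleton_iff] at h1 ⊢
        simp only [coneDeg, Sum.elim_inr]
        omega
  · intro m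
    obtain ⟨h, rfl⟩ := Ideal.Quotient.mk_surjective m
    obtain ⟨x, hx⟩ := B.aug_surjective (Ideal.Quotient.mk J h)
    exact ⟨x, (hπaug x).trans (by rw [hx, hπ])⟩
  · exact hbasis0
  · intro i
    match i with
    | 0 => exact hbasis1
    | i + 1 => exact hbasis2 i
  · intro i
    match i with
    | 0 => exact hexact1
    | i + 1 => exact hexact2 i
  · intro j m hm
    obtain ⟨h, hh, rfl⟩ := exists_of_mem_quotientGrading hm
    obtain ⟨x, hx1, hx2⟩ := hB j _ (mk_mem_quotientGrading (I := J) hh)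
    exact ⟨x, hx1, (hπaug x).trans (by rw [hx2, hπ])⟩
  · intro b hb1 hb2 i c
    match i, c with
    | 0, c => exact hb1 0 c
    | i + 1, Sum.inl c => exact hb1 (i + 1) c
    | i + 1, Sum.inr c => exact hb2 i c

/-- Ideals obtained from the zero ideal by successively adding forms of degree at most two such
that the colon ideals are of the same kind. -/
inductive QuadTower : Ideal (MvPolynomial σ K) → Prop
  | bot : QuadTower ⊥
  | add {I J : Ideal (MvPolynomial σ K)} {p : MvPolynomial σ K} {d : ℕ} (hd : d ≤ 2)
      (hp : p.IsHomogeneous d) (hJ : QuadTower J) (hI : QuadTower I)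
      (hcolon : ∀ h, h ∈ I ↔ p * h ∈ J) : QuadTower (J ⊔ Ideal.span {p})

/-- The resolution of the polynomial ring by itself. -/
lemma exists_gradedRes_bot : ∃ Q : GradedRes (⊥ : Ideal (MvPolynomial σ K)), Q.AugSurjective ∧
    ∀ i a, Q.deg i a ≤ 2 * i := by
  let ι : ℕ → Type := fun i => match i with
    | 0 => Unit
    | _ + 1 => Empty
  let hfin : ∀ i, Fintype (ι i) := fun i => match i with
    | 0 => inferInstanceAs (Fintype Unit)
    | _ + 1 => inferInstanceAs (Fintype Empty)
  have haug : ∀ x : Unit → MvPolynomial σ K, Fintype.linearCombination (MvPolynomial σ K)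
      (fun _ : Unit => (1 : MvPolynomial σ K ⧸ (⊥ : Ideal (MvPolynomial σ K)))) x =
        Ideal.Quotient.mk _ (x ()) := by
    intro x
    rw [Fintype.linearCombination_apply, Fintype.sum_unique]
    change Ideal.Quotient.mk _ (x () * 1) = _
    rw [mul_one]
  refine ⟨{
    ι := ι
    fintype := hfin
    deg := fun _ _ => 0
    d := fun i (b : Empty) => b.elim
    aug := fun _ => 1
    aug_mem := fun _ => mk_mem_quotientGrading (isHomogeneous_one σ K)
    d_homog := fun i (b : Empty) => b.elim
    aug_surjective := ?_
    aug_d := fun (b : Empty) => b.elim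
    exact_zero := ?_
    d_d := fun i (b : Empty) => b.elim
    exact_succ := ?_ }, ?_, fun i a => Nat.zero_le _⟩
  · intro m
    obtain ⟨h, rfl⟩ := Ideal.Quotient.mk_surjective m
    exact ⟨fun _ => h, haug _⟩
  · intro x hx
    have h1 := (haug x).symm.trans hx
    rw [Ideal.Quotient.eq_zero_iff_mem, Ideal.mem_bot] at h1
    refine ⟨fun (b : Empty) => b.elim, ?_⟩
    funext a
    exact Eq.trans (by rw [Fintype.linearCombination_apply]; rfl) h1.symm
  · intro i x hx
    exact ⟨fun (b : Empty) => b.elim, funext fun (b : Empty) => b.elim⟩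
  · intro j m hm
    obtain ⟨h, hh, rfl⟩ := exists_of_mem_quotientGrading hm
    exact ⟨fun _ => h, degSupp_of_isHomogeneous fun _ => Or.inr ⟨j, (Nat.zero_add j).symm, hh⟩,
      haug _⟩

/-- A basis vector in step `i` of the resolution of the colon ideal enters the cone in step `i + 1`
with degree at most `2 * i + d`, and `d ≤ 2` keeps this below `2 * (i + 1)`. -/
theorem QuadTower.exists_gradedRes {I : Ideal (MvPolynomial σ K)} (h : QuadTower I) :
    ∃ Q : GradedRes I, Q.AugSurjective ∧ ∀ i a, Q.deg i a ≤ 2 * i := by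
  induction h with
  | bot => exact exists_gradedRes_bot
  | add hd hp hJ hI hcolon ihJ ihI =>
    obtain ⟨B, hB, hBd⟩ := ihJ
    obtain ⟨A, hA, hAd⟩ := ihI
    obtain ⟨Q, hQ, hQd⟩ := exists_cone A B hB hp hcolon
    refine ⟨Q, hQ, hQd (fun i => 2 * i) hBd fun i a => ?_⟩
    have := hAd i a
    omega

theorem QuadTower.quotientBetti_eq_zero {I : Ideal (MvPolynomial σ K)} (h : QuadTower I) {i j : ℕ}
    (hij : 2 * i < j) : quotientBetti I i j = 0 := by
  obtain ⟨Q, hQ, hQd⟩ := h.exists_gradedRes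
  have h1 := quotientBetti_le hQ i j
  have h2 : Q.betti i j = 0 := by
    rw [GradedRes.betti, Nat.card_eq_zero]
    exact Or.inl ⟨fun a => by have := hQd i a.1; have := a.2; omega⟩
  omega

/-- Renaming variables along an equivalence preserves the class. -/
theorem QuadTower.rename {τ : Type*} (e : σ ≃ τ) {I : Ideal (MvPolynomial σ K)}
    (h : QuadTower I) :
    QuadTower (I.comap (MvPolynomial.rename e.symm : MvPolynomial τ K →ₐ[K] MvPolynomial σ K)) := by
  have hre : ∀ p : MvPolynomial τ K,
      MvPolynomial.rename e (MvPolynomial.rename e.symm p) = p := fun p => by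
    simp [MvPolynomial.rename_rename]
  have hre' : ∀ p : MvPolynomial σ K,
      MvPolynomial.rename e.symm (MvPolynomial.rename e p) = p := fun p => by
    simp [MvPolynomial.rename_rename]
  induction h with
  | bot =>
    convert QuadTower.bot using 1
    ext p
    rw [Ideal.mem_comap, Ideal.mem_bot, Ideal.mem_bot]
    exact ⟨fun h => by rw [← hre p, h, map_zero], fun h => by rw [h, map_zero]⟩
  | @add I J p d hd hp hJ hI hcolon ihJ ihI =>
    have h1 : (J ⊔ Ideal.span {p}).comap
        (MvPolynomial.rename e.symm : MvPolynomial τ K →ₐ[K] MvPolynomial σ K) =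
        J.comap (MvPolynomial.rename e.symm : MvPolynomial τ K →ₐ[K] MvPolynomial σ K) ⊔
          Ideal.span {MvPolynomial.rename e p} := by
      apply le_antisymm
      · intro q hq
        rw [Ideal.mem_comap] at hq
        obtain ⟨s, hs, t, ht, hst⟩ := Submodule.mem_sup.mp hq
        obtain ⟨c, rfl⟩ := Ideal.mem_span_singleton.mp ht
        rw [← hre q, ← hst, map_add, map_mul]
        refine Submodule.add_mem_sup ?_ (Ideal.mul_mem_right _ _ (Ideal.mem_span_singleton_self _))
        rw [Ideal.mem_comap, hre']
        exact hs
      · refine sup_le (Ideal.comap_mono le_sup_left) ?_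
        rw [Ideal.span_singleton_le_iff_mem, Ideal.mem_comap, hre']
        exact (le_sup_right : _ ≤ J ⊔ Ideal.span {p}) (Ideal.mem_span_singleton_self p)
    rw [h1]
    refine QuadTower.add hd hp.rename_isHomogeneous ihJ ihI fun q => ?_
    rw [Ideal.mem_comap, Ideal.mem_comap, hcolon, map_mul, hre']

end MappingCone

/-! ### Binomial edge ideals with deleted vertices and Ohtani's decomposition. -/

section BinomialEdgeIdeals

variable {V K : Type*} [Field K]

/-- The binomial `f_{u,v} = x_u y_v - y_u x_v`. -/
noncomputable def fBin (K : Type*) [Field K] (u v : V) : EdgeRing V K :=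
  X (Sum.inl u) * X (Sum.inr v) - X (Sum.inr u) * X (Sum.inl v)

lemma fBin_self (u : V) : fBin K u u = 0 := by
  rw [fBin]; ring

lemma fBin_swap (u v : V) : fBin K u v = -fBin K v u := by
  rw [fBin, fBin]; ring

/-- The ideal generated by the variables at the vertices of `A` and the binomials of the related
pairs. -/
noncomputable def bIdeal (K : Type*) [Field K] (A : Set V) (r : V → V → Prop) :
    Ideal (EdgeRing V K) :=
  Ideal.span ({p | ∃ w ∈ A, p = X (Sum.inl w) ∨ p = X (Sum.inr w)} ∪
    {p | ∃ a b, r a b ∧ p = fBin K a b})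

variable {A A' : Set V} {r r' : V → V → Prop}

lemma X_inl_mem_bIdeal {w : V} (h : w ∈ A) : (X (Sum.inl w) : EdgeRing V K) ∈ bIdeal K A r :=
  Ideal.subset_span (Or.inl ⟨w, h, Or.inl rfl⟩)

lemma X_inr_mem_bIdeal {w : V} (h : w ∈ A) : (X (Sum.inr w) : EdgeRing V K) ∈ bIdeal K A r :=
  Ideal.subset_span (Or.inl ⟨w, h, Or.inr rfl⟩)

lemma fBin_mem_bIdeal {a b : V} (h : r a b) : fBin K a b ∈ bIdeal K A r :=
  Ideal.subset_span (Or.inr ⟨a, b, h, rfl⟩)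

lemma bIdeal_le {J : Ideal (EdgeRing V K)} (h1 : ∀ w ∈ A, X (Sum.inl w) ∈ J)
    (h2 : ∀ w ∈ A, X (Sum.inr w) ∈ J) (h3 : ∀ a b, r a b → fBin K a b ∈ J) :
    bIdeal K A r ≤ J := by
  rw [bIdeal, Ideal.span_le]
  rintro p (⟨w, hw, rfl | rfl⟩ | ⟨a, b, hab, rfl⟩)
  · exact h1 w hw
  · exact h2 w hw
  · exact h3 a b hab

lemma fBin_mem_of_left {J : Ideal (EdgeRing V K)} {a b : V} (h1 : X (Sum.inl a) ∈ J)
    (h2 : X (Sum.inr a) ∈ J) : fBin K a b ∈ J :=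
  J.sub_mem (J.mul_mem_right _ h1) (J.mul_mem_right _ h2)

lemma fBin_mem_of_right {J : Ideal (EdgeRing V K)} {a b : V} (h1 : X (Sum.inl b) ∈ J)
    (h2 : X (Sum.inr b) ∈ J) : fBin K a b ∈ J :=
  J.sub_mem (J.mul_mem_left _ h2) (J.mul_mem_left _ h1)

lemma bIdeal_mono (hA : A ⊆ A') (hr : ∀ a b, r a b → r' a b) : bIdeal K A r ≤ bIdeal K A' r' :=
  bIdeal_le (fun _ hw => X_inl_mem_bIdeal (hA hw)) (fun _ hw => X_inr_mem_bIdeal (hA hw))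
    fun _ _ h => fBin_mem_bIdeal (hr _ _ h)

/-- The relation in which the neighbours of `v` have been made pairwise related. -/
def completeAt (r : V → V → Prop) (v : V) (a b : V) : Prop := r a b ∨ (r v a ∧ r v b)

lemma le_bIdeal_completeAt (v : V) : bIdeal K A r ≤ bIdeal K A (completeAt r v) :=
  bIdeal_mono le_rfl fun _ _ h => Or.inl h

/-- A Plücker relation between the minors of a matrix with two rows and the columns `w`, `a`, `b`.
-/
lemma X_inl_mul_fBin_mem {J : Ideal (EdgeRing V K)} {w a b : V} (h1 : fBin K w a ∈ J)
    (h2 : fBin K w b ∈ J) : X (Sum.inl w) * fBin K a b ∈ J := by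
  have : X (Sum.inl w) * fBin K a b =
      X (Sum.inl a) * fBin K w b - X (Sum.inl b) * fBin K w a := by
    simp only [fBin]; ring
  rw [this]
  exact J.sub_mem (J.mul_mem_left _ h2) (J.mul_mem_left _ h1)

lemma X_inr_mul_fBin_mem {J : Ideal (EdgeRing V K)} {w a b : V} (h1 : fBin K w a ∈ J)
    (h2 : fBin K w b ∈ J) : X (Sum.inr w) * fBin K a b ∈ J := by
  have : X (Sum.inr w) * fBin K a b =
      X (Sum.inr a) * fBin K w b - X (Sum.inr b) * fBin K w a := by
    simp only [fBin]; ring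
  rw [this]
  exact J.sub_mem (J.mul_mem_left _ h2) (J.mul_mem_left _ h1)

lemma mul_mem_of_mem_bIdeal {J : Ideal (EdgeRing V K)} {p : EdgeRing V K}
    (h1 : ∀ w ∈ A, p * X (Sum.inl w) ∈ J) (h2 : ∀ w ∈ A, p * X (Sum.inr w) ∈ J)
    (h3 : ∀ a b, r a b → p * fBin K a b ∈ J) {F : EdgeRing V K} (hF : F ∈ bIdeal K A r) :
    p * F ∈ J := by
  have h : bIdeal K A r ≤ J.colon {p} := bIdeal_le
    (fun w hw => Submodule.mem_colon_singleton.mpr (by rw [smul_eq_mul, mul_comm]; exact h1 w hw))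
    (fun w hw => Submodule.mem_colon_singleton.mpr (by rw [smul_eq_mul, mul_comm]; exact h2 w hw))
    (fun a b hab =>
      Submodule.mem_colon_singleton.mpr (by rw [smul_eq_mul, mul_comm]; exact h3 a b hab))
  have := Submodule.mem_colon_singleton.mp (h hF)
  rwa [smul_eq_mul, mul_comm] at this

/-- The new generators come from pairs of neighbours of `w`, so the Plücker relations at `w` apply
to them. -/
lemma mul_mem_bIdeal_of_mem_completeAt {w : V} {p F : EdgeRing V K}
    (hp : p = X (Sum.inl w) ∨ p = X (Sum.inr w)) (hF : F ∈ bIdeal K A (completeAt r w)) :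
    p * F ∈ bIdeal K A r := by
  refine mul_mem_of_mem_bIdeal (fun w hw => Ideal.mul_mem_left _ _ (X_inl_mem_bIdeal hw))
    (fun w hw => Ideal.mul_mem_left _ _ (X_inr_mem_bIdeal hw)) (fun a b hab => ?_) hF
  rcases hab with hab | ⟨ha, hb⟩
  · exact Ideal.mul_mem_left _ _ (fBin_mem_bIdeal hab)
  · rcases hp with rfl | rfl
    · exact X_inl_mul_fBin_mem (fBin_mem_bIdeal ha) (fBin_mem_bIdeal hb)
    · exact X_inr_mul_fBin_mem (fBin_mem_bIdeal ha) (fBin_mem_bIdeal hb)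

open Classical in
/-- The endomorphism that sends the variables at `w` to zero. -/
noncomputable def killVertex (K : Type*) [Field K] (w : V) : EdgeRing V K →ₐ[K] EdgeRing V K :=
  aeval fun s => if s = Sum.inl w ∨ s = Sum.inr w then 0 else X s

lemma killVertex_X_inl_self (w : V) : killVertex K w (X (Sum.inl w)) = 0 := by
  simp [killVertex]

lemma killVertex_X_inr_self (w : V) : killVertex K w (X (Sum.inr w)) = 0 := by
  simp [killVertex]

lemma killVertex_X_inl {w a : V} (h : a ≠ w) :
    killVertex K w (X (Sum.inl a)) = X (Sum.inl a) := by
  simp [killVertex, h]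

lemma killVertex_X_inr {w a : V} (h : a ≠ w) :
    killVertex K w (X (Sum.inr a)) = X (Sum.inr a) := by
  simp [killVertex, h]

lemma killVertex_fBin_left (w b : V) : killVertex K w (fBin K w b) = 0 := by
  simp [fBin, killVertex_X_inl_self, killVertex_X_inr_self]

lemma killVertex_fBin_right (w b : V) : killVertex K w (fBin K b w) = 0 := by
  simp [fBin, killVertex_X_inl_self, killVertex_X_inr_self]

lemma killVertex_fBin {w a b : V} (ha : a ≠ w) (hb : b ≠ w) :
    killVertex K w (fBin K a b) = fBin K a b := by
  simp [fBin, killVertex_X_inl, killVertex_X_inr, ha, hb]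

lemma killVertex_mem {J : Ideal (EdgeRing V K)} {w : V}
    (h1 : ∀ a ∈ A, a ≠ w → X (Sum.inl a) ∈ J) (h2 : ∀ a ∈ A, a ≠ w → X (Sum.inr a) ∈ J)
    (h3 : ∀ a b, r a b → a ≠ w → b ≠ w → fBin K a b ∈ J) {F : EdgeRing V K}
    (hF : F ∈ bIdeal K A r) : killVertex K w F ∈ J := by
  have h : bIdeal K A r ≤ J.comap (killVertex K w) := by
    refine bIdeal_le (fun a ha => ?_) (fun a ha => ?_) (fun a b hab => ?_)
    · rw [Ideal.mem_comap]
      by_cases haw : a = w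
      · rw [haw, killVertex_X_inl_self]; exact J.zero_mem
      · rw [killVertex_X_inl haw]; exact h1 a ha haw
    · rw [Ideal.mem_comap]
      by_cases haw : a = w
      · rw [haw, killVertex_X_inr_self]; exact J.zero_mem
      · rw [killVertex_X_inr haw]; exact h2 a ha haw
    · rw [Ideal.mem_comap]
      by_cases haw : a = w
      · rw [haw, killVertex_fBin_left]; exact J.zero_mem
      · by_cases hbw : b = w
        · rw [hbw, killVertex_fBin_right]; exact J.zero_mem
        · rw [killVertex_fBin haw hbw]; exact h3 a b hab haw hbw
  exact h hF

/-- The difference `p - killVertex K w p` lies in the ideal of the two variables at `w`; the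
induction on `p` is the product rule for this difference. -/
lemma sub_killVertex_mul_mem {J : Ideal (EdgeRing V K)} {w : V} {G : EdgeRing V K}
    (h1 : X (Sum.inl w) * G ∈ J) (h2 : X (Sum.inr w) * G ∈ J) (p : EdgeRing V K) :
    (p - killVertex K w p) * G ∈ J := by
  induction p using MvPolynomial.induction_on with
  | C a => simp [killVertex]
  | add p q hp hq =>
    rw [map_add, add_sub_add_comm, add_mul]
    exact J.add_mem hp hq
  | mul_X p s hp =>
    have hs : (X s - killVertex K w (X s)) * G ∈ J := by
      by_cases h : s = Sum.inl w
      · rw [h, killVertex_X_inl_self, sub_zero]; exact h1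
      by_cases h' : s = Sum.inr w
      · rw [h', killVertex_X_inr_self, sub_zero]; exact h2
      · simp [killVertex, h, h']
    have : (p * X s - killVertex K w (p * X s)) * G =
        X s * ((p - killVertex K w p) * G) +
          killVertex K w p * ((X s - killVertex K w (X s)) * G) := by
      rw [map_mul]; ring
    rw [this]
    exact J.add_mem (J.mul_mem_left _ hp) (J.mul_mem_left _ hs)

/-- Ohtani's decomposition `J(r) = J(r_w) ∩ (J(r - w) + (x_w, y_w))`. -/
theorem mem_bIdeal_of_completeAt_of_insert (hr : ∀ a b, r a b → r b a) {w : V} {F : EdgeRing V K}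
    (h1 : F ∈ bIdeal K A (completeAt r w)) (h2 : F ∈ bIdeal K (insert w A) r) :
    F ∈ bIdeal K A r := by
  have hkill : killVertex K w F ∈ bIdeal K A r := by
    refine killVertex_mem (fun a ha haw => ?_) (fun a ha haw => ?_)
      (fun a b hab _ _ => fBin_mem_bIdeal hab) h2
    · exact X_inl_mem_bIdeal (ha.resolve_left haw)
    · exact X_inr_mem_bIdeal (ha.resolve_left haw)
  have hstable : ∀ p ∈ bIdeal K A (completeAt r w),
      killVertex K w p ∈ bIdeal K A (completeAt r w) := fun p hp =>
    killVertex_mem (fun a ha _ => X_inl_mem_bIdeal ha) (fun a ha _ => X_inr_mem_bIdeal ha)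
      (fun a b hab _ _ => fBin_mem_bIdeal hab) hp
  -- A generator either does not involve `w`, and the difference is zero, or it does, and it already
  -- belongs to `J(r)`, because completion at `w` adds no neighbours to `w`. For multiples the
  -- product rule leaves an element of `(x_w, y_w)` times one of `J(r_w)`, which lies in `J(r)`. The
  -- theorem follows by writing `F` as `(F - killVertex K w F) + killVertex K w F`.
  have hsub : ∀ G ∈ bIdeal K A (completeAt r w), G - killVertex K w G ∈ bIdeal K A r := by
    intro G hG
    unfold bIdeal at hG
    induction hG using Submodule.span_induction with
    | mem p hp =>
      rcases hp with ⟨a, ha, rfl | rfl⟩ | ⟨a, b, hab, rfl⟩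
      · by_cases haw : a = w
        · rw [haw, killVertex_X_inl_self, sub_zero]; exact X_inl_mem_bIdeal (haw ▸ ha)
        · rw [killVertex_X_inl haw, sub_self]; exact Ideal.zero_mem _
      · by_cases haw : a = w
        · rw [haw, killVertex_X_inr_self, sub_zero]; exact X_inr_mem_bIdeal (haw ▸ ha)
        · rw [killVertex_X_inr haw, sub_self]; exact Ideal.zero_mem _
      · by_cases haw : a = w
        · subst haw
          rw [killVertex_fBin_left, sub_zero]
          exact fBin_mem_bIdeal (hab.elim id fun h => h.2)
        · by_cases hbw : b = w
          · subst hbw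
            rw [killVertex_fBin_right, sub_zero]
            exact fBin_mem_bIdeal (hab.elim id fun h => hr _ _ h.1)
          · rw [killVertex_fBin haw hbw, sub_self]; exact Ideal.zero_mem _
    | zero => simp
    | add p q _ _ hp hq =>
      rw [map_add, add_sub_add_comm]
      exact Ideal.add_mem _ hp hq
    | smul c p hp ih =>
      have h : c • p - killVertex K w (c • p) =
          c * (p - killVertex K w p) + (c - killVertex K w c) * killVertex K w p := by
        rw [smul_eq_mul, map_mul]; ring
      rw [h]
      exact Ideal.add_mem _ (Ideal.mul_mem_left _ _ ih) (sub_killVertex_mul_mem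
        (mul_mem_bIdeal_of_mem_completeAt (Or.inl rfl) (hstable p hp))
        (mul_mem_bIdeal_of_mem_completeAt (Or.inr rfl) (hstable p hp)) c)
  simpa using Ideal.add_mem _ (hsub F h1) hkill

end BinomialEdgeIdeals

/-! ### Disjoint unions of cliques: their ideals as kernels of monomial parametrizations. -/

section CliqueIdeals

variable {V K : Type*} [Field K]

open Classical in
/-- The parametrization of the binomial edge ideal of a disjoint union of cliques: the clique of
`v` is `c v`, and the vertices of `A` are deleted. -/
noncomputable def cliqueHom (K : Type*) [Field K] (A : Set V) (c : V → V) :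
    EdgeRing V K →ₐ[K] MvPolynomial (V ⊕ (V ⊕ V)) K :=
  aeval (Sum.elim
    (fun v => if v ∈ A then 0 else X (Sum.inl v) * X (Sum.inr (Sum.inl (c v))))
    (fun v => if v ∈ A then 0 else X (Sum.inl v) * X (Sum.inr (Sum.inr (c v)))))

lemma cliqueHom_X_inl (A : Set V) (c : V → V) {v : V} (h : v ∉ A) :
    cliqueHom K A c (X (Sum.inl v)) = X (Sum.inl v) * X (Sum.inr (Sum.inl (c v))) := by
  simp [cliqueHom, h]

lemma cliqueHom_X_inr (A : Set V) (c : V → V) {v : V} (h : v ∉ A) :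
    cliqueHom K A c (X (Sum.inr v)) = X (Sum.inl v) * X (Sum.inr (Sum.inr (c v))) := by
  simp [cliqueHom, h]

lemma cliqueHom_X_inl_of_mem {A : Set V} (c : V → V) {v : V} (h : v ∈ A) :
    cliqueHom K A c (X (Sum.inl v)) = 0 := by
  simp [cliqueHom, h]

lemma cliqueHom_X_inr_of_mem {A : Set V} (c : V → V) {v : V} (h : v ∈ A) :
    cliqueHom K A c (X (Sum.inr v)) = 0 := by
  simp [cliqueHom, h]

lemma cliqueHom_eq_zero {A : Set V} {r : V → V → Prop} {c : V → V}
    (h : ∀ a b, r a b → a ∉ A → b ∉ A → c a = c b) {F : EdgeRing V K} (hF : F ∈ bIdeal K A r) :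
    cliqueHom K A c F = 0 := by
  have : bIdeal K A r ≤ RingHom.ker (cliqueHom K A c) := by
    have h1 : ∀ w ∈ A, X (Sum.inl w) ∈ RingHom.ker (cliqueHom K A c) :=
      fun w hw => cliqueHom_X_inl_of_mem c hw
    have h2 : ∀ w ∈ A, X (Sum.inr w) ∈ RingHom.ker (cliqueHom K A c) :=
      fun w hw => cliqueHom_X_inr_of_mem c hw
    refine bIdeal_le h1 h2 (fun a b hab => ?_)
    by_cases ha : a ∈ A
    · exact fBin_mem_of_left (h1 a ha) (h2 a ha)
    by_cases hb : b ∈ A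
    · exact fBin_mem_of_right (h1 b hb) (h2 b hb)
    rw [RingHom.mem_ker, fBin, map_sub, map_mul, map_mul, cliqueHom_X_inl A c ha,
      cliqueHom_X_inl A c hb, cliqueHom_X_inr A c ha, cliqueHom_X_inr A c hb, h a b hab ha hb]
    ring
  exact this hF

/-- The exponent of the image of a variable under the parametrization of cliques. -/
noncomputable def cliqueExp (c : V → V) : V ⊕ V → (V ⊕ (V ⊕ V) →₀ ℕ) :=
  Sum.elim (fun v => Finsupp.single (Sum.inl v) 1 + Finsupp.single (Sum.inr (Sum.inl (c v))) 1)
    (fun v => Finsupp.single (Sum.inl v) 1 + Finsupp.single (Sum.inr (Sum.inr (c v))) 1)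

/-- The exponent of the image of a monomial under the parametrization of cliques. -/
noncomputable def cliqueExps (c : V → V) : (V ⊕ V →₀ ℕ) →+ (V ⊕ (V ⊕ V) →₀ ℕ) :=
  (Finsupp.linearCombination ℕ (cliqueExp c)).toAddMonoidHom

lemma cliqueExps_single (c : V → V) (s : V ⊕ V) :
    cliqueExps c (Finsupp.single s 1) = cliqueExp c s := by
  simp [cliqueExps]

/-- The monomial does not involve variables at the vertices of `A`. -/
def AvoidsVertices (A : Set V) (m : V ⊕ V →₀ ℕ) : Prop :=
  ∀ v ∈ A, m (Sum.inl v) = 0 ∧ m (Sum.inr v) = 0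

lemma cliqueHom_monomial {A : Set V} (c : V → V) (m : V ⊕ V →₀ ℕ) (hm : AvoidsVertices A m) :
    cliqueHom K A c (monomial m 1) = monomial (cliqueExps c m) 1 := by
  induction m using Finsupp.induction_linear with
  | zero =>
    rw [map_zero]
    exact map_one _
  | add m n hm' hn' =>
    have h1 : (monomial (m + n) 1 : EdgeRing V K) = monomial m 1 * monomial n 1 := by
      rw [monomial_mul, one_mul]
    have h2 : ∀ v ∈ A, (m (Sum.inl v) + n (Sum.inl v) = 0) ∧
        (m (Sum.inr v) + n (Sum.inr v) = 0) := hm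
    rw [h1, map_mul, hm' fun v hv => by have := h2 v hv; omega,
      hn' fun v hv => by have := h2 v hv; omega, monomial_mul, one_mul, map_add]
  | single s j =>
    by_cases hj : j = 0
    · subst hj
      rw [Finsupp.single_zero, map_zero]
      exact map_one _
    · have hX : cliqueHom K A c (X s) = monomial (cliqueExp c s) 1 := by
        rcases s with v | v
        · have hv : v ∉ A := fun hv => hj (by simpa using (hm v hv).1)
          rw [cliqueHom_X_inl A c hv, X, X, monomial_mul, one_mul]
          rfl
        · have hv : v ∉ A := fun hv => hj (by simpa using (hm v hv).2)
          rw [cliqueHom_X_inr A c hv, X, X, monomial_mul, one_mul]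
          rfl
      have h1 : (monomial (Finsupp.single s j) 1 : EdgeRing V K) = X s ^ j := by
        rw [X_pow_eq_monomial]
      have h2 : cliqueExps c (Finsupp.single s j) = j • cliqueExp c s := by
        simp [cliqueExps]
      rw [h1, map_pow, hX, monomial_pow, one_pow, h2]

lemma cliqueExps_inl (c : V → V) (m : V ⊕ V →₀ ℕ) (v : V) :
    cliqueExps c m (Sum.inl v) = m (Sum.inl v) + m (Sum.inr v) := by
  classical
  induction m using Finsupp.induction_linear with
  | zero => simp
  | add m n hm hn => rw [map_add, Finsupp.add_apply, hm, hn, Finsupp.add_apply, Finsupp.add_apply]; ring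
  | single s j =>
    cases s <;> simp [cliqueExps, cliqueExp, Finsupp.single_apply]

variable [Fintype V]

open Classical in
lemma cliqueExps_inr_inl (c : V → V) (m : V ⊕ V →₀ ℕ) (k : V) :
    cliqueExps c m (Sum.inr (Sum.inl k)) = ∑ v with c v = k, m (Sum.inl v) := by
  induction m using Finsupp.induction_linear with
  | zero => simp
  | add m n hm hn =>
    rw [map_add, Finsupp.add_apply, hm, hn, ← Finset.sum_add_distrib]
    rfl
  | single s j =>
    cases s <;> simp [cliqueExps, cliqueExp, Finsupp.single_apply, Finset.sum_ite_eq]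

/-- Equal images mean equal total exponents at every vertex and equal total `x`-exponents on every
clique. If `m` has too many `x_v`, some `w` in the clique of `v` has too few `x_w`, and replacing
`x_v y_w` by `y_v x_w` changes the monomial by a multiple of `fBin K v w`. The total excess drops,
and without excess the monomials agree. -/
lemma monomial_sub_mem_bIdeal {A : Set V} {r : V → V → Prop} {c : V → V}
    (h : ∀ a b, a ∉ A → b ∉ A → c a = c b → r a b) (m m' : V ⊕ V →₀ ℕ)
    (hm : AvoidsVertices A m) (hE : cliqueExps c m = cliqueExps c m') :
    (monomial m 1 : EdgeRing V K) - monomial m' 1 ∈ bIdeal K A r := by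
  classical
  induction hD : ∑ v, (m (Sum.inl v) - m' (Sum.inl v)) using Nat.strong_induction_on
    generalizing m with
  | _ D ih =>
  have htot : ∀ v, m (Sum.inl v) + m (Sum.inr v) = m' (Sum.inl v) + m' (Sum.inr v) := fun v => by
    rw [← cliqueExps_inl c, hE, cliqueExps_inl]
  have hcls : ∀ k, ∑ v with c v = k, m (Sum.inl v) = ∑ v with c v = k, m' (Sum.inl v) :=
    fun k => by rw [← cliqueExps_inr_inl, hE, cliqueExps_inr_inl]
  by_cases hex : ∃ v, m' (Sum.inl v) < m (Sum.inl v)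
  · obtain ⟨v, hv⟩ := hex
    obtain ⟨w, hcw, hw⟩ : ∃ w, c w = c v ∧ m (Sum.inl w) < m' (Sum.inl w) := by
      by_contra! hcon
      refine absurd (hcls (c v)) (ne_of_gt (Finset.sum_lt_sum (fun i hi => hcon i ?_)
        ⟨v, ?_, hv⟩))
      · simpa using hi
      · simp
    have hvw : v ≠ w := by rintro rfl; omega
    have hvA : v ∉ A := fun hA => by have := (hm v hA).1; omega
    have hwA : w ∉ A := fun hA => by have := (hm w hA).2; have := htot w; omega
    have hle : Finsupp.single (Sum.inl v) 1 + Finsupp.single (Sum.inr w) 1 ≤ m := by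
      intro s
      have := htot w
      rcases s with s | s
      · by_cases hs : s = v
        · subst hs; simp; omega
        · simp [Ne.symm hs]
      · by_cases hs : s = w
        · subst hs; simp; omega
        · simp [Ne.symm hs]
    obtain ⟨n, hn⟩ := exists_add_of_le hle
    set m₁ : V ⊕ V →₀ ℕ := Finsupp.single (Sum.inr v) 1 + Finsupp.single (Sum.inl w) 1 + n with hm₁
    have e1 : ∀ u, m (Sum.inl u) = (if v = u then 1 else 0) + n (Sum.inl u) := fun u => by
      rw [hn]; simp [Finsupp.single_apply]
    have e2 : ∀ u, m₁ (Sum.inl u) = (if w = u then 1 else 0) + n (Sum.inl u) := fun u => by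
      rw [hm₁]; simp [Finsupp.single_apply]
    have e3 : ∀ u, m (Sum.inr u) = (if w = u then 1 else 0) + n (Sum.inr u) := fun u => by
      rw [hn]; simp [Finsupp.single_apply]
    have e4 : ∀ u, m₁ (Sum.inr u) = (if v = u then 1 else 0) + n (Sum.inr u) := fun u => by
      rw [hm₁]; simp [Finsupp.single_apply]
    have h1 : (monomial m 1 : EdgeRing V K) - monomial m₁ 1 ∈ bIdeal K A r := by
      have : (monomial m 1 : EdgeRing V K) - monomial m₁ 1 = monomial n 1 * fBin K v w := by
        rw [fBin, hn, hm₁]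
        simp only [X, mul_sub, monomial_mul, mul_one]
        rw [add_comm n, add_comm n]
      rw [this]
      exact Ideal.mul_mem_left _ _ (fBin_mem_bIdeal (h v w hvA hwA hcw.symm))
    have hE₁ : cliqueExps c m₁ = cliqueExps c m' := by
      rw [← hE, hn, hm₁]
      simp only [map_add, cliqueExps_single, cliqueExp, Sum.elim_inl, Sum.elim_inr, hcw]
      abel
    have hm₁A : AvoidsVertices A m₁ := by
      intro u hu
      have huv : v ≠ u := fun h => hvA (h ▸ hu)
      have huw : w ≠ u := fun h => hwA (h ▸ hu)
      have := hm u hu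
      rw [e1, e3, if_neg huv, if_neg huw] at this
      rw [e2, e4, if_neg huv, if_neg huw]
      exact this
    have hlt : ∑ u, (m₁ (Sum.inl u) - m' (Sum.inl u)) < D := by
      rw [← hD]
      refine Finset.sum_lt_sum (fun u _ => ?_) ⟨v, Finset.mem_univ v, ?_⟩
      · have h5 := e1 u
        have h6 := e2 u
        by_cases hu : w = u
        · subst hu
          rw [if_pos rfl] at h6
          rw [if_neg hvw] at h5
          omega
        · rw [if_neg hu] at h6
          omega
      · have h5 := e1 v
        have h6 := e2 v
        rw [if_pos rfl] at h5
        rw [if_neg hvw.symm] at h6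
        omega
    have h2 := ih _ hlt m₁ hm₁A hE₁ rfl
    simpa using Ideal.add_mem _ h1 h2
  · push Not at hex
    have heq : ∀ v, m (Sum.inl v) = m' (Sum.inl v) := by
      intro v
      by_contra hne
      exact absurd (hcls (c v)) (ne_of_lt (Finset.sum_lt_sum (fun i _ => hex i)
        ⟨v, by simp, lt_of_le_of_ne (hex v) hne⟩))
    have : m = m' := by
      ext s
      rcases s with s | s
      · exact heq s
      · have := heq s
        have := htot s
        omega
    rw [this, sub_self]
    exact Ideal.zero_mem _

/-- The binomial edge ideal of a disjoint union of cliques is the kernel of its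
parametrization. -/
theorem mem_bIdeal_of_cliqueHom_eq_zero {A : Set V} {r : V → V → Prop} {c : V → V}
    (h : ∀ a b, a ∉ A → b ∉ A → c a = c b → r a b) {F : EdgeRing V K}
    (hF : cliqueHom K A c F = 0) : F ∈ bIdeal K A r := by
  classical
  -- A partial inverse on monomials: an exponent in the image goes to the class of a chosen
  -- preimage, and by `monomial_sub_mem_bIdeal` the choice is immaterial. Then `ψ` composed with
  -- `cliqueHom` is the quotient map, so the kernel of `cliqueHom` lies in the ideal.
  let ψ : MvPolynomial (V ⊕ (V ⊕ V)) K →ₗ[K] EdgeRing V K ⧸ bIdeal K A r :=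
    (basisMonomials (V ⊕ (V ⊕ V)) K).constr K fun μ =>
      if hμ : ∃ m, AvoidsVertices A m ∧ cliqueExps c m = μ then
        Ideal.Quotient.mk _ (monomial hμ.choose 1) else 0
  have hψ : ψ.comp (cliqueHom K A c).toLinearMap =
      (Ideal.Quotient.mkₐ K (bIdeal K A r)).toLinearMap := by
    refine (basisMonomials (V ⊕ V) K).ext fun m => ?_
    rw [coe_basisMonomials]
    simp only [LinearMap.comp_apply, AlgHom.toLinearMap_apply, Ideal.Quotient.mkₐ_eq_mk]
    by_cases hm : AvoidsVertices A m
    · rw [cliqueHom_monomial c m hm]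
      have h1 := (basisMonomials (V ⊕ (V ⊕ V)) K).constr_basis K (fun μ =>
        if hμ : ∃ m, AvoidsVertices A m ∧ cliqueExps c m = μ then
          Ideal.Quotient.mk (bIdeal K A r) (monomial hμ.choose 1) else 0) (cliqueExps c m)
      rw [coe_basisMonomials] at h1
      change ψ _ = _ at h1
      have hex : ∃ m', AvoidsVertices A m' ∧ cliqueExps c m' = cliqueExps c m := ⟨m, hm, rfl⟩
      rw [h1, dif_pos hex, Ideal.Quotient.eq]
      exact monomial_sub_mem_bIdeal h _ _ hex.choose_spec.1 hex.choose_spec.2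
    · unfold AvoidsVertices at hm
      push Not at hm
      obtain ⟨v, hv, hne⟩ := hm
      obtain ⟨s, hs, hms⟩ : ∃ s, (s = Sum.inl v ∨ s = Sum.inr v) ∧ m s ≠ 0 := by
        by_cases h0 : m (Sum.inl v) = 0
        · exact ⟨_, Or.inr rfl, hne h0⟩
        · exact ⟨_, Or.inl rfl, h0⟩
      have hdvd : (monomial m 1 : EdgeRing V K) =
          X s * monomial (m - Finsupp.single s 1) 1 := by
        rw [X, monomial_mul, one_mul, add_tsub_cancel_of_le]
        rw [Finsupp.single_le_iff]
        omega
      have hX : cliqueHom K A c (X s) = 0 := by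
        rcases hs with rfl | rfl
        · exact cliqueHom_X_inl_of_mem c hv
        · exact cliqueHom_X_inr_of_mem c hv
      have hX' : X s ∈ bIdeal K A r := by
        rcases hs with rfl | rfl
        · exact X_inl_mem_bIdeal hv
        · exact X_inr_mem_bIdeal hv
      rw [hdvd, map_mul, hX, zero_mul, map_zero, eq_comm, Ideal.Quotient.eq_zero_iff_mem]
      exact Ideal.mul_mem_right _ _ hX'
  have := LinearMap.congr_fun hψ F
  simp only [LinearMap.comp_apply, AlgHom.toLinearMap_apply, Ideal.Quotient.mkₐ_eq_mk, hF,
    map_zero] at this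
  exact Ideal.Quotient.eq_zero_iff_mem.mp this.symm

end CliqueIdeals

/-! ### Nonzerodivisors modulo binomial edge ideals. -/

section NonZeroDivisors

variable {V K : Type*} [Field K]

/-- The neighbours of `u` outside `A` are pairwise related. -/
def IsSimplicial (A : Set V) (r : V → V → Prop) (u : V) : Prop :=
  ∀ a b, a ∉ A → b ∉ A → r u a → r u b → r a b

lemma completeAt_refl {r : V → V → Prop} (hr : ∀ a, r a a) (w a : V) : completeAt r w a a :=
  Or.inl (hr a)

lemma completeAt_symm {r : V → V → Prop} (hr : ∀ a b, r a b → r b a) (w : V) (a b : V)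
    (h : completeAt r w a b) : completeAt r w b a :=
  h.imp (hr a b) fun h => ⟨h.2, h.1⟩

/-- A vertex `u` gains neighbours only if it is adjacent to `w`. Then `w`, being outside `A`, is
adjacent to all old neighbours of `u` outside `A`, so the completion at `w` joins old and new ones
alike. -/
lemma IsSimplicial.completeAt {A : Set V} {r : V → V → Prop} {u w : V}
    (hs : ∀ a b, r a b → r b a) (hw : w ∉ A) (hu : IsSimplicial A r u) :
    IsSimplicial A (completeAt r w) u := by
  rintro a b ha hb (h1 | ⟨h1, h1'⟩) (h2 | ⟨h2, h2'⟩)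
  · exact Or.inl (hu a b ha hb h1 h2)
  · exact Or.inr ⟨hu w a hw ha (hs _ _ h2) h1, h2'⟩
  · exact Or.inr ⟨h1', hu w b hw hb (hs _ _ h1) h2⟩
  · exact Or.inr ⟨h1', h2'⟩

lemma isSimplicial_completeAt_self {A : Set V} {r : V → V → Prop} (v : V) :
    IsSimplicial A (completeAt r v) v := by
  rintro a b - - h1 h2
  exact Or.inr ⟨h1.elim id fun h => h.2, h2.elim id fun h => h.2⟩

/-- A polynomial that vanishes on none of the relevant components is a nonzerodivisor modulo a
binomial edge ideal. -/
theorem mem_bIdeal_of_mul_mem [Fintype V] {U : Set V} {E : V → V → Prop} (hE : Equivalence E)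
    {p : EdgeRing V K}
    (hp : ∀ (A : Set V) (c : V → V), (∀ u ∈ U, u ∉ A) → (∀ a b, c a = c b → E a b) →
      cliqueHom K A c p ≠ 0)
    {A : Set V} {r : V → V → Prop} (hr : ∀ a, r a a) (hs : ∀ a b, r a b → r b a)
    (hU : ∀ u ∈ U, u ∉ A) (hUs : ∀ u ∈ U, IsSimplicial A r u) (hrE : ∀ a b, r a b → E a b)
    {F : EdgeRing V K} (hF : p * F ∈ bIdeal K A r) : F ∈ bIdeal K A r := by
  classical
  -- Completing at a non-simplicial vertex lowers the number of unrelated pairs; deleting it lowers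
  -- the number of vertices without adding such pairs. The equivalence `E` persists in both cases
  -- and records which vertices can never end up in one clique.
  induction hN : (Finset.univ.filter fun q : V × V => q.1 ∉ A ∧ q.2 ∉ A ∧ ¬ r q.1 q.2).card +
    (Finset.univ.filter fun a : V => a ∉ A).card using Nat.strong_induction_on generalizing A r with
  | _ N ih =>
  -- If every remaining vertex is simplicial, the relation is transitive outside `A`: the graph is a
  -- disjoint union of cliques. The parametrization then maps to a domain, where `p` is nonzero by
  -- `hp`.
  by_cases hall : ∀ w, w ∉ A → IsSimplicial A r w
  · let s : Setoid V :=
      { r := fun a b => a = b ∨ (a ∉ A ∧ b ∉ A ∧ r a b)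
        iseqv := by
          refine ⟨fun a => Or.inl rfl, fun {a b} h => ?_, fun {a b c} h h' => ?_⟩
          · rcases h with h | ⟨h1, h2, h3⟩
            · exact Or.inl h.symm
            · exact Or.inr ⟨h2, h1, hs _ _ h3⟩
          · rcases h with rfl | ⟨h1, h2, h3⟩
            · exact h'
            · rcases h' with rfl | ⟨h1', h2', h3'⟩
              · exact Or.inr ⟨h1, h2, h3⟩
              · exact Or.inr ⟨h1, h2', hall b h2 a c h1 h2' (hs _ _ h3) h3'⟩ }
    let c : V → V := fun v => (Quotient.mk s v).out
    have hc : ∀ a b, c a = c b ↔ (a = b ∨ (a ∉ A ∧ b ∉ A ∧ r a b)) := by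
      intro a b
      constructor
      · intro h
        exact Quotient.exact (Quotient.out_injective h)
      · intro h
        have : Quotient.mk s a = Quotient.mk s b := Quotient.sound h
        simp only [c, this]
    refine mem_bIdeal_of_cliqueHom_eq_zero (c := c) (fun a b ha hb h => ?_) ?_
    · rcases (hc a b).mp h with rfl | h
      · exact hr a
      · exact h.2.2
    · have h1 := cliqueHom_eq_zero (c := c)
        (fun a b h ha hb => (hc a b).mpr (Or.inr ⟨ha, hb, h⟩)) hF
      rw [map_mul] at h1
      refine (mul_eq_zero.mp h1).resolve_left (hp A c hU fun a b h => ?_)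
      rcases (hc a b).mp h with rfl | h
      · exact hE.refl a
      · exact hrE _ _ h.2.2
  · push Not at hall
    obtain ⟨w, hw, hns⟩ := hall
    -- The vertices of `U` are simplicial, so the recursion never deletes them, and `hp` is
    -- applicable at its end.
    have hwU : w ∉ U := fun h => hns (hUs w h)
    unfold IsSimplicial at hns
    push Not at hns
    obtain ⟨a, b, ha, hb, hwa, hwb, hab⟩ := hns
    refine mem_bIdeal_of_completeAt_of_insert (w := w) hs ?_ ?_
    · refine ih _ ?_ (completeAt_refl hr w) (completeAt_symm hs w) hU
        (fun u hu => (hUs u hu).completeAt hs hw) (fun x y hxy => ?_)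
        (le_bIdeal_completeAt w hF) rfl
      · rw [← hN, Nat.add_lt_add_iff_right]
        refine Finset.card_lt_card (Finset.ssubset_iff_of_subset (fun q hq => ?_) |>.mpr
          ⟨(a, b), ?_, ?_⟩)
        · simp only [Finset.mem_filter, Finset.mem_univ, true_and] at hq ⊢
          exact ⟨hq.1, hq.2.1, fun h => hq.2.2 (Or.inl h)⟩
        · simp [ha, hb, hab]
        · simp [completeAt, hwa, hwb]
      · rcases hxy with h | ⟨h1, h2⟩
        · exact hrE _ _ h
        · exact hE.trans (hE.symm (hrE _ _ h1)) (hrE _ _ h2)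
    · refine ih _ ?_ hr hs (fun u hu h => ?_) (fun u hu x y hx hy => ?_) hrE
        (bIdeal_mono (Set.subset_insert w A) (fun _ _ h => h) hF) rfl
      · rw [← hN]
        refine Nat.add_lt_add_of_le_of_lt (Finset.card_le_card fun q hq => ?_)
          (Finset.card_lt_card (Finset.ssubset_iff_of_subset (fun x hx => ?_) |>.mpr ⟨w, ?_, ?_⟩))
        · simp only [Finset.mem_filter, Finset.mem_univ, true_and, Set.mem_insert_iff] at hq ⊢
          tauto
        · simp only [Finset.mem_filter, Finset.mem_univ, true_and, Set.mem_insert_iff] at hx ⊢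
          tauto
        · simp [hw]
        · simp
      · rcases h with rfl | h
        · exact hwU hu
        · exact hU u hu h
      · exact hUs u hu x y (fun h => hx (Or.inr h)) (fun h => hy (Or.inr h))

/-- The binomial of an isolated and a simplicial vertex is a nonzerodivisor. -/
theorem mem_bIdeal_of_fBin_mul_mem [Fintype V] {A : Set V} {r : V → V → Prop} {u v : V}
    (hr : ∀ a, r a a) (hs : ∀ a b, r a b → r b a) (hu : u ∉ A) (hv : v ∉ A) (huv : u ≠ v)
    (hiso : ∀ a, r u a → a ∉ A → a = u) (hsimp : IsSimplicial A r v) {F : EdgeRing V K}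
    (hF : fBin K u v * F ∈ bIdeal K A r) : F ∈ bIdeal K A r := by
  classical
  -- Pairs that meet `A` give redundant generators. Removing them isolates `u` completely, so that
  -- the equivalence chosen below contains the relation.
  have hred : bIdeal K A r =
      bIdeal K A (fun a b => a = b ∨ (a ∉ A ∧ b ∉ A ∧ r a b)) := by
    apply le_antisymm
    · refine bIdeal_le (fun _ h => X_inl_mem_bIdeal h) (fun _ h => X_inr_mem_bIdeal h)
        fun a b hab => ?_
      by_cases ha : a ∈ A
      · exact fBin_mem_of_left (X_inl_mem_bIdeal ha) (X_inr_mem_bIdeal ha)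
      by_cases hb : b ∈ A
      · exact fBin_mem_of_right (X_inl_mem_bIdeal hb) (X_inr_mem_bIdeal hb)
      exact fBin_mem_bIdeal (Or.inr ⟨ha, hb, hab⟩)
    · refine bIdeal_mono le_rfl fun a b hab => ?_
      rcases hab with rfl | h
      · exact hr a
      · exact h.2.2
  rw [hred] at hF ⊢
  refine mem_bIdeal_of_mul_mem (U := {u, v}) (E := fun a b => a = u ↔ b = u)
    ⟨fun _ => Iff.rfl, fun h => h.symm, fun h h' => h.trans h'⟩ (fun A' c hA' hc => ?_)
    (fun a => Or.inl rfl) (fun a b h => ?_) ?_ ?_ (fun a b h => ?_) hF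
  · have hu' : u ∉ A' := hA' u (Or.inl rfl)
    have hv' : v ∉ A' := hA' v (Or.inr rfl)
    have hcuv : c u ≠ c v := fun h => huv ((hc u v h).mp rfl).symm
    intro h0
    -- The point has `x`-coordinate one on the clique of `u` and `y`-coordinate one on the clique of
    -- `v`, all others being zero. The cliques differ, so the minor takes the value one.
    have h1 := congrArg (aeval (Sum.elim (fun _ => (1 : K))
      (Sum.elim (fun k => if k = c u then 1 else 0) (fun k => if k = c v then 1 else 0)))) h0
    rw [fBin, map_sub, map_mul, map_mul, cliqueHom_X_inl A' c hu', cliqueHom_X_inl A' c hv',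
      cliqueHom_X_inr A' c hu', cliqueHom_X_inr A' c hv'] at h1
    simp [hcuv] at h1
  · rcases h with rfl | ⟨h1, h2, h3⟩
    · exact Or.inl rfl
    · exact Or.inr ⟨h2, h1, hs _ _ h3⟩
  · rintro w (rfl | rfl)
    · exact hu
    · exact hv
  · rintro w (rfl | rfl)
    · rintro a b ha hb h1 h2
      have h1' : a = w := h1.elim (fun h => h.symm) fun h => hiso a h.2.2 ha
      have h2' : b = w := h2.elim (fun h => h.symm) fun h => hiso b h.2.2 hb
      exact Or.inl (h1'.trans h2'.symm)
    · rintro a b ha hb h1 h2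
      have h1' : r w a := h1.elim (fun h => h ▸ hr w) fun h => h.2.2
      have h2' : r w b := h2.elim (fun h => h ▸ hr w) fun h => h.2.2
      exact Or.inr ⟨ha, hb, hsimp a b ha hb h1' h2'⟩
  · rcases h with rfl | ⟨h1, h2, h3⟩
    · exact Iff.rfl
    · constructor
      · rintro rfl
        exact hiso b h3 h2
      · rintro rfl
        exact hiso a (hs _ _ h3) h1

/-- The parity binomial of two simplicial vertices is a nonzerodivisor. -/
theorem mem_bIdeal_of_gBar_mul_mem [Fintype V] {A : Set V} {r : V → V → Prop} {u v : V}
    (hr : ∀ a, r a a) (hs : ∀ a b, r a b → r b a) (hu : u ∉ A) (hv : v ∉ A)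
    (husimp : IsSimplicial A r u) (hvsimp : IsSimplicial A r v) {F : EdgeRing V K}
    (hF : gBar K u v * F ∈ bIdeal K A r) : F ∈ bIdeal K A r := by
  refine mem_bIdeal_of_mul_mem (U := {u, v}) (E := fun _ _ => True)
    ⟨fun _ => trivial, fun _ => trivial, fun _ _ => trivial⟩ (fun A' c hA' _ => ?_)
    hr hs ?_ ?_ (fun _ _ _ => trivial) hF
  · have hu' : u ∉ A' := hA' u (Or.inl rfl)
    have hv' : v ∉ A' := hA' v (Or.inr rfl)
    intro h0
    -- At the point with all `x` equal to one and all `y` equal to zero `gBar` has value one,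
    -- whatever the cliques; hence the trivial equivalence suffices here.
    have h1 := congrArg (aeval (Sum.elim (fun _ => (1 : K))
      (Sum.elim (fun _ => 1) (fun _ => 0)))) h0
    rw [gBar, map_sub, map_mul, map_mul, cliqueHom_X_inl A' c hu', cliqueHom_X_inl A' c hv',
      cliqueHom_X_inr A' c hu', cliqueHom_X_inr A' c hv'] at h1
    simp at h1
  · rintro w (rfl | rfl)
    · exact hu
    · exact hv
  · rintro w (rfl | rfl)
    · exact husimp
    · exact hvsimp

end NonZeroDivisors

/-! ### Colon ideals by the binomial of an additional edge. -/

section Colon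

variable {V K : Type*} [Field K] [Fintype V]

/-- The relation `r` with the pairs `(u, w)`, `w ∈ W`, added. -/
def addStar (r : V → V → Prop) (u : V) (W : Set V) (a b : V) : Prop :=
  r a b ∨ (a = u ∧ b ∈ W) ∨ (b = u ∧ a ∈ W)

/-- Plücker relations show that `fBin K u v` multiplies the new generators into the ideal: a vertex
of `W` is a common neighbour of `u` and `v`, and a new pair consists of two neighbours of `v`.
Conversely, after deletion of `W` and completion at `v` the vertex `u` is isolated and `v`
simplicial, so `fBin K u v` is a nonzerodivisor modulo the larger ideal. -/
theorem fBin_mul_mem_addStar_iff {A W : Set V} {r : V → V → Prop} {u v : V}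
    (hr : ∀ a, r a a) (hs : ∀ a b, r a b → r b a) (hu : u ∉ A) (hv : v ∉ A) (huv : u ≠ v)
    (hiso : ∀ a, r u a → a = u) (hW : ∀ w ∈ W, r v w) (hvW : v ∉ W) (F : EdgeRing V K) :
    F ∈ bIdeal K (A ∪ W) (completeAt r v) ↔ fBin K u v * F ∈ bIdeal K A (addStar r u W) := by
  have huW : u ∉ W := fun h => huv (hiso v (hs _ _ (hW u h))).symm
  constructor
  · intro hF
    have hstar : ∀ w ∈ W, fBin K u w ∈ bIdeal K A (addStar r u W) :=
      fun w hw => fBin_mem_bIdeal (Or.inr (Or.inl ⟨rfl, hw⟩))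
    have hstar' : ∀ w ∈ W, fBin K w v ∈ bIdeal K A (addStar r u W) :=
      fun w hw => fBin_mem_bIdeal (Or.inl (hs _ _ (hW w hw)))
    refine mul_mem_of_mem_bIdeal (fun w hw => ?_) (fun w hw => ?_) (fun a b hab => ?_) hF
    · rcases hw with hw | hw
      · exact Ideal.mul_mem_left _ _ (X_inl_mem_bIdeal hw)
      · rw [mul_comm]
        refine X_inl_mul_fBin_mem ?_ (hstar' w hw)
        rw [fBin_swap]
        exact neg_mem (hstar w hw)
    · rcases hw with hw | hw
      · exact Ideal.mul_mem_left _ _ (X_inr_mem_bIdeal hw)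
      · rw [mul_comm]
        refine X_inr_mul_fBin_mem ?_ (hstar' w hw)
        rw [fBin_swap]
        exact neg_mem (hstar w hw)
    · rcases hab with hab | ⟨ha, hb⟩
      · exact Ideal.mul_mem_left _ _ (fBin_mem_bIdeal (Or.inl hab))
      · have ha' : fBin K v a ∈ bIdeal K A (addStar r u W) := fBin_mem_bIdeal (Or.inl ha)
        have hb' : fBin K v b ∈ bIdeal K A (addStar r u W) := fBin_mem_bIdeal (Or.inl hb)
        rw [fBin.eq_def K u v, sub_mul, mul_assoc, mul_assoc]
        exact Ideal.sub_mem _ (Ideal.mul_mem_left _ _ (X_inr_mul_fBin_mem ha' hb'))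
          (Ideal.mul_mem_left _ _ (X_inl_mul_fBin_mem ha' hb'))
  · intro hF
    have hle : bIdeal K A (addStar r u W) ≤ bIdeal K (A ∪ W) (completeAt r v) := by
      refine bIdeal_le (fun w hw => X_inl_mem_bIdeal (Or.inl hw))
        (fun w hw => X_inr_mem_bIdeal (Or.inl hw)) (fun a b hab => ?_)
      rcases hab with hab | ⟨rfl, hb⟩ | ⟨rfl, ha⟩
      · exact fBin_mem_bIdeal (Or.inl hab)
      · exact fBin_mem_of_right (X_inl_mem_bIdeal (Or.inr hb)) (X_inr_mem_bIdeal (Or.inr hb))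
      · exact fBin_mem_of_left (X_inl_mem_bIdeal (Or.inr ha)) (X_inr_mem_bIdeal (Or.inr ha))
    refine mem_bIdeal_of_fBin_mul_mem (completeAt_refl hr v) (completeAt_symm hs v)
      (fun h => h.elim hu huW) (fun h => h.elim hv hvW) huv (fun a ha _ => ?_)
      (isSimplicial_completeAt_self v) (hle hF)
    rcases ha with ha | ⟨h1, -⟩
    · exact hiso a ha
    · exact absurd (hiso v (hs _ _ h1)).symm huv

/-- Each term of `gBar` contains a variable at `u` and one at `v`, so Plücker relations at either
vertex absorb the added pairs; as `u` and `v` are unrelated, completion at `u` gives `v` no new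
neighbours. After both completions `u` and `v` are simplicial, and `gBar K u v` is a nonzerodivisor.
-/
theorem gBar_mul_mem_iff {r : V → V → Prop} {u v : V}
    (hr : ∀ a, r a a) (hs : ∀ a b, r a b → r b a) (huv : ¬ r u v) (F : EdgeRing V K) :
    F ∈ bIdeal K ∅ (completeAt (completeAt r u) v) ↔ gBar K u v * F ∈ bIdeal K ∅ r := by
  constructor
  · intro hF
    have hmem : ∀ {w a b}, r w a → r w b → (X (Sum.inl w) * fBin K a b ∈ bIdeal K ∅ r ∧
        X (Sum.inr w) * fBin K a b ∈ bIdeal K ∅ r) := fun ha hb =>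
      ⟨X_inl_mul_fBin_mem (fBin_mem_bIdeal ha) (fBin_mem_bIdeal hb),
        X_inr_mul_fBin_mem (fBin_mem_bIdeal ha) (fBin_mem_bIdeal hb)⟩
    have hv : ∀ {a}, completeAt r u v a → r v a :=
      fun h => h.elim id fun h => absurd h.1 huv
    have hgu : ∀ {a b}, r u a → r u b → gBar K u v * fBin K a b ∈ bIdeal K ∅ r := by
      intro a b ha hb
      have : gBar K u v * fBin K a b = X (Sum.inl v) * (X (Sum.inl u) * fBin K a b) -
          X (Sum.inr v) * (X (Sum.inr u) * fBin K a b) := by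
        rw [gBar]; ring
      rw [this]
      exact Ideal.sub_mem _ (Ideal.mul_mem_left _ _ (hmem ha hb).1)
        (Ideal.mul_mem_left _ _ (hmem ha hb).2)
    have hgv : ∀ {a b}, r v a → r v b → gBar K u v * fBin K a b ∈ bIdeal K ∅ r := by
      intro a b ha hb
      have : gBar K u v * fBin K a b = X (Sum.inl u) * (X (Sum.inl v) * fBin K a b) -
          X (Sum.inr u) * (X (Sum.inr v) * fBin K a b) := by
        rw [gBar]; ring
      rw [this]
      exact Ideal.sub_mem _ (Ideal.mul_mem_left _ _ (hmem ha hb).1)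
        (Ideal.mul_mem_left _ _ (hmem ha hb).2)
    refine mul_mem_of_mem_bIdeal (fun w hw => absurd hw (by simp))
      (fun w hw => absurd hw (by simp)) (fun a b hab => ?_) hF
    rcases hab with (hab | ⟨ha, hb⟩) | ⟨ha, hb⟩
    · exact Ideal.mul_mem_left _ _ (fBin_mem_bIdeal hab)
    · exact hgu ha hb
    · exact hgv (hv ha) (hv hb)
  · intro hF
    refine mem_bIdeal_of_gBar_mul_mem (completeAt_refl (completeAt_refl hr u) v)
      (completeAt_symm (completeAt_symm hs u) v) (by simp) (by simp)
      ((isSimplicial_completeAt_self u).completeAt (completeAt_symm hs u) (by simp))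
      (isSimplicial_completeAt_self v)
      (le_bIdeal_completeAt v (le_bIdeal_completeAt u hF))

end Colon

/-! ### Subtrees of a rooted forest as a model of chordal graphs. -/

section RootedSubtrees

variable {V P : Type*}

/-- Two vertices of `B` are related if their subtrees meet. -/
def meetRel (B : Finset V) (T : V → Set P) (a b : V) : Prop :=
  a = b ∨ (a ∈ B ∧ b ∈ B ∧ (T a ∩ T b).Nonempty)

lemma meetRel_refl (B : Finset V) (T : V → Set P) (a : V) : meetRel B T a a := Or.inl rfl

lemma meetRel_symm (B : Finset V) (T : V → Set P) (a b : V) (h : meetRel B T a b) :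
    meetRel B T b a := by
  rcases h with rfl | ⟨h1, h2, h3⟩
  · exact Or.inl rfl
  · exact Or.inr ⟨h2, h1, by rwa [Set.inter_comm]⟩

open Classical in
/-- The subtrees that represent the completion at `v`. -/
noncomputable def completeTree (T : V → Set P) (v w : V) : Set P :=
  if (T v ∩ T w).Nonempty then T w ∪ T v else T w

lemma subset_completeTree (T : V → Set P) (v w : V) : T w ⊆ completeTree T v w := by
  unfold completeTree
  split_ifs
  · exact Set.subset_union_left
  · exact le_rfl

lemma subset_completeTree_of_meet {T : V → Set P} {v w : V} (h : (T v ∩ T w).Nonempty) :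
    T v ⊆ completeTree T v w := by
  rw [completeTree, if_pos h]
  exact Set.subset_union_right

variable [PartialOrder P]

/-- A set with a least element that contains the segments from it to its elements. In a rooted
forest these are the vertex sets of subtrees. -/
def IsRootedSubtree (T : Set P) : Prop :=
  ∃ t ∈ T, ∀ p ∈ T, t ≤ p ∧ ∀ q, t ≤ q → q ≤ p → q ∈ T

/-- Both roots lie below a common point, hence are comparable, and the lower one is the root of the
union. A segment from it to a point of the other subtree runs inside the first subtree up to the
other root, and inside the second one beyond. -/
lemma IsRootedSubtree.union (hP : ∀ p q s : P, q ≤ p → s ≤ p → q ≤ s ∨ s ≤ q) {T T' : Set P}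
    (hT : IsRootedSubtree T) (hT' : IsRootedSubtree T') (h : (T ∩ T').Nonempty) :
    IsRootedSubtree (T ∪ T') := by
  have aux : ∀ {T T' : Set P} {t t' p : P}, t ∈ T → (∀ p ∈ T, t ≤ p ∧ ∀ q, t ≤ q → q ≤ p → q ∈ T) →
      (∀ p ∈ T', t' ≤ p ∧ ∀ q, t' ≤ q → q ≤ p → q ∈ T') → p ∈ T → p ∈ T' → t ≤ t' →
      IsRootedSubtree (T ∪ T') := by
    intro T T' t t' p ht hT hT' hp hp' htt
    refine ⟨t, Or.inl ht, fun q hq => ?_⟩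
    rcases hq with hq | hq
    · exact ⟨(hT q hq).1, fun s h1 h2 => Or.inl ((hT q hq).2 s h1 h2)⟩
    · refine ⟨htt.trans (hT' q hq).1, fun s h1 h2 => ?_⟩
      rcases hP q s t' h2 (hT' q hq).1 with h3 | h3
      · exact Or.inl ((hT p hp).2 s h1 (h3.trans (hT' p hp').1))
      · exact Or.inr ((hT' q hq).2 s h3 h2)
  obtain ⟨t, ht, hTt⟩ := hT
  obtain ⟨t', ht', hTt'⟩ := hT'
  obtain ⟨p, hp, hp'⟩ := h
  rcases hP p t t' (hTt p hp).1 (hTt' p hp').1 with h | h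
  · exact aux ht hTt hTt' hp hp' h
  · rw [Set.union_comm]
    exact aux ht' hTt' hTt hp' hp h

lemma IsRootedSubtree.nonempty {T : Set P} (hT : IsRootedSubtree T) : T.Nonempty :=
  hT.imp fun _ h => h.1

/-- Members of a finite family of subtrees that meet a member with maximal root pairwise meet. -/
lemma exists_simplicial_of_isRootedSubtree
    (hP : ∀ p q s : P, q ≤ p → s ≤ p → q ≤ s ∨ s ≤ q) {T : V → Set P}
    (hT : ∀ v, IsRootedSubtree (T v)) {B : Finset V} (hB : B.Nonempty) :
    ∃ u ∈ B, ∀ a ∈ B, ∀ b ∈ B, (T u ∩ T a).Nonempty → (T u ∩ T b).Nonempty →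
      (T a ∩ T b).Nonempty := by
  choose t ht htT using hT
  obtain ⟨u, hu⟩ := B.exists_maximalFor t hB
  -- The root of `T u` lies in every member that meets `T u`, by maximality, and so is a common
  -- point of all of them.
  have key : ∀ a ∈ B, (T u ∩ T a).Nonempty → t u ∈ T a := by
    rintro a ha ⟨p, hpu, hpa⟩
    have h1 := (htT u p hpu).1
    have h2 := (htT a p hpa).1
    rcases hP p (t u) (t a) h1 h2 with h | h
    · exact (htT a p hpa).2 (t u) (hu.2 ha h) h1
    · exact (htT a p hpa).2 (t u) h h1
  exact ⟨u, hu.1, fun a ha b hb h1 h2 => ⟨t u, key a ha h1, key b hb h2⟩⟩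

lemma isRootedSubtree_completeTree (hP : ∀ p q s : P, q ≤ p → s ≤ p → q ≤ s ∨ s ≤ q)
    {T : V → Set P} (hT : ∀ v, IsRootedSubtree (T v)) (v w : V) :
    IsRootedSubtree (completeTree T v w) := by
  unfold completeTree
  split_ifs with h
  · exact (hT w).union hP (hT v) (by rwa [Set.inter_comm])
  · exact hT w

/-- Enlarging by `T v` every subtree that meets it makes all of these meet in `T v`, and creates no
intersection with a subtree disjoint from `T v`. Completion at a vertex thus stays within the class
of chordal graphs. -/
lemma meetRel_completeTree_iff {T : V → Set P} (hT : ∀ v, IsRootedSubtree (T v)) {B : Finset V}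
    {v : V} (hv : v ∈ B) (a b : V) :
    meetRel B (completeTree T v) a b ↔ completeAt (meetRel B T) v a b := by
  classical
  constructor
  · rintro (rfl | ⟨ha, hb, h⟩)
    · exact Or.inl (Or.inl rfl)
    · by_cases hva : (T v ∩ T a).Nonempty
      · by_cases hvb : (T v ∩ T b).Nonempty
        · exact Or.inr ⟨Or.inr ⟨hv, ha, hva⟩, Or.inr ⟨hv, hb, hvb⟩⟩
        · rw [completeTree, completeTree, if_pos hva, if_neg hvb, Set.union_inter_distrib_right,
            Set.union_nonempty] at h
          exact Or.inl (Or.inr ⟨ha, hb, h.resolve_right hvb⟩)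
      · by_cases hvb : (T v ∩ T b).Nonempty
        · rw [completeTree, completeTree, if_neg hva, if_pos hvb, Set.inter_union_distrib_left,
            Set.union_nonempty, Set.inter_comm _ (T v)] at h
          exact Or.inl (Or.inr ⟨ha, hb, h.resolve_right hva⟩)
        · rw [completeTree, completeTree, if_neg hva, if_neg hvb] at h
          exact Or.inl (Or.inr ⟨ha, hb, h⟩)
  · have hsub : ∀ {a}, meetRel B T v a → a ∈ B ∧ T v ⊆ completeTree T v a := by
      rintro a (rfl | ⟨-, ha, h⟩)
      · exact ⟨hv, subset_completeTree T v v⟩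
      · exact ⟨ha, subset_completeTree_of_meet h⟩
    rintro ((rfl | ⟨ha, hb, p, h1, h2⟩) | ⟨h1, h2⟩)
    · exact Or.inl rfl
    · exact Or.inr ⟨ha, hb, p, subset_completeTree T v a h1, subset_completeTree T v b h2⟩
    · obtain ⟨p, hp⟩ := (hT v).nonempty
      exact Or.inr ⟨(hsub h1).1, (hsub h2).1, p, (hsub h1).2 hp, (hsub h2).2 hp⟩

end RootedSubtrees

/-! ### Binomial edge ideals of chordal graphs as towers of quadrics. -/

section Tower

variable {V K P : Type*} [Field K] [PartialOrder P]

lemma fBin_isHomogeneous (u v : V) : (fBin K u v).IsHomogeneous 2 :=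
  ((isHomogeneous_X K _).mul (isHomogeneous_X K _)).sub
    ((isHomogeneous_X K _).mul (isHomogeneous_X K _))

lemma gBar_isHomogeneous (u v : V) : (gBar K u v).IsHomogeneous 2 :=
  ((isHomogeneous_X K _).mul (isHomogeneous_X K _)).sub
    ((isHomogeneous_X K _).mul (isHomogeneous_X K _))

lemma bIdeal_congr {A : Set V} {r r' : V → V → Prop} (h : ∀ a b, r a b ↔ r' a b) :
    bIdeal K A r = bIdeal K A r' :=
  le_antisymm (bIdeal_mono le_rfl fun a b => (h a b).mp) (bIdeal_mono le_rfl fun a b => (h a b).mpr)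

/-- A variable is a nonzerodivisor modulo an ideal generated by other variables, so the colon ideal
is the ideal itself. -/
lemma quadTower_span_X {σ : Type*} (Z : Finset σ) :
    QuadTower (Ideal.span (X '' (Z : Set σ)) : Ideal (MvPolynomial σ K)) := by
  classical
  induction Z using Finset.induction_on with
  | empty =>
    simpa using QuadTower.bot
  | insert z Z hz ih =>
    have h1 : (Ideal.span (X '' ((insert z Z : Finset σ) : Set σ)) : Ideal (MvPolynomial σ K)) =
        Ideal.span (X '' (Z : Set σ)) ⊔ Ideal.span {X z} := by
      rw [Finset.coe_insert, Set.image_insert_eq, Ideal.span_insert, sup_comm]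
    rw [h1]
    refine QuadTower.add (d := 1) (by norm_num) (isHomogeneous_X K z) ih ih fun h =>
      ⟨fun hh => Ideal.mul_mem_left _ _ hh, fun hh => ?_⟩
    rw [mem_ideal_span_X_image] at hh ⊢
    intro m hm
    have h2 : Finsupp.single z 1 + m ∈ (X z * h).support := by
      rw [mem_support_iff, coeff_X_mul]
      exact mem_support_iff.mp hm
    obtain ⟨i, hi, hne⟩ := hh _ h2
    refine ⟨i, hi, ?_⟩
    have hiz : z ≠ i := fun h => hz (h ▸ hi)
    simpa [Finsupp.single_apply, hiz] using hne

variable [Fintype V]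

lemma quadTower_bIdeal_of_eq {A : Set V} {r : V → V → Prop} (hr : ∀ a b, r a b → a = b) :
    QuadTower (bIdeal K A r) := by
  classical
  have h1 : bIdeal K A r = Ideal.span (X '' ((Finset.univ.filter fun s : V ⊕ V =>
      ∃ w ∈ A, s = Sum.inl w ∨ s = Sum.inr w : Finset (V ⊕ V)) : Set (V ⊕ V))) := by
    apply le_antisymm
    · refine bIdeal_le (fun w hw => Ideal.subset_span ⟨_, ?_, rfl⟩)
        (fun w hw => Ideal.subset_span ⟨_, ?_, rfl⟩) (fun a b hab => ?_)
      · simpa using hw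
      · simpa using hw
      · rw [hr a b hab, fBin_self]
        exact Ideal.zero_mem _
    · rw [Ideal.span_le]
      rintro _ ⟨s, hs, rfl⟩
      simp only [Finset.coe_filter, Finset.mem_univ, true_and, Set.mem_ofPred_eq] at hs
      obtain ⟨w, hw, rfl | rfl⟩ := hs
      · exact X_inl_mem_bIdeal hw
      · exact X_inr_mem_bIdeal hw
  rw [h1]
  exact quadTower_span_X _

/-- Binomial edge ideals of chordal graphs, presented as intersection graphs of subtrees of a
rooted forest, are towers of quadrics. -/
theorem quadTower_bIdeal_meetRel (hP : ∀ p q s : P, q ≤ p → s ≤ p → q ≤ s ∨ s ≤ q)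
    (B : Finset V) (A : Set V) {T : V → Set P} (hT : ∀ v, IsRootedSubtree (T v)) :
    QuadTower (bIdeal K A (meetRel B T)) := by
  classical
  induction hn : B.card generalizing B A T with
  | zero =>
    refine quadTower_bIdeal_of_eq fun a b hab => hab.elim id fun h => ?_
    rw [Finset.card_eq_zero] at hn
    exact absurd h.1 (by simp [hn])
  | succ n ih =>
    have hne : B.Nonempty := Finset.card_pos.mp (by omega)
    obtain ⟨u, hu, hsimp⟩ := exists_simplicial_of_isRootedSubtree hP hT hne
    set B' := B.erase u with hB'
    have hcard : B'.card = n := by rw [hB', Finset.card_erase_of_mem hu]; omega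
    set r := meetRel B' T with hr
    have hiso : ∀ a, r u a → a = u := by
      rintro a (rfl | h)
      · rfl
      · exact absurd h.1 (by simp [hB'])
    -- The edges at the simplicial vertex `u` are added one at a time to the graph on `B'`.
    have key : ∀ W : Finset V, (∀ w ∈ W, w ∈ B' ∧ (T u ∩ T w).Nonempty) →
        QuadTower (bIdeal K A (addStar r u W)) := by
      intro W
      induction W using Finset.induction_on with
      | empty =>
        intro _
        have : bIdeal K A (addStar r u ((∅ : Finset V) : Set V)) = bIdeal K A r :=
          bIdeal_congr fun a b => by simp [addStar]
        rw [this]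
        exact ih B' A hT hcard
      | insert v W hv ihW =>
        intro hW
        obtain ⟨hvB, hvu⟩ := hW v (Finset.mem_insert_self v W)
        have hWW : ∀ w ∈ W, w ∈ B' ∧ (T u ∩ T w).Nonempty :=
          fun w hw => hW w (Finset.mem_insert_of_mem hw)
        have huv : u ≠ v := fun h => by simp [hB', h] at hvB
        have hsup : bIdeal K A (addStar r u ((insert v W : Finset V) : Set V)) =
            bIdeal K A (addStar r u W) ⊔ Ideal.span {fBin K u v} := by
          have huvmem : fBin K u v ∈ bIdeal K A (addStar r u W) ⊔ Ideal.span {fBin K u v} :=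
            (le_sup_right : _ ≤ bIdeal K A (addStar r u W) ⊔ _) (Ideal.mem_span_singleton_self _)
          apply le_antisymm
          · refine bIdeal_le (fun w hw => (le_sup_left : bIdeal K A (addStar r u W) ≤ _)
              (X_inl_mem_bIdeal hw)) (fun w hw => (le_sup_left : bIdeal K A (addStar r u W) ≤ _)
              (X_inr_mem_bIdeal hw)) (fun a b hab => ?_)
            rcases hab with hab | ⟨rfl, hb⟩ | ⟨rfl, ha⟩
            · exact (le_sup_left : bIdeal K A (addStar r u W) ≤ _) (fBin_mem_bIdeal (Or.inl hab))
            · rcases Finset.mem_insert.mp (Finset.mem_coe.mp hb) with rfl | hb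
              · exact huvmem
              · exact (le_sup_left : bIdeal K A (addStar r a W) ≤ _)
                  (fBin_mem_bIdeal (Or.inr (Or.inl ⟨rfl, hb⟩)))
            · rcases Finset.mem_insert.mp (Finset.mem_coe.mp ha) with rfl | ha
              · have := neg_mem huvmem
                rwa [← fBin_swap] at this
              · exact (le_sup_left : bIdeal K A (addStar r b W) ≤ _)
                  (fBin_mem_bIdeal (Or.inr (Or.inr ⟨rfl, ha⟩)))
          · refine sup_le (bIdeal_mono le_rfl fun a b hab => ?_) ?_
            · rcases hab with hab | ⟨rfl, hb⟩ | ⟨rfl, ha⟩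
              · exact Or.inl hab
              · exact Or.inr (Or.inl ⟨rfl, by simp [Finset.mem_coe.mp hb]⟩)
              · exact Or.inr (Or.inr ⟨rfl, by simp [Finset.mem_coe.mp ha]⟩)
            · rw [Ideal.span_singleton_le_iff_mem]
              exact fBin_mem_bIdeal (Or.inr (Or.inl ⟨rfl, by simp⟩))
        by_cases huA : u ∈ A
        · rw [hsup, sup_eq_left.mpr]
          · exact ihW hWW
          · rw [Ideal.span_singleton_le_iff_mem]
            exact fBin_mem_of_left (X_inl_mem_bIdeal huA) (X_inr_mem_bIdeal huA)
        by_cases hvA : v ∈ A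
        · rw [hsup, sup_eq_left.mpr]
          · exact ihW hWW
          · rw [Ideal.span_singleton_le_iff_mem]
            exact fBin_mem_of_right (X_inl_mem_bIdeal hvA) (X_inr_mem_bIdeal hvA)
        rw [hsup]
        -- The earlier neighbours `W` of `u` are also neighbours of `v`, because `u` is simplicial.
        -- The colon ideal deletes `W` and completes at `v`; its edges live on `B'`, so the
        -- induction hypothesis, stated for all `A` and `T`, applies.
        refine QuadTower.add le_rfl (fBin_isHomogeneous u v) (ihW hWW)
          (I := bIdeal K (A ∪ W) (completeAt r v)) ?_ ?_
        · rw [← bIdeal_congr (meetRel_completeTree_iff hT hvB)]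
          exact ih B' _ (isRootedSubtree_completeTree hP hT v) hcard
        · refine fBin_mul_mem_addStar_iff (meetRel_refl B' T) (meetRel_symm B' T) huA hvA huv hiso
            (fun w hw => ?_) (by simpa using hv)
          have hw' := hWW w hw
          exact Or.inr ⟨hvB, hw'.1, hsimp v (Finset.mem_of_mem_erase hvB) w
            (Finset.mem_of_mem_erase hw'.1) hvu hw'.2⟩
    have hfinal : bIdeal K A (meetRel B T) = bIdeal K A (addStar r u
        ((B'.filter fun w => (T u ∩ T w).Nonempty : Finset V) : Set V)) := by
      have hmem : ∀ {a}, a ∈ B → a ≠ u → a ∈ B' := fun ha hau => Finset.mem_erase.mpr ⟨hau, ha⟩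
      refine bIdeal_congr fun a b => ⟨?_, ?_⟩
      · rintro (rfl | ⟨ha, hb, h⟩)
        · exact Or.inl (Or.inl rfl)
        · by_cases hau : a = u
          · by_cases hbu : b = u
            · exact Or.inl (Or.inl (hau.trans hbu.symm))
            · exact Or.inr (Or.inl ⟨hau, by
                rw [Finset.mem_coe, Finset.mem_filter]; exact ⟨hmem hb hbu, hau ▸ h⟩⟩)
          · by_cases hbu : b = u
            · exact Or.inr (Or.inr ⟨hbu, by
                rw [Finset.mem_coe, Finset.mem_filter]
                exact ⟨hmem ha hau, by rw [Set.inter_comm]; exact hbu ▸ h⟩⟩)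
            · exact Or.inl (Or.inr ⟨hmem ha hau, hmem hb hbu, h⟩)
      · rintro ((rfl | ⟨ha, hb, h⟩) | ⟨rfl, hb⟩ | ⟨rfl, ha⟩)
        · exact Or.inl rfl
        · exact Or.inr ⟨Finset.mem_of_mem_erase ha, Finset.mem_of_mem_erase hb, h⟩
        · rw [Finset.mem_coe, Finset.mem_filter] at hb
          exact Or.inr ⟨hu, Finset.mem_of_mem_erase hb.1, hb.2⟩
        · rw [Finset.mem_coe, Finset.mem_filter] at ha
          exact Or.inr ⟨Finset.mem_of_mem_erase ha.1, hu, by rw [Set.inter_comm]; exact ha.2⟩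
    rw [hfinal]
    exact key _ fun w hw => by simpa using hw

/-- Adding the parity binomial of two nonadjacent vertices gives a tower of quadrics. -/
theorem quadTower_bIdeal_sup_gBar (hP : ∀ p q s : P, q ≤ p → s ≤ p → q ≤ s ∨ s ≤ q)
    {T : V → Set P} (hT : ∀ v, IsRootedSubtree (T v)) {u v : V}
    (huv : ¬ meetRel Finset.univ T u v) :
    QuadTower (bIdeal K ∅ (meetRel Finset.univ T) ⊔ Ideal.span {gBar K u v}) := by
  refine QuadTower.add le_rfl (gBar_isHomogeneous u v) (quadTower_bIdeal_meetRel hP _ _ hT)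
    (I := bIdeal K ∅ (completeAt (completeAt (meetRel Finset.univ T) u) v)) ?_
    (gBar_mul_mem_iff (meetRel_refl _ _) (meetRel_symm _ _) huv)
  have h1 : ∀ a b, meetRel Finset.univ (completeTree (completeTree T u) v) a b ↔
      completeAt (completeAt (meetRel Finset.univ T) u) v a b := by
    intro a b
    rw [meetRel_completeTree_iff (isRootedSubtree_completeTree hP hT u) (Finset.mem_univ v)]
    simp only [completeAt, meetRel_completeTree_iff hT (Finset.mem_univ u)]
  rw [← bIdeal_congr h1]
  exact quadTower_bIdeal_meetRel hP _ _
    (isRootedSubtree_completeTree hP (isRootedSubtree_completeTree hP hT u) v)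

end Tower

/-! ### Forests, odd unicyclic graphs and non-bipartite graphs. -/

section Forests

variable {V : Type*} (G : SimpleGraph V)

/-- A chosen vertex of the connected component of `v`. -/
noncomputable def componentRoot (v : V) : V := (G.connectedComponentMk v).out

lemma reachable_componentRoot (v : V) : G.Reachable (componentRoot G v) v :=
  SimpleGraph.ConnectedComponent.exact (Quot.out_eq (G.connectedComponentMk v))

lemma componentRoot_eq {a b : V} (h : G.Reachable a b) : componentRoot G a = componentRoot G b := by
  unfold componentRoot
  rw [SimpleGraph.ConnectedComponent.sound h]

/-- The vertex `q` is the neighbour of `p` on the way to the root of its component. -/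
def IsParent (p q : V) : Prop :=
  G.Adj p q ∧ G.dist (componentRoot G p) p = G.dist (componentRoot G q) q + 1

variable {G}

/-- A parent is the penultimate vertex of every path from the root to `a`. Otherwise a shortest path
to the parent would pass through `a`, contradicting that the parent is nearer to the root. -/
lemma IsParent.eq (hG : G.IsAcyclic) {a b c : V} (hb : IsParent G a b) (hc : IsParent G a c) :
    b = c := by
  have key : ∀ {b : V}, IsParent G a b → ∀ p : G.Walk (componentRoot G a) a, p.IsPath →
      b = p.penultimate := by
    intro b hb p hp
    have hr := componentRoot_eq G hb.1.reachable
    have hreach := reachable_componentRoot G b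
    have hd := hb.2
    rw [← hr] at hreach hd
    obtain ⟨q, hq, hql⟩ := hreach.exists_path_of_dist
    refine hG.eq_penultimate_of_adj_end hp hb.1 ?_
    by_contra hmem
    have ha : a ∈ q.support := hG.mem_support_of_ne_mem_support_of_adj_of_isPath hq hp
      hb.1.symm hmem
    have := hG.path_concat hp hq hb.1 ha
    have h2 := SimpleGraph.dist_le p
    rw [this, SimpleGraph.Walk.length_concat] at hql
    omega
  obtain ⟨p, hp, -⟩ := (reachable_componentRoot G a).exists_path_of_dist
  rw [key hb p hp, key hc p hp]

lemma isParent_or_isParent (hG : G.IsAcyclic) {a b : V} (h : G.Adj a b) :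
    IsParent G a b ∨ IsParent G b a := by
  have hr := componentRoot_eq G h.reachable
  rcases hG.dist_eq_dist_add_one_of_adj_of_reachable (componentRoot G a) h
    (reachable_componentRoot G a) with h' | h'
  · exact Or.inl ⟨h, by rw [h', hr]⟩
  · exact Or.inr ⟨h.symm, by rw [← hr, h']⟩

lemma dist_componentRoot_le {p q : V} (h : Relation.ReflTransGen (IsParent G) p q) :
    p = q ∨ G.dist (componentRoot G q) q < G.dist (componentRoot G p) p := by
  induction h with
  | refl => exact Or.inl rfl
  | tail _ h2 ih =>
    right
    have := h2.2
    rcases ih with rfl | ih <;> omega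

variable (G) in
/-- The order on a graph in which `q ≤ p` if `q` lies on the chain of parents of `p`. -/
@[reducible] def parentOrder : PartialOrder V where
  le q p := Relation.ReflTransGen (IsParent G) p q
  le_refl _ := Relation.ReflTransGen.refl
  le_trans _ _ _ h1 h2 := h2.trans h1
  le_antisymm a b h1 h2 := by
    rcases dist_componentRoot_le h1 with h | h
    · exact h.symm
    rcases dist_componentRoot_le h2 with h' | h'
    · exact h'
    omega

/-- A forest is the intersection graph of rooted subtrees of a rooted forest. -/
theorem exists_rootedSubtree_of_isAcyclic [Fintype V] (hG : G.IsAcyclic) :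
    ∃ (_ : PartialOrder V) (T : V → Set V),
      (∀ p q s : V, q ≤ p → s ≤ p → q ≤ s ∨ s ≤ q) ∧ (∀ v, IsRootedSubtree (T v)) ∧
      ∀ a b, meetRel Finset.univ T a b ↔ a = b ∨ G.Adj a b := by
  let _ := parentOrder G
  -- The subtree of `v` consists of `v` and its children. Two of these meet only for equal or
  -- adjacent vertices, because a common child has just one parent.
  refine ⟨inferInstance, fun v => {p | p = v ∨ IsParent G p v}, ?_, ?_, ?_⟩
  · intro p q s hq hs
    exact Relation.ReflTransGen.total_of_right_unique (fun _ _ _ h1 h2 => IsParent.eq hG h1 h2)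
      hs hq
  · intro v
    refine ⟨v, Or.inl rfl, ?_⟩
    rintro p (rfl | hp)
    · exact ⟨le_rfl, fun q h1 h2 => Or.inl (le_antisymm h2 h1)⟩
    · refine ⟨Relation.ReflTransGen.single hp, fun q h1 h2 => ?_⟩
      rcases Relation.ReflTransGen.cases_head h2 with h | ⟨p', h, h'⟩
      · exact Or.inr (h ▸ hp)
      · rw [IsParent.eq hG h hp] at h'
        exact Or.inl (le_antisymm h' h1)
  · intro a b
    constructor
    · rintro (rfl | ⟨-, -, x, hxa, hxb⟩)
      · exact Or.inl rfl
      · rcases hxa with rfl | hxa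
        · rcases hxb with rfl | hxb
          · exact Or.inl rfl
          · exact Or.inr hxb.1
        · rcases hxb with rfl | hxb
          · exact Or.inr hxa.1.symm
          · exact Or.inl (IsParent.eq hG hxa hxb)
    · rintro (rfl | h)
      · exact Or.inl rfl
      · refine Or.inr ⟨Finset.mem_univ _, Finset.mem_univ _, ?_⟩
        rcases isParent_or_isParent hG h with h | h
        · exact ⟨a, Or.inl rfl, Or.inr h⟩
        · exact ⟨b, Or.inr h, Or.inl rfl⟩

/-- An odd unicyclic graph is a forest together with an edge joining two vertices of the same
colour. -/
theorem IsOddUnicyclic.exists_edge (h : IsOddUnicyclic G) :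
    ∃ (u v : V) (c : V → Bool), G.Adj u v ∧ (G.deleteEdges {s(u, v)}).IsAcyclic ∧
      c u = c v ∧ ∀ a b, (G.deleteEdges {s(u, v)}).Adj a b → c a ≠ c b := by
  obtain ⟨⟨C, ⟨v₀, p₀, hp₀, -⟩, hC⟩, hodd⟩ := h
  obtain ⟨a, w, hw, hlen⟩ := SimpleGraph.exists_girth_eq_length.mpr (fun hG => hG p₀ hp₀)
  have hCw := hC _ ⟨a, w, hw, rfl⟩
  cases w with
  | nil => exact absurd hw SimpleGraph.Walk.not_isCycle_nil
  | @cons _ b _ hab p =>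
    -- A cycle avoiding the deleted edge would be a cycle of `G` with the same edges as the unique
    -- one, which contains that edge.
    have hac : (G.deleteEdges {s(a, b)}).IsAcyclic := by
      intro x q hq
      have hle : G.deleteEdges {s(a, b)} ≤ G := SimpleGraph.deleteEdges_le _
      have h1 := hC _ ⟨x, q.mapLe hle, hq.mapLe hle, rfl⟩
      have h2 : s(a, b) ∈ (q.mapLe hle).edges := by
        have : s(a, b) ∈ {e | e ∈ (q.mapLe hle).edges} := by
          rw [h1, ← hCw]
          simp
        exact this
      rw [SimpleGraph.Walk.edges_mapLe_eq_edges] at h2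
      have := q.edges_subset_edgeSet h2
      simp at this
    obtain ⟨c⟩ := hac.colorable_two
    let c' : (G.deleteEdges {s(a, b)}).Coloring Bool :=
      SimpleGraph.recolorOfEquiv _ finTwoEquiv c
    have hnot : s(a, b) ∉ p.edges := ((SimpleGraph.Walk.cons_isCycle_iff _ _).mp hw).2
    refine ⟨a, b, c', hab, hac, ?_, fun x y hxy => c'.valid hxy⟩
    -- What remains of the odd cycle is a walk of even length in the forest, so its ends have the
    -- same colour.
    have h1 := (c'.even_length_iff_congr (p.toDeleteEdge _ hnot))
    have h2 : Even p.length := by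
      rw [hlen, SimpleGraph.Walk.length_cons] at hodd
      grind
    have h3 : (p.toDeleteEdge _ hnot).length = p.length := by
      simp [SimpleGraph.Walk.toDeleteEdge, SimpleGraph.Walk.toDeleteEdges]
    rw [h3] at h1
    have := h1.mp h2
    exact (Bool.eq_iff_iff.mpr this).symm

/-- A graph without triangles and induced paths on four vertices is bipartite. -/
theorem exists_triangle_or_path_of_not_isBipartite (h : ¬ G.IsBipartite) :
    (∃ a b c, G.Adj a b ∧ G.Adj b c ∧ G.Adj a c) ∨
      ∃ a b c d, G.Adj a b ∧ G.Adj b c ∧ G.Adj c d ∧ a ≠ c ∧ a ≠ d ∧ b ≠ d ∧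
        ¬ G.Adj a c ∧ ¬ G.Adj a d ∧ ¬ G.Adj b d := by
  classical
  by_contra hcon
  push Not at hcon
  obtain ⟨htri, hpath⟩ := hcon
  -- Without induced paths on four vertices, every vertex reachable from `r` has distance at most
  -- two from it.
  have hreach : ∀ r a : V, G.Reachable r a → a = r ∨ G.Adj r a ∨ ∃ c, G.Adj r c ∧ G.Adj c a := by
    rintro r a ⟨w⟩
    have : ∀ {a r : V} (w : G.Walk a r), a = r ∨ G.Adj r a ∨ ∃ c, G.Adj r c ∧ G.Adj c a := by
      intro a r w
      induction w with
      | nil => exact Or.inl rfl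
      | @cons a b r hab w ih =>
        rcases ih with rfl | ih | ⟨c, hc, hcb⟩
        · exact Or.inr (Or.inl hab.symm)
        · exact Or.inr (Or.inr ⟨b, ih, hab.symm⟩)
        · by_contra hno
          push Not at hno
          obtain ⟨h1, h2, h3⟩ := hno
          have hbr : b ≠ r := fun h => h2 (h ▸ hab.symm)
          have hac : a ≠ c := fun h => h2 (h ▸ hc)
          refine h3 b ?_ hab.symm
          have hnca : ¬ G.Adj a c := fun h => h3 c hc h.symm
          by_contra hrb
          exact hrb (hpath a b c r hab hcb.symm hc.symm hac h1 hbr hnca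
            (fun h => h2 h.symm)).symm
    exact this w.reverse
  apply h
  rw [SimpleGraph.IsBipartite]
  -- Vertices are coloured by adjacency to the root of their component. Adjacent vertices of equal
  -- colour would give a triangle at the root, or an induced path that starts at the root.
  refine ⟨SimpleGraph.Coloring.mk
    (fun v => if G.Adj (componentRoot G v) v then (0 : Fin 2) else 1) ?_⟩
  intro a b hab
  have hr := componentRoot_eq G hab.reachable
  have hra := reachable_componentRoot G a
  rw [← hr]
  generalize componentRoot G a = r at hra
  by_cases h1 : G.Adj r a <;> by_cases h2 : G.Adj r b <;> simp only [h1, h2, if_true, if_false]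
  · exact fun _ => htri r a b h1 hab h2
  · simp
  · simp
  · intro _
    rcases hreach r a hra with rfl | h | ⟨c, hc, hca⟩
    · exact h2 hab
    · exact h1 h
    · have hcb : ¬ G.Adj c b := fun h => htri c a b hca hab h
      have hrb : r ≠ b := fun h => h1 (h ▸ hab.symm)
      have hra' : r ≠ a := fun h => h2 (h ▸ hab)
      have hcb' : c ≠ b := fun h => h2 (h ▸ hc)
      exact hcb (hpath r c a b hc hca hab hra' hrb hcb' h1 h2)

end Forests

/-! ### Interchanging the two variables on a colour class. -/

section Swap

variable {V K : Type*} [Field K]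

/-- The ideal generated by the binomials `gBar` of the related pairs. -/
noncomputable def gIdeal (K : Type*) [Field K] (E : V → V → Prop) : Ideal (EdgeRing V K) :=
  Ideal.span {f | ∃ u v : V, E u v ∧ f = gBar K u v}

lemma gBar_swap (u v : V) : gBar K u v = gBar K v u := by
  rw [gBar, gBar]; ring

lemma gBar_mem_gIdeal {E : V → V → Prop} {u v : V} (h : E u v) : gBar K u v ∈ gIdeal K E :=
  Ideal.subset_span ⟨u, v, h, rfl⟩

lemma gIdeal_le {E : V → V → Prop} {J : Ideal (EdgeRing V K)} (h : ∀ u v, E u v → gBar K u v ∈ J) :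
    gIdeal K E ≤ J := by
  rw [gIdeal, Ideal.span_le]
  rintro f ⟨u, v, huv, rfl⟩
  exact h u v huv

/-- The permutation of the variables that interchanges `x_v` and `y_v` if `c v` holds. -/
def swapPerm (c : V → Bool) : Equiv.Perm (V ⊕ V) :=
  Function.Involutive.toPerm
    (Sum.elim (fun v => if c v then Sum.inr v else Sum.inl v)
      (fun v => if c v then Sum.inl v else Sum.inr v))
    (by rintro (v | v) <;> by_cases h : c v <;> simp [h])

variable (c : V → Bool)

lemma swapPerm_symm : (swapPerm c).symm = swapPerm c := rfl

lemma rename_swapPerm_rename (p : EdgeRing V K) :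
    rename (swapPerm c) (rename (swapPerm c) p) = p := by
  rw [rename_rename]
  conv_lhs => rw [← swapPerm_symm c]
  rw [show (swapPerm c).symm ∘ ((swapPerm c).symm) = id from ?_, rename_id_apply]
  funext s
  exact (swapPerm c).apply_symm_apply s

lemma rename_swapPerm_X_inl (v : V) : rename (swapPerm c) (X (Sum.inl v) : EdgeRing V K) =
    if c v then X (Sum.inr v) else X (Sum.inl v) := by
  rw [rename_X, show swapPerm c (Sum.inl v) = if c v then Sum.inr v else Sum.inl v from rfl,
    apply_ite X]

lemma rename_swapPerm_X_inr (v : V) : rename (swapPerm c) (X (Sum.inr v) : EdgeRing V K) =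
    if c v then X (Sum.inl v) else X (Sum.inr v) := by
  rw [rename_X, show swapPerm c (Sum.inr v) = if c v then Sum.inl v else Sum.inr v from rfl,
    apply_ite X]

variable {c}

lemma rename_swapPerm_gBar_of_ne {u v : V} (h : c u ≠ c v) :
    rename (swapPerm c) (gBar K u v) = fBin K u v ∨
      rename (swapPerm c) (gBar K u v) = -fBin K u v := by
  simp only [gBar, fBin, map_sub, map_mul, rename_swapPerm_X_inl, rename_swapPerm_X_inr]
  cases hu : c u <;> cases hv : c v <;> simp [hu, hv] at h ⊢

lemma rename_swapPerm_gBar_of_eq {u v : V} (h : c u = c v) :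
    rename (swapPerm c) (gBar K u v) = gBar K u v ∨
      rename (swapPerm c) (gBar K u v) = -gBar K u v := by
  simp only [gBar, map_sub, map_mul, rename_swapPerm_X_inl, rename_swapPerm_X_inr]
  cases hu : c u <;> cases hv : c v <;> simp [hu, hv] at h ⊢

lemma rename_swapPerm_fBin_of_ne {u v : V} (h : c u ≠ c v) :
    rename (swapPerm c) (fBin K u v) = gBar K u v ∨
      rename (swapPerm c) (fBin K u v) = -gBar K u v := by
  rcases rename_swapPerm_gBar_of_ne (K := K) h with h' | h'
  · left; rw [← h', rename_swapPerm_rename]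
  · right; rw [eq_neg_iff_add_eq_zero, ← neg_eq_iff_add_eq_zero, ← map_neg, ← h',
      rename_swapPerm_rename]

lemma mem_of_eq_or_eq_neg {R : Type*} [CommRing R] {J : Ideal R} {p q : R}
    (h : p = q ∨ p = -q) (hq : q ∈ J) : p ∈ J := by
  rcases h with rfl | rfl
  · exact hq
  · exact J.neg_mem hq

/-- For a properly coloured graph the swap turns the binomials `gBar` into the binomials `fBin`. -/
theorem mem_gIdeal_iff {E : V → V → Prop} (hE : ∀ a b, E a b → c a ≠ c b) (F : EdgeRing V K) :
    F ∈ gIdeal K E ↔ rename (swapPerm c) F ∈ bIdeal K ∅ (fun a b => a = b ∨ E a b) := by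
  constructor
  · intro hF
    have : gIdeal K E ≤ (bIdeal K ∅ (fun a b => a = b ∨ E a b)).comap
        (rename (swapPerm c) : EdgeRing V K →ₐ[K] EdgeRing V K) :=
      gIdeal_le fun u v huv => Ideal.mem_comap.mpr <| mem_of_eq_or_eq_neg (rename_swapPerm_gBar_of_ne (hE u v huv))
        (fBin_mem_bIdeal (Or.inr huv))
    exact this hF
  · intro hF
    have : bIdeal K ∅ (fun a b => a = b ∨ E a b) ≤ (gIdeal K E).comap
        (rename (swapPerm c) : EdgeRing V K →ₐ[K] EdgeRing V K) := by
      refine bIdeal_le (by simp) (by simp) ?_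
      rintro a b (rfl | hab)
      · rw [fBin_self]; exact zero_mem _
      · refine Ideal.mem_comap.mpr <| mem_of_eq_or_eq_neg (rename_swapPerm_fBin_of_ne (hE a b hab)) (gBar_mem_gIdeal hab)
    have h := this hF
    rwa [Ideal.mem_comap, rename_swapPerm_rename] at h

section Regular

variable [Fintype V] {E : V → V → Prop} {u v : V}

/-- Adding a pendant edge at a simplicial vertex adds a nonzerodivisor. -/
theorem mem_gIdeal_of_pendant (hE : ∀ a b, E a b → c a ≠ c b) (hs : ∀ a b, E a b → E b a)
    (huv : c u ≠ c v) (hu : ∀ a, ¬ E u a) (hv : ∀ a b, E v a → E v b → a = b) {F : EdgeRing V K}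
    (hF : gBar K u v * F ∈ gIdeal K E) : F ∈ gIdeal K E := by
  rw [mem_gIdeal_iff hE] at hF ⊢
  rw [map_mul] at hF
  refine mem_bIdeal_of_fBin_mul_mem (u := u) (v := v) (fun a => Or.inl rfl)
    (fun a b h => h.imp Eq.symm (hs a b)) (by simp) (by simp) (fun h => huv (h ▸ rfl))
    (fun a ha _ => ha.elim Eq.symm fun h => absurd h (hu a)) ?_ ?_
  · rintro a b - - (rfl | ha) (rfl | hb)
    · exact Or.inl rfl
    · exact Or.inr hb
    · exact Or.inr (hs _ _ ha)
    · exact Or.inl (hv a b ha hb)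
  · rcases rename_swapPerm_gBar_of_ne (K := K) huv with h | h <;> rw [h] at hF
    · exact hF
    · rwa [neg_mul, neg_mem_iff] at hF

/-- Adding an edge between simplicial vertices of the same colour adds a nonzerodivisor. -/
theorem mem_gIdeal_of_same_colour (hE : ∀ a b, E a b → c a ≠ c b) (hs : ∀ a b, E a b → E b a)
    (huv : c u = c v) (hu : ∀ a b, E u a → E u b → a = b) (hv : ∀ a b, E v a → E v b → a = b)
    {F : EdgeRing V K} (hF : gBar K u v * F ∈ gIdeal K E) : F ∈ gIdeal K E := by
  rw [mem_gIdeal_iff hE] at hF ⊢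
  rw [map_mul] at hF
  have hsimp : ∀ w, (∀ a b, E w a → E w b → a = b) →
      IsSimplicial ∅ (fun a b => a = b ∨ E a b) w := by
    rintro w hw a b - - (rfl | ha) (rfl | hb)
    · exact Or.inl rfl
    · exact Or.inr hb
    · exact Or.inr (hs _ _ ha)
    · exact Or.inl (hw a b ha hb)
  refine mem_bIdeal_of_gBar_mul_mem (u := u) (v := v) (fun a => Or.inl rfl)
    (fun a b h => h.imp Eq.symm (hs a b)) (by simp) (by simp) (hsimp u hu) (hsimp v hv) ?_
  rcases rename_swapPerm_gBar_of_eq (K := K) huv with h | h <;> rw [h] at hF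
  · exact hF
  · rwa [neg_mul, neg_mem_iff] at hF

end Regular

/-- The parity binomial edge ideal of an odd unicyclic graph is built by quadrics. -/
theorem IsOddUnicyclic.quadTower [Fintype V] {G : SimpleGraph V} (h : IsOddUnicyclic G) :
    QuadTower (parityIdeal K G) := by
  obtain ⟨u, v, c, huv, hG, hc, hcol⟩ := h.exists_edge
  obtain ⟨_, T, hP, hT, hmeet⟩ := exists_rootedSubtree_of_isAcyclic hG
  have hnot : ¬ meetRel Finset.univ T u v := by
    rw [hmeet]
    rintro (h | h)
    · exact huv.ne h
    · simp at h
  have hbI : bIdeal K ∅ (meetRel Finset.univ T) =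
      bIdeal K ∅ (fun a b => a = b ∨ (G.deleteEdges {s(u, v)}).Adj a b) := bIdeal_congr hmeet
  have hq := quadTower_bIdeal_sup_gBar (K := K) hP hT hnot
  rw [hbI] at hq
  have hq' := hq.rename (swapPerm c)
  rw [swapPerm_symm] at hq'
  convert hq' using 1
  apply le_antisymm
  · refine gIdeal_le (E := G.Adj) fun a b hab => ?_
    rw [Ideal.mem_comap]
    by_cases he : s(a, b) = s(u, v)
    · have : gBar K a b = gBar K u v := by
        rcases Sym2.eq_iff.mp he with ⟨rfl, rfl⟩ | ⟨rfl, rfl⟩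
        · rfl
        · exact gBar_swap _ _
      rw [this]
      exact mem_of_eq_or_eq_neg (rename_swapPerm_gBar_of_eq hc)
        (Ideal.mem_sup_right (Ideal.mem_span_singleton_self _))
    · have hab' : (G.deleteEdges {s(u, v)}).Adj a b := by simp [hab, he]
      exact mem_of_eq_or_eq_neg (rename_swapPerm_gBar_of_ne (hcol a b hab'))
        (Ideal.mem_sup_left (fBin_mem_bIdeal (Or.inr hab')))
  · intro p hp
    rw [Ideal.mem_comap] at hp
    have hle : bIdeal K ∅ (fun a b => a = b ∨ (G.deleteEdges {s(u, v)}).Adj a b) ⊔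
        Ideal.span {gBar K u v} ≤ (parityIdeal K G).comap
          (rename (swapPerm c) : EdgeRing V K →ₐ[K] EdgeRing V K) := by
      refine sup_le (bIdeal_le (by simp) (by simp) ?_) ?_
      · rintro a b (rfl | hab)
        · rw [fBin_self]; exact zero_mem _
        · refine Ideal.mem_comap.mpr <| mem_of_eq_or_eq_neg (rename_swapPerm_fBin_of_ne (hcol a b hab))
            (gBar_mem_gIdeal (E := G.Adj) (SimpleGraph.deleteEdges_le _ hab))
      · rw [Ideal.span_singleton_le_iff_mem]
        refine Ideal.mem_comap.mpr <| mem_of_eq_or_eq_neg (rename_swapPerm_gBar_of_eq hc)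
          (gBar_mem_gIdeal (E := G.Adj) huv)
    have h := hle hp
    rwa [Ideal.mem_comap, rename_swapPerm_rename] at h

end Swap

/-! ### The Koszul resolution of three quadrics. -/

section Koszul

variable {σ K : Type*} [Field K]

/-- The ranks in the Koszul complex on three elements. -/
def koszulRank : ℕ → ℕ
  | 0 => 1
  | 1 => 3
  | 2 => 3
  | 3 => 1
  | _ + 4 => 0

/-- The differentials of the Koszul complex on three elements. -/
noncomputable def koszulD (f : Fin 3 → MvPolynomial σ K) :
    ∀ i, Fin (koszulRank (i + 1)) → Fin (koszulRank i) → MvPolynomial σ K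
  | 0 => fun b _ => f b
  | 1 => ![![-f 1, f 0, 0], ![-f 2, 0, f 0], ![0, -f 2, f 1]]
  | 2 => fun _ => ![f 2, -f 1, f 0]
  | _ + 3 => fun b => Fin.elim0 b

/-- Entries of the differentials are zero or a generator up to sign. Homogeneity, minimality and
invariance under the retraction are all checked through this principle. -/
lemma koszulD_induction (f : Fin 3 → MvPolynomial σ K) {p : MvPolynomial σ K → Prop} (h0 : p 0)
    (h : ∀ b, p (f b)) (hneg : ∀ b, p (-f b)) : ∀ i b a, p (koszulD f i b a)
  | 0, b, _ => h b
  | 1, b, a => by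
    change Fin 3 at b a
    fin_cases b <;> fin_cases a <;> first | exact h0 | exact h _ | exact hneg _
  | 2, b, a => by
    change Fin 3 at a
    fin_cases a <;> first | exact h _ | exact hneg _
  | _ + 3, b, _ => Fin.elim0 b

lemma degSupp_koszulD {f : Fin 3 → MvPolynomial σ K} (hf : ∀ b, (f b).IsHomogeneous 2) (i : ℕ)
    (b : Fin (koszulRank (i + 1))) :
    DegSupp (fun _ : Fin (koszulRank i) => 2 * i) {2 * (i + 1)} (koszulD f i b) := by
  intro a m hm
  have h : (koszulD f i b a).IsHomogeneous 2 := koszulD_induction f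
    (p := fun q => q.IsHomogeneous 2) (isHomogeneous_zero _ _ _) hf (fun b => (hf b).neg) i b a
  have := isHomogeneous_iff_degSupp.mp h m hm
  rw [this, Set.mem_singleton_iff]
  ring

lemma linearCombination_one (I : Ideal (MvPolynomial σ K)) (x : Fin 1 → MvPolynomial σ K) :
    Fintype.linearCombination (MvPolynomial σ K) (fun _ : Fin 1 => (1 : MvPolynomial σ K ⧸ I)) x =
      Ideal.Quotient.mk I (x 0) := by
  rw [Fintype.linearCombination_apply, Fin.sum_univ_one]
  change Ideal.Quotient.mk I (x 0 * 1) = _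
  rw [mul_one]

/-- The Koszul resolution of three quadrics that form a regular sequence. -/
noncomputable def koszulRes (f : Fin 3 → MvPolynomial σ K) (hf : ∀ b, (f b).IsHomogeneous 2)
    (h0 : ∀ F, f 0 * F = 0 → F = 0)
    (h1 : ∀ F, f 1 * F ∈ Ideal.span {f 0} → F ∈ Ideal.span {f 0})
    (h2 : ∀ F, f 2 * F ∈ Ideal.span {f 0, f 1} → F ∈ Ideal.span {f 0, f 1}) :
    GradedRes (Ideal.span {f 0, f 1, f 2}) where
  ι i := Fin (koszulRank i)
  fintype _ := inferInstance
  deg i _ := 2 * i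
  d := koszulD f
  aug _ := 1
  aug_mem _ := mk_mem_quotientGrading (isHomogeneous_one _ _)
  d_homog := degSupp_koszulD hf
  aug_surjective y := by
    obtain ⟨p, rfl⟩ := Ideal.Quotient.mk_surjective y
    refine ⟨fun _ => p, ?_⟩
    exact linearCombination_one _ (fun _ => p)
  aug_d b := by
    refine (linearCombination_one _ (fun _ => f b)).trans
      (Ideal.Quotient.eq_zero_iff_mem.mpr (Ideal.subset_span ?_))
    change Fin 3 at b
    fin_cases b <;> simp
  exact_zero x hx := by
    change Fin 1 → MvPolynomial σ K at x
    obtain ⟨a, b, c, habc⟩ := Submodule.mem_span_triple.mp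
      (Ideal.Quotient.eq_zero_iff_mem.mp ((linearCombination_one _ x).symm.trans hx))
    refine ⟨![a, b, c], ?_⟩
    change Fintype.linearCombination (MvPolynomial σ K) (fun (b : Fin 3) (_ : Fin 1) => f b)
      ![a, b, c] = x
    funext t
    rw [Subsingleton.elim t 0, Fintype.linearCombination_apply, Fin.sum_univ_three, ← habc]
    rfl
  d_d i b := by
    match i, b with
    | 0, b =>
      change Fin 3 at b
      change Fintype.linearCombination (MvPolynomial σ K) (fun (b : Fin 3) (_ : Fin 1) => f b)
        (![![-f 1, f 0, 0], ![-f 2, 0, f 0], ![0, -f 2, f 1]] b) = 0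
      funext t
      rw [Fintype.linearCombination_apply, Fin.sum_univ_three]
      fin_cases b <;> simp <;> ring
    | 1, b =>
      change Fintype.linearCombination (MvPolynomial σ K)
        ![![-f 1, f 0, 0], ![-f 2, 0, f 0], ![0, -f 2, f 1]] ![f 2, -f 1, f 0] = 0
      funext t
      rw [Fintype.linearCombination_apply, Fin.sum_univ_three]
      change Fin 3 at t
      fin_cases t <;> simp <;> ring
    | _ + 2, b => exact Fin.elim0 b
  exact_succ i x hx := by
    match i, x, hx with
    | 0, x, hx =>
      change Fin 3 → MvPolynomial σ K at x
      change Fintype.linearCombination (MvPolynomial σ K) (fun (b : Fin 3) (_ : Fin 1) => f b) x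
        = 0 at hx
      have hx' := congrFun hx 0
      rw [Fintype.linearCombination_apply, Fin.sum_univ_three] at hx'
      simp only [Pi.add_apply, Pi.smul_apply, smul_eq_mul, Pi.zero_apply] at hx'
      -- Regularity is peeled off from the last generator: `h2` puts `x 2` in the span of `f 0` and
      -- `f 1`, then `h1` determines `x 1` modulo `f 0`, and `h0` fixes `x 0`.
      obtain ⟨a, b, hab⟩ := Ideal.mem_span_pair.mp (h2 (x 2)
        (Ideal.mem_span_pair.mpr ⟨-x 0, -x 1, by linear_combination -hx'⟩))
      obtain ⟨c, hc⟩ := Ideal.mem_span_singleton'.mp (h1 (x 1 + b * f 2)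
        (Ideal.mem_span_singleton'.mpr ⟨-(x 0 + a * f 2), by
          linear_combination -hx' - f 2 * hab⟩))
      have h3 := h0 (x 0 + a * f 2 + c * f 1) (by
        linear_combination hx' + f 2 * hab + f 1 * hc)
      refine ⟨![c, a, b], ?_⟩
      change Fintype.linearCombination (MvPolynomial σ K)
        ![![-f 1, f 0, 0], ![-f 2, 0, f 0], ![0, -f 2, f 1]] ![c, a, b] = x
      funext t
      rw [Fintype.linearCombination_apply, Fin.sum_univ_three]
      fin_cases t <;> simp
      · linear_combination -h3
      · linear_combination hc
      · linear_combination hab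
    | 1, x, hx =>
      change Fin 3 → MvPolynomial σ K at x
      change Fintype.linearCombination (MvPolynomial σ K)
        ![![-f 1, f 0, 0], ![-f 2, 0, f 0], ![0, -f 2, f 1]] x = 0 at hx
      have e1 := congrFun hx (1 : Fin 3)
      have e2 := congrFun hx (2 : Fin 3)
      rw [Fintype.linearCombination_apply, Fin.sum_univ_three] at e1 e2
      simp at e1 e2
      obtain ⟨t, ht⟩ := Ideal.mem_span_singleton'.mp (h1 (x 2)
        (Ideal.mem_span_singleton'.mpr ⟨-x 1, by linear_combination -e2⟩))
      have e4 := h0 (x 1 + t * f 1) (by linear_combination e2 + f 1 * ht)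
      have e5 := h0 (x 0 - t * f 2) (by linear_combination e1 - f 2 * ht)
      refine ⟨fun _ => t, ?_⟩
      change Fintype.linearCombination (MvPolynomial σ K)
        (fun _ : Fin 1 => ![f 2, -f 1, f 0]) (fun _ : Fin 1 => t) = x
      funext s
      rw [Fintype.linearCombination_apply, Fin.sum_univ_one]
      fin_cases s <;> simp
      · linear_combination -e5
      · linear_combination -e4
      · linear_combination ht
    | 2, x, hx =>
      change Fin 1 → MvPolynomial σ K at x
      change Fintype.linearCombination (MvPolynomial σ K)
        (fun _ : Fin 1 => ![f 2, -f 1, f 0]) x = 0 at hx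
      have e := congrFun hx (2 : Fin 3)
      rw [Fintype.linearCombination_apply, Fin.sum_univ_one] at e
      simp at e
      refine ⟨Fin.elim0, ?_⟩
      funext s
      change Fin 1 at s
      rw [Subsingleton.elim s 0, h0 (x 0) (by rw [mul_comm]; simpa using e)]
      rfl
    | _ + 3, x, hx => exact ⟨Fin.elim0, funext fun s => Fin.elim0 s⟩

end Koszul

section Koszul

variable {σ K : Type*} [Field K] {f : Fin 3 → MvPolynomial σ K} {hf : ∀ b, (f b).IsHomogeneous 2}
  {h0 : ∀ F, f 0 * F = 0 → F = 0}
  {h1 : ∀ F, f 1 * F ∈ Ideal.span {f 0} → F ∈ Ideal.span {f 0}}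
  {h2 : ∀ F, f 2 * F ∈ Ideal.span {f 0, f 1} → F ∈ Ideal.span {f 0, f 1}}

lemma koszulRes_isMinimal : (koszulRes f hf h0 h1 h2).IsMinimal := by
  have hc : ∀ b, constantCoeff (f b) = 0 := fun b => by
    rw [constantCoeff_eq]
    exact (hf b).coeff_eq_zero (by simp)
  exact koszulD_induction f (p := fun q => constantCoeff q = 0) (map_zero _) hc
    (fun b => by rw [map_neg, hc b, neg_zero])

lemma koszulRes_augSurjective : (koszulRes f hf h0 h1 h2).AugSurjective := by
  intro j m hm
  obtain ⟨p, hp, rfl⟩ := exists_of_mem_quotientGrading hm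
  refine ⟨fun _ => p, fun a m hm => ?_, linearCombination_one _ (fun _ => p)⟩
  have := isHomogeneous_iff_degSupp.mp hp m hm
  simpa [koszulRes] using this

lemma koszulRes_betti_pos : 0 < (koszulRes f hf h0 h1 h2).betti 3 6 := by
  have : Nonempty {a : Fin 1 // 2 * 3 = 6} := ⟨⟨0, rfl⟩⟩
  exact Nat.card_pos (α := {a : Fin 1 // 2 * 3 = 6})

end Koszul

/-! ### Restriction to induced subgraphs and the Betti number of non-bipartite graphs. -/

section InducedSubgraph

variable {V K : Type*} [Field K]

open Classical in
/-- The endomorphism that kills the variables at the vertices outside `W`. -/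
noncomputable def restrictVertices (K : Type*) [Field K] (W : Set V) :
    EdgeRing V K →ₐ[K] EdgeRing V K :=
  aeval fun s => if Sum.elim id id s ∈ W then X s else 0

variable {W : Set V}

lemma constantCoeff_restrictVertices (p : EdgeRing V K) :
    constantCoeff (restrictVertices K W p) = constantCoeff p := by
  have : (constantCoeff : EdgeRing V K →+* K).comp (restrictVertices K W).toRingHom =
      constantCoeff := by
    refine ringHom_ext (fun r => ?_) fun s => ?_
    · simp [restrictVertices]
    · simp only [restrictVertices, AlgHom.toRingHom_eq_coe, RingHom.comp_apply, RingHom.coe_coe,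
        aeval_X]
      split_ifs <;> simp
  exact DFunLike.congr_fun this p

open Classical in
lemma restrictVertices_isHomogeneous {p : EdgeRing V K} {k : ℕ} (hp : p.IsHomogeneous k) :
    (restrictVertices K W p).IsHomogeneous k := by
  have h := hp.aeval (fun s => if Sum.elim id id s ∈ W then (X s : EdgeRing V K) else 0)
    (n := 1) (fun s => by
      split_ifs
      · exact isHomogeneous_X _ _
      · exact isHomogeneous_zero _ _ _)
  rwa [one_mul] at h

lemma restrictVertices_gBar {u v : V} (hu : u ∈ W) (hv : v ∈ W) :
    restrictVertices K W (gBar K u v) = gBar K u v := by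
  simp [restrictVertices, gBar, hu, hv]

lemma restrictVertices_gBar_eq_zero {u v : V} (h : ¬ (u ∈ W ∧ v ∈ W)) :
    restrictVertices K W (gBar K u v) = 0 := by
  by_cases hu : u ∈ W <;> by_cases hv : v ∈ W <;> simp_all [restrictVertices, gBar]

/-- Three edges that span an induced subgraph and give a regular sequence contribute to the third
step of the resolution. -/
theorem quotientBetti_three_six_ne_zero {G : SimpleGraph V}
    (hex : Nonempty (MinimalGradedFreeResolution (σ := V ⊕ V)
      (quotientGrading (parityIdeal K G))))
    (f : Fin 3 → EdgeRing V K)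
    (hf : ∀ i, ∃ u v, u ∈ W ∧ v ∈ W ∧ G.Adj u v ∧ f i = gBar K u v)
    (h0 : ∀ F, f 0 * F = 0 → F = 0)
    (h1 : ∀ F, f 1 * F ∈ Ideal.span {f 0} → F ∈ Ideal.span {f 0})
    (h2 : ∀ F, f 2 * F ∈ Ideal.span {f 0, f 1} → F ∈ Ideal.span {f 0, f 1})
    (hW : ∀ u v, u ∈ W → v ∈ W → G.Adj u v → ∃ i, gBar K u v = f i) :
    quotientBetti (parityIdeal K G) 3 6 ≠ 0 := by
  have hhom : ∀ i, (f i).IsHomogeneous 2 := fun i => by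
    obtain ⟨u, v, -, -, -, h⟩ := hf i
    rw [h]
    exact gBar_isHomogeneous u v
  have hfix : ∀ i, restrictVertices K W (f i) = f i := fun i => by
    obtain ⟨u, v, hu, hv, -, h⟩ := hf i
    rw [h]
    exact restrictVertices_gBar hu hv
  have hmem : ∀ i, f i ∈ Ideal.span {f 0, f 1, f 2} := fun i =>
    Ideal.subset_span (by fin_cases i <;> simp)
  -- Setting the variables outside `W` to zero fixes the three binomials and kills every edge that
  -- leaves `W`, hence is a retraction onto the quotient resolved by the Koszul complex.
  have key := le_quotientBetti (ρ := (restrictVertices K W).toRingHom)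
    (P := koszulRes f hhom h0 h1 h2) hex koszulRes_isMinimal koszulRes_augSurjective
    constantCoeff_restrictVertices (fun p k hp => restrictVertices_isHomogeneous hp)
    (koszulD_induction f (p := fun q => restrictVertices K W q = q) (map_zero _) hfix
      (fun b => by rw [map_neg, hfix])) ?_ ?_ (fun a => ⟨1, map_one _, rfl⟩) 3 6
  · exact Nat.pos_iff_ne_zero.mp (koszulRes_betti_pos.trans_le key)
  · rw [Ideal.span_le]
    have : ∀ i, f i ∈ parityIdeal K G := fun i => by
      obtain ⟨u, v, -, -, huv, h⟩ := hf i
      rw [h]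
      exact gBar_mem_gIdeal (E := G.Adj) huv
    rintro p (rfl | rfl | rfl) <;> exact this _
  · have : parityIdeal K G ≤ (Ideal.span {f 0, f 1, f 2}).comap (restrictVertices K W) := by
      refine gIdeal_le (E := G.Adj) fun u v huv => ?_
      rw [Ideal.mem_comap]
      by_cases h : u ∈ W ∧ v ∈ W
      · rw [restrictVertices_gBar h.1 h.2]
        obtain ⟨i, hi⟩ := hW u v h.1 h.2 huv
        rw [hi]
        exact hmem i
      · rw [restrictVertices_gBar_eq_zero h]
        exact zero_mem _
    exact fun x hx => this hx

lemma gBar_ne_zero (u v : V) : gBar K u v ≠ 0 := by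
  intro h
  have := congrArg (aeval (Sum.elim (fun _ => (1 : K)) (fun _ => 0))) h
  simp [gBar] at this

lemma gIdeal_pair (a b : V) :
    gIdeal K (fun x y => s(x, y) = s(a, b)) = Ideal.span {gBar K a b} := by
  apply le_antisymm
  · refine gIdeal_le fun u v h => Ideal.subset_span ?_
    rcases Sym2.eq_iff.mp h with ⟨rfl, rfl⟩ | ⟨rfl, rfl⟩
    · rfl
    · exact gBar_swap _ _
  · rw [Ideal.span_singleton_le_iff_mem]
    exact gBar_mem_gIdeal rfl

lemma gIdeal_pair_pair (a b c d : V) :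
    gIdeal K (fun x y => s(x, y) = s(a, b) ∨ s(x, y) = s(c, d)) =
      Ideal.span {gBar K a b, gBar K c d} := by
  apply le_antisymm
  · refine gIdeal_le fun u v h => Ideal.subset_span ?_
    rcases h with h | h <;> rcases Sym2.eq_iff.mp h with ⟨rfl, rfl⟩ | ⟨rfl, rfl⟩
    · exact Or.inl rfl
    · exact Or.inl (gBar_swap _ _)
    · exact Or.inr rfl
    · exact Or.inr (gBar_swap _ _)
  · rw [Ideal.span_le]
    rintro p (rfl | rfl)
    · exact gBar_mem_gIdeal (Or.inl rfl)
    · exact gBar_mem_gIdeal (Or.inr rfl)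

variable [Fintype V] {a b c d : V}

/-- With `b` alone in its colour class, `bc` is a pendant edge attached at the leaf `b` of the edge
`ab`. -/
lemma mem_span_gBar_of_mul_mem (hab : a ≠ b) (hbc : b ≠ c) (hac : a ≠ c) {F : EdgeRing V K}
    (hF : gBar K b c * F ∈ Ideal.span {gBar K a b}) : F ∈ Ideal.span {gBar K a b} := by
  classical
  rw [← gIdeal_pair] at hF ⊢
  rw [gBar_swap] at hF
  refine mem_gIdeal_of_pendant (c := fun v => decide (v = b)) (u := c) (v := b) ?_ ?_ ?_ ?_ ?_ hF
  all_goals try simp only [Sym2.eq_iff]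
  all_goals grind

/-- The vertices `a` and `c` are leaves of the path `a`, `b`, `c` and have the same colour. -/
lemma mem_span_gBar_gBar_of_triangle (hab : a ≠ b) (hbc : b ≠ c) (hac : a ≠ c)
    {F : EdgeRing V K} (hF : gBar K a c * F ∈ Ideal.span {gBar K a b, gBar K b c}) :
    F ∈ Ideal.span {gBar K a b, gBar K b c} := by
  classical
  rw [← gIdeal_pair_pair] at hF ⊢
  refine mem_gIdeal_of_same_colour (c := fun v => decide (v = b)) (u := a) (v := c) ?_ ?_ ?_ ?_ ?_
    hF
  all_goals try simp only [Sym2.eq_iff]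
  all_goals grind

/-- The edge `cd` is pendant at the leaf `c` of the path `a`, `b`, `c`. -/
lemma mem_span_gBar_gBar_of_path (hab : a ≠ b) (hbc : b ≠ c) (hac : a ≠ c) (had : a ≠ d)
    (hbd : b ≠ d) (hcd : c ≠ d)
    {F : EdgeRing V K} (hF : gBar K c d * F ∈ Ideal.span {gBar K a b, gBar K b c}) :
    F ∈ Ideal.span {gBar K a b, gBar K b c} := by
  classical
  rw [← gIdeal_pair_pair] at hF ⊢
  rw [gBar_swap] at hF
  refine mem_gIdeal_of_pendant (c := fun v => decide (v = b ∨ v = d)) (u := d) (v := c)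
    ?_ ?_ ?_ ?_ ?_ hF
  all_goals try simp only [Sym2.eq_iff]
  all_goals grind

/-- The third step of the resolution of a non-bipartite graph has a generator of degree six. -/
theorem quotientBetti_three_six_ne_zero_of_not_isBipartite {G : SimpleGraph V}
    (hex : Nonempty (MinimalGradedFreeResolution (σ := V ⊕ V)
      (quotientGrading (parityIdeal K G)))) (hG : ¬ G.IsBipartite) :
    quotientBetti (parityIdeal K G) 3 6 ≠ 0 := by
  rcases exists_triangle_or_path_of_not_isBipartite hG with
    ⟨a, b, c, hab, hbc, hac⟩ | ⟨a, b, c, d, hab, hbc, hcd, nac, nad, nbd, hac, had, hbd⟩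
  · refine quotientBetti_three_six_ne_zero (W := {a, b, c}) hex
      ![gBar K a b, gBar K b c, gBar K a c] ?_
      (fun F h => (mul_eq_zero.mp h).resolve_left (gBar_ne_zero a b))
      (fun F h => mem_span_gBar_of_mul_mem hab.ne hbc.ne hac.ne h)
      (fun F h => mem_span_gBar_gBar_of_triangle hab.ne hbc.ne hac.ne h) ?_
    · intro i
      fin_cases i
      · exact ⟨a, b, by simp, by simp, hab, rfl⟩
      · exact ⟨b, c, by simp, by simp, hbc, rfl⟩
      · exact ⟨a, c, by simp, by simp, hac, rfl⟩
    · rintro u v (rfl | rfl | rfl) (rfl | rfl | rfl) huv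
      · exact absurd rfl huv.ne
      · exact ⟨0, rfl⟩
      · exact ⟨2, rfl⟩
      · exact ⟨0, gBar_swap _ _⟩
      · exact absurd rfl huv.ne
      · exact ⟨1, rfl⟩
      · exact ⟨2, gBar_swap _ _⟩
      · exact ⟨1, gBar_swap _ _⟩
      · exact absurd rfl huv.ne
  · refine quotientBetti_three_six_ne_zero (W := {a, b, c, d}) hex
      ![gBar K a b, gBar K b c, gBar K c d] ?_
      (fun F h => (mul_eq_zero.mp h).resolve_left (gBar_ne_zero a b))
      (fun F h => mem_span_gBar_of_mul_mem hab.ne hbc.ne nac h)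
      (fun F h => mem_span_gBar_gBar_of_path hab.ne hbc.ne nac nad nbd hcd.ne h) ?_
    · intro i
      fin_cases i
      · exact ⟨a, b, by simp, by simp, hab, rfl⟩
      · exact ⟨b, c, by simp, by simp, hbc, rfl⟩
      · exact ⟨c, d, by simp, by simp, hcd, rfl⟩
    · rintro u v (rfl | rfl | rfl | rfl) (rfl | rfl | rfl | rfl) huv
      · exact absurd rfl huv.ne
      · exact ⟨0, rfl⟩
      · exact absurd huv hac
      · exact absurd huv had
      · exact ⟨0, gBar_swap _ _⟩
      · exact absurd rfl huv.ne
      · exact ⟨1, rfl⟩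
      · exact absurd huv hbd
      · exact absurd huv.symm hac
      · exact ⟨1, gBar_swap _ _⟩
      · exact absurd rfl huv.ne
      · exact ⟨2, rfl⟩
      · exact absurd huv.symm had
      · exact absurd huv.symm hbd
      · exact ⟨2, gBar_swap _ _⟩
      · exact absurd rfl huv.ne

end InducedSubgraph

/-! ### Coefficients that separate the multiples of different edge binomials. -/

section Coefficients

variable {V K : Type*} [Field K]

-- The chosen monomial contains at most one `t`-variable, so the product of two distinct ones does
-- not divide it, and a product of two distinct `z`-variables divides it only for the pair `u`, `v`.
-- Both roles of `x` and `y` are used, according to which variable `m` is.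
open Classical in
lemma coeff_mul_quadric {σ : Type*} {z t : V → σ} (hz : Function.Injective z)
    (hzt : ∀ a b, z a ≠ t b) (ht : Function.Injective t) {u v a b : V} (hab : a ≠ b)
    {m : σ →₀ ℕ} (hm : m = 0 ∨ ∃ w, m = Finsupp.single (t w) 1) (p : MvPolynomial σ K) :
    coeff (Finsupp.single (z u) 1 + Finsupp.single (z v) 1 + m)
      (p * (X (z a) * X (z b) - X (t a) * X (t b))) =
      if s(a, b) = s(u, v) then coeff m p else 0 := by
  have hX : ∀ c d : σ, (X c * X d : MvPolynomial σ K) =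
      monomial (Finsupp.single c 1 + Finsupp.single d 1) 1 := fun c d => by
    rw [X, X, monomial_mul, one_mul]
  have hmz : ∀ a, m (z a) = 0 := fun a => by
    rcases hm with rfl | ⟨w, rfl⟩
    · rfl
    · exact Finsupp.single_eq_of_ne (hzt a w)
  have hnot : ¬ Finsupp.single (t a) 1 + Finsupp.single (t b) 1 ≤
      Finsupp.single (z u) 1 + Finsupp.single (z v) 1 + m := by
    intro hle
    have h1 := hle (t a)
    have h2 := hle (t b)
    simp only [Finsupp.add_apply, Finsupp.single_apply, hzt, ht.eq_iff] at h1 h2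
    rcases hm with rfl | ⟨w, rfl⟩
    · simp at h1
    · simp only [Finsupp.single_apply, ht.eq_iff] at h1 h2
      grind
  rw [mul_sub, coeff_sub, hX, hX, coeff_mul_monomial', coeff_mul_monomial', mul_one, mul_one,
    if_neg hnot, sub_zero]
  by_cases h : s(a, b) = s(u, v)
  · have hsum : Finsupp.single (z a) 1 + Finsupp.single (z b) 1 =
        Finsupp.single (z u) 1 + Finsupp.single (z v) 1 := by
      rcases Sym2.eq_iff.mp h with ⟨rfl, rfl⟩ | ⟨rfl, rfl⟩
      · rfl
      · exact add_comm _ _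
    rw [if_pos h, hsum, if_pos le_self_add, add_tsub_cancel_left]
  · rw [if_neg h, if_neg]
    intro hle
    have h1 := hle (z a)
    have h2 := hle (z b)
    simp only [Finsupp.add_apply, Finsupp.single_apply, hz.eq_iff, hmz] at h1 h2
    apply h
    rw [Sym2.eq_iff]
    grind

/-- Multiples of the binomial of an edge determine the multiplier up to degree one, and the
multiples of other edges do not interfere. -/
lemma exists_coeff_mul_gBar {u v : V} (huv : u ≠ v) {m : V ⊕ V →₀ ℕ} (hm : m.degree ≤ 1) :
    ∃ M : V ⊕ V →₀ ℕ, (∀ p : EdgeRing V K, coeff M (p * gBar K u v) = 0 → coeff m p = 0) ∧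
      ∀ (p : EdgeRing V K) (a b : V), a ≠ b → s(a, b) ≠ s(u, v) →
        coeff M (p * gBar K a b) = 0 := by
  classical
  have hm' : (m = 0 ∨ ∃ w, m = Finsupp.single (Sum.inr w) 1) ∨
      ∃ w, m = Finsupp.single (Sum.inl w) 1 := by
    rcases Nat.le_one_iff_eq_zero_or_eq_one.mp hm with h | h
    · exact Or.inl (Or.inl ((Finsupp.degree_eq_zero_iff m).mp h))
    · obtain ⟨s, rfl⟩ := (Finsupp.sum_eq_one_iff m).mp h
      rcases s with w | w
      · exact Or.inr ⟨w, rfl⟩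
      · exact Or.inl (Or.inr ⟨w, rfl⟩)
  rcases hm' with h | h
  · have key := fun (p : EdgeRing V K) {a b : V} (hab : a ≠ b) =>
      coeff_mul_quadric (K := K) (z := Sum.inl) (t := Sum.inr) (u := u) (v := v)
      Sum.inl_injective (fun _ _ => Sum.inl_ne_inr) Sum.inr_injective hab h p
    refine ⟨Finsupp.single (Sum.inl u) 1 + Finsupp.single (Sum.inl v) 1 + m, fun p hp => ?_,
      fun p a b hab hne => ?_⟩
    · rw [gBar, key p huv, if_pos rfl] at hp
      exact hp
    · rw [gBar, key p hab, if_neg hne]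
  · have key := fun (p : EdgeRing V K) {a b : V} (hab : a ≠ b) =>
      coeff_mul_quadric (K := K) (z := Sum.inr) (t := Sum.inl) (u := u) (v := v)
      Sum.inr_injective (fun _ _ => Sum.inr_ne_inl) Sum.inl_injective hab (Or.inr h) p
    have hneg : ∀ (p : EdgeRing V K) (a b : V), p * gBar K a b =
        -(p * (X (Sum.inr a) * X (Sum.inr b) - X (Sum.inl a) * X (Sum.inl b))) := by
      intro p a b
      rw [gBar]; ring
    refine ⟨Finsupp.single (Sum.inr u) 1 + Finsupp.single (Sum.inr v) 1 + m, fun p hp => ?_,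
      fun p a b hab hne => ?_⟩
    · rw [hneg, coeff_neg, key p huv, if_pos rfl, neg_eq_zero] at hp
      exact hp
    · rw [hneg, coeff_neg, key p hab, if_neg hne, neg_zero]

/-- An element of the colon ideal by the binomial of a further edge has no terms of degree at most
one. -/
lemma coeff_eq_zero_of_mul_gBar_mem {E : V → V → Prop} {u v : V} (huv : u ≠ v)
    (hE : ∀ a b, E a b → a ≠ b ∧ s(a, b) ≠ s(u, v)) {p : EdgeRing V K}
    (hp : p * gBar K u v ∈ gIdeal K E) {m : V ⊕ V →₀ ℕ} (hm : m.degree ≤ 1) : coeff m p = 0 := by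
  obtain ⟨M, h1, h2⟩ := exists_coeff_mul_gBar (K := K) huv hm
  refine h1 p ?_
  -- The claim is strengthened to all multiples of `x`, since vanishing of a single coefficient is
  -- not preserved by scalars.
  suffices h : ∀ x ∈ gIdeal K E, ∀ q, coeff M (q * x) = 0 by
    have := h _ hp 1
    rwa [one_mul] at this
  intro x hx
  induction hx using Submodule.span_induction with
  | mem x hx =>
    obtain ⟨a, b, hab, rfl⟩ := hx
    exact fun q => h2 q a b (hE a b hab).1 (hE a b hab).2
  | zero => intro q; rw [mul_zero, coeff_zero]
  | add x y _ _ hx hy => intro q; rw [mul_add, coeff_add, hx, hy, add_zero]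
  | smul a x _ hx => intro q; rw [smul_eq_mul, ← mul_assoc, hx]

lemma homogeneousComponent_mem_gIdeal {E : V → V → Prop} {p : EdgeRing V K} (hp : p ∈ gIdeal K E)
    (j : ℕ) : homogeneousComponent j p ∈ gIdeal K E := by
  let _ := gradedAlgebra (σ := V ⊕ V) (R := K)
  refine homogeneousComponent_mem_of_mem (Ideal.homogeneous_span _ _ ?_) hp j
  rintro f ⟨u, v, -, rfl⟩
  exact ⟨2, gBar_isHomogeneous u v⟩

end Coefficients

/-! ### Growth of degrees in minimal resolutions. -/

section Growth

variable {σ K : Type*} [Field K]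

/-- In a minimal resolution the degrees of the generators increase strictly. -/
lemma MinimalGradedFreeResolution.exists_deg_lt {M : Type*} [AddCommGroup M] [Module K M]
    [Module (MvPolynomial σ K) M] {𝓜 : ℕ → Submodule K M}
    (F : MinimalGradedFreeResolution (σ := σ) 𝓜) (i : ℕ) (b : Fin (F.rank (i + 1))) :
    ∃ a, F.deg i a < F.deg (i + 1) b := by
  -- A vanishing column would make a basis vector a boundary, but boundaries have no constant
  -- coefficients.
  have hne : F.d i (Pi.single b 1) ≠ 0 := by
    intro h0
    obtain ⟨y, hy⟩ := (F.exact_succ i _).mp h0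
    have h1 : constantCoeff (F.d (i + 1) y b) = 0 := by
      rw [← linearMap_eq_linearCombination (F.d (i + 1)), Fintype.linearCombination_apply,
        Finset.sum_apply, map_sum]
      refine Finset.sum_eq_zero fun c _ => ?_
      rw [Pi.smul_apply, smul_eq_mul, map_mul, F.minimal, mul_zero]
    rw [hy, Pi.single_eq_same, map_one] at h1
    exact one_ne_zero h1
  obtain ⟨a, ha⟩ := Function.ne_iff.mp hne
  rcases F.d_homogeneous i b a with h | ⟨k, hk, hhom⟩
  · exact absurd h ha
  · refine ⟨a, ?_⟩
    rcases Nat.eq_zero_or_pos k with rfl | hpos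
    · have h1 := F.minimal i b a
      rw [(totalDegree_eq_zero_iff_eq_C.mp (Nat.le_zero.mp hhom.totalDegree_le)),
        constantCoeff_C] at h1
      refine absurd ?_ ha
      rw [(totalDegree_eq_zero_iff_eq_C.mp (Nat.le_zero.mp hhom.totalDegree_le)), h1, map_zero]
      rfl
    · omega

/-- Strict growth from an arbitrary starting step: step two with bound four excludes the linear
strand, step one with bound two handles the colon ideal. -/
lemma MinimalGradedFreeResolution.le_deg {M : Type*} [AddCommGroup M] [Module K M]
    [Module (MvPolynomial σ K) M] {𝓜 : ℕ → Submodule K M}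
    (F : MinimalGradedFreeResolution (σ := σ) 𝓜) {i m : ℕ} (h : ∀ a, m ≤ F.deg i a) (k : ℕ)
    (b : Fin (F.rank (i + k))) : m + k ≤ F.deg (i + k) b := by
  induction k with
  | zero => exact h b
  | succ k ih =>
    obtain ⟨a, ha⟩ := F.exists_deg_lt (i + k) b
    have := ih a
    change m + (k + 1) ≤ F.deg (i + k + 1) b
    omega

lemma quotientBetti_eq_zero_of_deg_ne {I : Ideal (MvPolynomial σ K)}
    (F : MinimalGradedFreeResolution (σ := σ) (quotientGrading I))
    (hF : F.toGradedRes.AugSurjective) {i j : ℕ} (h : ∀ a, F.deg i a ≠ j) :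
    quotientBetti I i j = 0 := by
  rw [quotientBetti_eq F hF, GradedRes.betti, Nat.card_eq_zero]
  exact Or.inl ⟨fun a => h a.1 a.2⟩

/-- A homogeneous ideal without elements of degree at most one has no linear strand in its
resolution. -/
theorem quotientBetti_diagonal_eq_zero [Finite σ] {I : Ideal (MvPolynomial σ K)}
    (hI : ∀ x ∈ I, ∀ j, homogeneousComponent j x ∈ I)
    (hI1 : ∀ x ∈ I, ∀ m : σ →₀ ℕ, m.degree ≤ 1 → coeff m x = 0) {i : ℕ} (hi : 0 < i) :
    quotientBetti I i i = 0 := by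
  let N : Submodule (MvPolynomial σ K) (Fin 1 → MvPolynomial σ K) :=
    Submodule.comap (LinearMap.proj 0) I
  obtain ⟨r, e, g, hg, hmin⟩ := exists_minimal_homogGen (fun _ : Fin 1 => 0) N (by
    intro x hx j
    have := hI (x 0) hx j
    simpa [N, degComp] using this)
  have hgI : ∀ b, g b 0 ∈ I := fun b => by
    have : g b ∈ N := hg.span ▸ Submodule.subset_span ⟨b, rfl⟩
    exact this
  have hspan : Ideal.span (Set.range fun b => g b 0) = I := by
    apply le_antisymm
    · rw [Ideal.span_le]
      rintro _ ⟨b, rfl⟩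
      exact hgI b
    · intro x hx
      have hx' : (fun _ => x) ∈ Submodule.span (MvPolynomial σ K) (Set.range g) := by
        rw [hg.span]; exact hx
      rw [← Fintype.range_linearCombination] at hx'
      obtain ⟨y, hy⟩ := hx'
      have := congrFun hy 0
      rw [Fintype.linearCombination_apply, Finset.sum_apply] at this
      rw [← this]
      exact sum_mem fun b _ => Ideal.mul_mem_left _ _ (Ideal.subset_span ⟨b, rfl⟩)
  have he : ∀ b, 2 ≤ e b := by
    intro b
    by_contra hlt
    -- A generator of degree at most one vanishes by `hI1`, and a zero vector satisfies a relation
    -- with coefficient one, contrary to minimality.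
    have h0 : g b = 0 := by
      funext a
      rw [Subsingleton.elim a 0]
      ext m
      by_contra hne
      rw [Pi.zero_apply, coeff_zero] at hne
      have : m.degree + 0 = e b := hg.homog b 0 m hne
      exact hne (hI1 _ (hgI b) m (by omega))
    have := hmin (Pi.single b 1) (by rw [Fintype.linearCombination_apply_single, h0, smul_zero]) b
    simp at this
  obtain ⟨F, hF, -, hdeg, -⟩ := exists_minimalResolution hg.homog hmin hspan
    (fun x hx => by rw [constantCoeff_eq]; exact hI1 x hx 0 (by simp))
  refine quotientBetti_eq_zero_of_deg_ne F hF fun a => ?_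
  obtain ⟨k, rfl⟩ := Nat.exists_eq_add_of_le hi
  have := F.le_deg (i := 1) (m := 2) (fun a => by
    obtain ⟨c, hc⟩ := hdeg a
    rw [hc]; exact he c) k a
  change F.deg (1 + k) a ≠ 1 + k
  omega

end Growth

/-- The resolution of the colon ideal of an edge has no linear strand. -/
theorem quotientBetti_colon_eq_zero {V K : Type*} [Field K] [Finite V] (G : SimpleGraph V)
    {u v : V} (huv : G.Adj u v) {i : ℕ} (hi : 0 < i) :
    quotientBetti ((parityIdeal K (G.deleteEdges {s(u, v)})).colon {gBar K u v}) i i = 0 := by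
  refine quotientBetti_diagonal_eq_zero (fun x hx j => ?_) (fun x hx m hm => ?_) hi
  · rw [Submodule.mem_colon_singleton, smul_eq_mul] at hx ⊢
    -- Multiplication by `gBar` is viewed as a homogeneous matrix of size one with source degree
    -- two, so it shifts components by two.
    have h := linearCombination_degComp (degα := fun _ : Fin 1 => 2) (degβ := fun _ : Fin 1 => 0)
      (D := fun _ _ => gBar K u v) (fun _ _ m hm => by
        simpa using isHomogeneous_iff_degSupp.mp (gBar_isHomogeneous (K := K) u v) m hm)
      (j + 2) (fun _ => x)
    have h' := congrFun h 0
    simp only [Fintype.linearCombination_apply, Fin.sum_univ_one, Pi.smul_apply, smul_eq_mul,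
      degComp, Nat.le_add_left, if_true, Nat.add_sub_cancel, Nat.sub_zero] at h'
    rw [h']
    exact homogeneousComponent_mem_gIdeal hx _
  · rw [Submodule.mem_colon_singleton, smul_eq_mul] at hx
    refine coeff_eq_zero_of_mul_gBar_mem (E := (G.deleteEdges {s(u, v)}).Adj) huv.ne ?_ hx hm
    intro a b hab
    exact ⟨hab.ne, fun h => by simp [h] at hab⟩

/-! ### The edge generators, their syzygies and the main theorem. -/

section EdgeGenerators

variable {V K : Type*} [Field K]

lemma exists_edge_enumeration [Finite V] (G : SimpleGraph V) :
    ∃ u v : Fin G.edgeSet.ncard → V, (∀ b, G.Adj (u b) (v b)) ∧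
      (∀ b c, s(u b, v b) = s(u c, v c) → b = c) ∧
      ∀ a c, G.Adj a c → ∃ b, s(a, c) = s(u b, v b) := by
  have e : Fin G.edgeSet.ncard ≃ G.edgeSet := (Finite.equivFin G.edgeSet).symm
  have hq : ∀ z : Sym2 V, ∃ p : V × V, s(p.1, p.2) = z := fun z => by
    induction z using Sym2.ind with
    | h a b => exact ⟨(a, b), rfl⟩
  choose q hq using hq
  refine ⟨fun b => (q (e b)).1, fun b => (q (e b)).2, fun b => ?_, fun b c h => ?_,
    fun a c h => ?_⟩
  · rw [← SimpleGraph.mem_edgeSet, hq]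
    exact (e b).2
  · simp only [hq] at h
    exact e.injective (Subtype.ext h)
  · refine ⟨e.symm ⟨s(a, c), h⟩, ?_⟩
    rw [hq, e.apply_symm_apply]

/-- The generators of the parity binomial edge ideal as vectors of length one. -/
noncomputable def edgeFamily {s : ℕ} (K : Type*) [Field K] (u v : Fin s → V) :
    Fin s → Fin 1 → EdgeRing V K :=
  fun b _ => gBar K (u b) (v b)

variable {s : ℕ} {u v : Fin s → V}

lemma span_edgeFamily {G : SimpleGraph V} (huv : ∀ b, G.Adj (u b) (v b))
    (hG : ∀ a c, G.Adj a c → ∃ b, s(a, c) = s(u b, v b)) :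
    Ideal.span (Set.range fun b => edgeFamily K u v b 0) = parityIdeal K G := by
  apply le_antisymm
  · rw [Ideal.span_le]
    rintro _ ⟨b, rfl⟩
    exact gBar_mem_gIdeal (E := G.Adj) (huv b)
  · refine gIdeal_le (E := G.Adj) fun a c hac => Ideal.subset_span ?_
    obtain ⟨b, hb⟩ := hG a c hac
    refine ⟨b, ?_⟩
    rcases Sym2.eq_iff.mp hb with ⟨rfl, rfl⟩ | ⟨rfl, rfl⟩
    · rfl
    · exact gBar_swap _ _

lemma degSupp_edgeFamily (b : Fin s) : DegSupp (fun _ => 0) {2} (edgeFamily K u v b) :=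
  fun _ m hm => by
    simpa using isHomogeneous_iff_degSupp.mp (gBar_isHomogeneous (K := K) (u b) (v b)) m hm

lemma linearCombination_edgeFamily (x : Fin s → EdgeRing V K) :
    Fintype.linearCombination (EdgeRing V K) (edgeFamily K u v) x 0 =
      ∑ b, x b * gBar K (u b) (v b) := by
  rw [Fintype.linearCombination_apply, Finset.sum_apply]
  rfl

/-- The coefficients of a syzygy of the generators have no terms of degree at most one. -/
lemma coeff_eq_zero_of_linearCombination_edgeFamily (huv : ∀ b, u b ≠ v b)
    (hinj : ∀ b c, s(u b, v b) = s(u c, v c) → b = c) {x : Fin s → EdgeRing V K}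
    (hx : Fintype.linearCombination (EdgeRing V K) (edgeFamily K u v) x = 0)
    (b : Fin s) {m : V ⊕ V →₀ ℕ} (hm : m.degree ≤ 1) : coeff m (x b) = 0 := by
  obtain ⟨M, h1, h2⟩ := exists_coeff_mul_gBar (K := K) (huv b) hm
  apply h1
  have h := congrArg (coeff M) (congrFun hx 0)
  rw [linearCombination_edgeFamily, coeff_sum, Finset.sum_eq_single b, Pi.zero_apply,
    coeff_zero] at h
  · exact h
  · exact fun c _ hcb => h2 _ _ _ (huv c) fun h => hcb (hinj _ _ h)
  · exact fun hb => absurd (Finset.mem_univ b) hb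

lemma edgeFamily_isMinimalFamily (huv : ∀ b, u b ≠ v b)
    (hinj : ∀ b c, s(u b, v b) = s(u c, v c) → b = c) : IsMinimalFamily (edgeFamily K u v) :=
  fun x hx b => by
    rw [constantCoeff_eq]
    exact coeff_eq_zero_of_linearCombination_edgeFamily huv hinj hx b (by simp)

/-- The syzygies of the generators start in degree four. -/
lemma four_le_of_syzygies {t : ℕ} {D : Fin t → Fin s → EdgeRing V K} {δ : Fin t → ℕ}
    (huv : ∀ b, u b ≠ v b) (hinj : ∀ b c, s(u b, v b) = s(u c, v c) → b = c)
    (hD : ∀ b, DegSupp (fun _ => 2) {δ b} (D b)) (hmin : IsMinimalFamily D)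
    (hker : LinearMap.range (Fintype.linearCombination (EdgeRing V K) D) =
      LinearMap.ker (Fintype.linearCombination (EdgeRing V K) (edgeFamily K u v))) (b : Fin t) :
    4 ≤ δ b := by
  by_contra hlt
  have hDb : D b ∈ LinearMap.ker (Fintype.linearCombination (EdgeRing V K) (edgeFamily K u v)) := by
    rw [← hker]
    exact ⟨Pi.single b 1, by rw [Fintype.linearCombination_apply_single, one_smul]⟩
  have h0 : D b = 0 := by
    funext c
    ext m
    by_contra hne
    rw [Pi.zero_apply, coeff_zero] at hne
    have : m.degree + 2 = δ b := hD b c m hne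
    exact hne (coeff_eq_zero_of_linearCombination_edgeFamily huv hinj hDb c (by omega))
  have := hmin (Pi.single b 1) (by rw [Fintype.linearCombination_apply_single, h0, smul_zero]) b
  simp at this

/-- The syzygy that expresses the commutativity of two generators. -/
noncomputable def commSyzygy (K : Type*) [Field K] (u v : Fin s → V) (b c : Fin s) :
    Fin s → EdgeRing V K :=
  Pi.single b (gBar K (u c) (v c)) - Pi.single c (gBar K (u b) (v b))

lemma commSyzygy_mem_ker (b c : Fin s) :
    Fintype.linearCombination (EdgeRing V K) (edgeFamily K u v) (commSyzygy K u v b c) = 0 := by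
  rw [commSyzygy, map_sub, Fintype.linearCombination_apply_single,
    Fintype.linearCombination_apply_single]
  funext a
  simp only [edgeFamily, Pi.sub_apply, Pi.smul_apply, smul_eq_mul, Pi.zero_apply]
  ring

lemma degSupp_single {b : Fin s} {p : EdgeRing V K} (hp : p.IsHomogeneous 2) :
    DegSupp (fun _ => 2) {4} (Pi.single b p : Fin s → EdgeRing V K) := by
  intro a m hm
  by_cases h : a = b
  · subst h
    rw [Pi.single_eq_same] at hm
    simp [isHomogeneous_iff_degSupp.mp hp m hm]
  · rw [Pi.single_eq_of_ne h, coeff_zero] at hm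
    exact absurd rfl hm

lemma degSupp_commSyzygy (b c : Fin s) : DegSupp (fun _ => 2) {4} (commSyzygy K u v b c) :=
  (degSupp_single (gBar_isHomogeneous _ _)).sub (degSupp_single (gBar_isHomogeneous _ _))

/-- The pairs of elements of `Fin s` in increasing order. -/
abbrev IncreasingPair (s : ℕ) : Type := {p : Fin s × Fin s // p.1 < p.2}

lemma card_increasingPair (s : ℕ) : Fintype.card (IncreasingPair s) = s.choose 2 := by
  have e : IncreasingPair s ≃ Σ c : Fin s, Fin c :=
    { toFun := fun p => ⟨p.1.2, ⟨p.1.1, p.2⟩⟩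
      invFun := fun q => ⟨(⟨q.2, q.2.2.trans q.1.2⟩, q.1), q.2.2⟩
      left_inv := fun _ => rfl
      right_inv := fun _ => rfl }
  rw [Fintype.card_congr e, Fintype.card_sigma]
  simp only [Fintype.card_fin]
  rw [Fin.sum_univ_eq_sum_range (fun i => i), Finset.sum_range_id, Nat.choose_two_right]

/-- The commutation syzygies are linearly independent over the ground field. -/
lemma eq_zero_of_sum_commSyzygy_eq_zero (huv : ∀ b, u b ≠ v b)
    (hinj : ∀ b c, s(u b, v b) = s(u c, v c) → b = c) {l : IncreasingPair s → K}
    (h : ∑ p, (C (l p) : EdgeRing V K) • commSyzygy K u v p.1.1 p.1.2 = 0) (p : IncreasingPair s) : l p = 0 := by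
  -- Within the component at `p.1.1`, the monomial `M` singles out the generator of the edge
  -- `p.1.2`. Only the pair `p` contributes: the reversed pair is excluded because pairs are
  -- increasing.
  obtain ⟨M, h1, h2⟩ := exists_coeff_mul_gBar (K := K) (huv p.1.2) (m := 0) (by simp)
  have h2' : ∀ c, c ≠ p.1.2 → coeff M (gBar K (u c) (v c)) = 0 := fun c hc => by
    have := h2 1 _ _ (huv c) fun h => hc (hinj _ _ h)
    rwa [one_mul] at this
  have hz := congrArg (coeff M) (congrFun h p.1.1)
  rw [Finset.sum_apply, coeff_sum, Finset.sum_eq_single p] at hz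
  · have hne : p.1.1 ≠ p.1.2 := p.2.ne
    simp only [commSyzygy, Pi.smul_apply, Pi.sub_apply, Pi.single_eq_same,
      Pi.single_eq_of_ne hne, sub_zero, smul_eq_mul, Pi.zero_apply, coeff_zero] at hz
    have := h1 _ hz
    simpa using this
  · intro q _ hq
    rw [Pi.smul_apply, smul_eq_mul, coeff_C_mul, commSyzygy, Pi.sub_apply, coeff_sub]
    have e1 : coeff M ((Pi.single q.1.1 (gBar K (u q.1.2) (v q.1.2)) :
        Fin s → EdgeRing V K) p.1.1) = 0 := by
      by_cases h : p.1.1 = q.1.1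
      · rw [h, Pi.single_eq_same]
        exact h2' _ fun h' => hq (Subtype.ext (Prod.ext h.symm h'))
      · rw [Pi.single_eq_of_ne h, coeff_zero]
    have e2 : coeff M ((Pi.single q.1.2 (gBar K (u q.1.1) (v q.1.1)) :
        Fin s → EdgeRing V K) p.1.1) = 0 := by
      by_cases h : p.1.1 = q.1.2
      · rw [h, Pi.single_eq_same]
        refine h2' _ fun h' => ?_
        have := p.2
        have := q.2
        rw [h'] at this
        rw [h] at *
        exact absurd this (by omega)
      · rw [Pi.single_eq_of_ne h, coeff_zero]
    rw [e1, e2, sub_zero, mul_zero]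
  · exact fun hp => absurd (Finset.mem_univ p) hp

/-- The number of generators of degree four of the syzygies of the edge generators. -/
theorem choose_two_le_card_syzygies {t : ℕ} {D : Fin t → Fin s → EdgeRing V K} {δ : Fin t → ℕ}
    (huv : ∀ b, u b ≠ v b) (hinj : ∀ b c, s(u b, v b) = s(u c, v c) → b = c)
    (hD : ∀ b, DegSupp (fun _ => 2) {δ b} (D b)) (hδ : ∀ b, 4 ≤ δ b)
    (hker : LinearMap.range (Fintype.linearCombination (EdgeRing V K) D) =
      LinearMap.ker (Fintype.linearCombination (EdgeRing V K) (edgeFamily K u v))) :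
    s.choose 2 ≤ Nat.card {a // δ a = 4} := by
  classical
  have hy : ∀ p : IncreasingPair s, ∃ y, DegSupp δ {4} y ∧
      Fintype.linearCombination (EdgeRing V K) D y = commSyzygy K u v p.1.1 p.1.2 := by
    intro p
    have hmem : commSyzygy K u v p.1.1 p.1.2 ∈
        LinearMap.range (Fintype.linearCombination (EdgeRing V K) D) := by
      rw [hker]
      exact commSyzygy_mem_ker _ _
    obtain ⟨x, hx⟩ := hmem
    exact exists_degSupp_preimage hD (degSupp_commSyzygy _ _) hx
  choose y hy hyD using hy
  -- The generators of the syzygies have degree at least four, so a preimage of degree four has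
  -- constant entries, supported on the generators of degree four. Independence of the commutation
  -- syzygies passes to these vectors over `K`.
  have hconst : ∀ p a, y p a = C (constantCoeff (y p a)) := by
    intro p a
    ext m
    rw [coeff_C, constantCoeff_eq]
    split_ifs with h
    · rw [h]
    · by_contra hne
      have h1 : m.degree + δ a = 4 := hy p a m hne
      have h2 := hδ a
      exact h ((Finsupp.degree_eq_zero_iff m).mp (by omega)).symm
  have hzero : ∀ p a, δ a ≠ 4 → constantCoeff (y p a) = 0 := fun p a ha =>
    constantCoeff_eq_zero_of_degSupp (hy p) ha
  have hli : LinearIndependent K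
      (fun (p : IncreasingPair s) (a : {a // δ a = 4}) => constantCoeff (y p a)) := by
    rw [Fintype.linearIndependent_iff]
    intro l hl p
    refine eq_zero_of_sum_commSyzygy_eq_zero (K := K) huv hinj (l := l) ?_ p
    have h0 : ∑ q, (C (l q) : EdgeRing V K) • y q = 0 := by
      funext a
      rw [Finset.sum_apply]
      have : ∀ q, ((C (l q) : EdgeRing V K) • y q) a = C (l q * constantCoeff (y q a)) := fun q => by
        rw [Pi.smul_apply, smul_eq_mul, C_mul, ← hconst]
      rw [Finset.sum_congr rfl fun q _ => this q, ← map_sum]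
      by_cases ha : δ a = 4
      · have := congrFun hl ⟨a, ha⟩
        rw [Finset.sum_apply] at this
        simp only [Pi.smul_apply, smul_eq_mul, Pi.zero_apply] at this
        rw [this, map_zero, Pi.zero_apply]
      · rw [Finset.sum_eq_zero fun q _ => by rw [hzero q a ha, mul_zero], map_zero, Pi.zero_apply]
    rw [Finset.sum_congr rfl fun q _ => by rw [← hyD q, ← map_smul], ← map_sum, h0, map_zero]
  have := hli.fintype_card_le_finrank
  rwa [card_increasingPair, Module.finrank_fintype_fun_eq_card, ← Nat.card_eq_fintype_card] at this

end EdgeGenerators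

/-- The minimal resolution of the parity binomial edge ideal: its first generators have degree two,
the second ones have degree at least four, and the commutation syzygies contribute to the latter. -/
theorem exists_parityResolution {V K : Type*} [Field K] [Finite V] (G : SimpleGraph V) :
    ∃ F : MinimalGradedFreeResolution (σ := V ⊕ V) (quotientGrading (parityIdeal K G)),
      F.toGradedRes.AugSurjective ∧ (∀ a, F.deg 0 a = 0) ∧ (∀ a, 4 ≤ F.deg 2 a) ∧
      G.edgeSet.ncard.choose 2 ≤ Nat.card {a // F.deg 2 a = 4} := by
  obtain ⟨u, v, hadj, hinj, hG⟩ := exists_edge_enumeration G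
  have huv : ∀ b, u b ≠ v b := fun b => (hadj b).ne
  obtain ⟨F, hF, h0, -, D, hD, hmin, hker⟩ := exists_minimalResolution
    (e := fun _ => 2) (degSupp_edgeFamily (K := K)) (edgeFamily_isMinimalFamily huv hinj)
    (span_edgeFamily hadj hG) (fun x hx => by
      have : parityIdeal K G ≤ RingHom.ker constantCoeff := gIdeal_le (E := G.Adj)
        fun a b _ => by simp [gBar, RingHom.mem_ker]
      exact this hx)
  have h4 := four_le_of_syzygies huv hinj hD hmin hker
  exact ⟨F, hF, h0, h4, choose_two_le_card_syzygies huv hinj hD h4 hker⟩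

theorem theorem3p8 {K : Type*} [Field K] (n : ℕ) (G : SimpleGraph (Fin n)) :
    (quotientBetti (parityIdeal K G) 2 3 = 0 ∧
      ∀ i : ℕ, i ≠ 1 → quotientBetti (parityIdeal K G) i (i + 1) = 0) ∧
    (IsEmpty (G ≃g (⊤ : SimpleGraph (Fin 2))) →
      G.edgeSet.ncard.choose 2 ≤ quotientBetti (parityIdeal K G) 2 4) ∧
    (∀ u v : Fin n, G.Adj u v → ∀ i : ℕ, 0 < i →
      quotientBetti
        ((parityIdeal K (G.deleteEdges {s(u, v)})).colon {gBar K u v}) i i = 0) ∧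
    (¬ G.IsBipartite → quotientBetti (parityIdeal K G) 3 6 ≠ 0) ∧
    (IsOddUnicyclic G → ∀ i j : ℕ, 2 * i < j →
      quotientBetti (parityIdeal K G) i j = 0) := by
  obtain ⟨F, hF, h0, h4, hcard⟩ := exists_parityResolution (K := K) G
  have hlin : ∀ i : ℕ, i ≠ 1 → quotientBetti (parityIdeal K G) i (i + 1) = 0 := by
    intro i hi
    refine quotientBetti_eq_zero_of_deg_ne F hF fun a => ?_
    -- In step zero only degree zero occurs; otherwise `i ≠ 1` leaves `2 ≤ i`, where all degrees are
    -- at least `i + 2`.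
    rcases Nat.eq_zero_or_pos i with rfl | hpos
    · rw [h0 a]
      exact zero_ne_one
    · obtain ⟨k, rfl⟩ := Nat.exists_eq_add_of_le (show 2 ≤ i by omega)
      have := F.le_deg h4 k a
      omega
  refine ⟨⟨hlin 2 (by norm_num), hlin⟩, fun _ => ?_, fun u v huv i hi =>
    quotientBetti_colon_eq_zero G huv hi,
    quotientBetti_three_six_ne_zero_of_not_isBipartite ⟨F⟩,
    fun h i j hij => h.quadTower.quotientBetti_eq_zero hij⟩
  rw [quotientBetti_eq F hF]
  exact hcard
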